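/- Let $p$ be a prime, $K$ a finite unramified extension of $\mathbb Q_p$ of degree $f$, $q=p^f$, and $E$ a finite extension of $\mathbb Q_p$ with an embedding $\sigma_0:K\hookrightarrow E$; put $\sigma_i=\sigma_0\circ\mathrm{Frob}_p^i$. Normalize the norm of $E$ by $|\pi|=p^{-1}$ for a uniformizer $\pi$. In $\mathcal O_E[[\mathcal O_K]]=\varprojlim_n\mathcal O_E[\mathcal O_K/p^n]$ let $$Y_{\sigma_i}=\sum_{\lambda\in\mathbb F_q^\times}\sigma_i([\lambda])^{-1}\,[[\lambda]]\qquad(0\le i\le f-1),$$ where the outer bracket denotes a group-like element and $[\lambda]\in\mathcal O_K$ is the Teichmüller lift; for $K=\mathbb Q_2$ put $Y_{\sigma_0}=[1]-1$. Then $\mathcal O_E[[\mathcal O_K]]=\mathcal O_E[[Y_{\sigma_0},\dots,Y_{\sigma_{f-1}}]]$. Let $s\ge1$ be an integer. Let $A^{\dagger,s^-}_{\mathrm{mv},E}$ be the ring of series $$x=\sum_{m\in\mathbb Z,\ \underline n\in\mathbb Z^{f-1}}a_{m,\underline n}\,Y_{\sigma_0}^m\prod_{i=1}^{f-1}\left(\frac{Y_{\sigma_i}}{Y_{\sigma_0}}\right)^{n_i},\qquad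 a_{m,\underline n}\in\mathcal O_E,$$ such that $|a_{m,\underline n}|p^{-m/s}\le1$ for all $(m,\underline n)$ and $|a_{m,\underline n}|p^{-m/s}\to0$ as $|m|+|\underline n|\to\infty$, with the norm $\|x\|_s=\sup|a_{m,\underline n}|p^{-m/s}$. Put $W=A^{\dagger,s^-}_{\mathrm{mv},E}[1/Y_{\sigma_0}]$ with the norm extending $\|\cdot\|_s$, and let $\widehat W$ be the $E$-Banach algebra obtained by completing $W[1/p]$, i.e. the series as above with $a_{m,\underline n}\in E$ and $|a_{m,\underline n}|p^{-m/s}\to0$. There is exactly one action of $\mathcal O_K^\times$ on $W$ by continuous $\mathcal O_E$-algebra automorphisms that extends the action $a\cdot[x]=[ax]$ on $\mathcal O_E[[\mathcal O_K]]\subset W$. This action is locally $\mathbb Q_p$-analytic, in the following sense (as $p$ is not invertible in $W$, coefficients are taken in $\widehat W$): for every $x\in W$ and every $\mathbb Q_p$-basis $b_1,\dots,b_f$ of $K$ there are $m\ge0$ and elements $w_{\underline k}\in\widehat W$ $(\underline k\in\mathbb N^f)$ with $w_{\underline k}\to0$ such that $$\gamma(x)=\sum_{\underline k\in\mathbb N^f}t_1^{k_1}\cdots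 t_f^{k_f}\,w_{\underline k}$$ whenever $\gamma=1+p^m\sum_jt_jb_j\in\mathcal O_K^\times$ with $t_j\in\mathbb Z_p$. Moreover, $\|\gamma(x)-x\|_s\le p^{-1/(p-1)}$ for all $\gamma\in\mathcal O_K^\times\cap(1+p^s\mathcal O_K)$ and all $x\in A^{\dagger,s^-}_{\mathrm{mv},E}$. -/

import Mathlib

open Filter Topology

set_option linter.unusedSectionVars false

noncomputable section

namespace MultivarOC

/-! ### Rings of integers, normalizations -/

/-- The closed unit ball of an ultrametric normed field, i.e. its ring of integers when the field
is a finite extension of `ℚ_[p]` with a norm defining its `p`-adic topology. -/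
def intRing (F : Type*) [NormedField F] [IsUltrametricDist F] : Subring F where
  carrier := {x | ‖x‖ ≤ 1}
  mul_mem' := by
    intro a b ha hb
    simp only [Set.mem_ofPred_eq, norm_mul] at *
    exact mul_le_one₀ ha (norm_nonneg _) hb
  one_mem' := by simp
  add_mem' := by
    intro a b ha hb
    exact (IsUltrametricDist.norm_add_le_max a b).trans (max_le ha hb)
  zero_mem' := by simp
  neg_mem' := by
    intro a ha
    simpa using ha

/-- The norm of the extension `E` of `ℚ_[p]` is the `p`-adic one, normalized so that a uniformizer
has norm `p⁻¹`. (The exponent `e` is then the ramification index.) -/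
structure IsNormalizedPadicNorm (p : ℕ) [Fact p.Prime] (E : Type*) [NormedField E]
    [Algebra ℚ_[p] E] : Prop where
  restrict : ∃ e : ℕ, 0 < e ∧ ∀ x : ℚ_[p], ‖algebraMap ℚ_[p] E x‖ = ‖x‖ ^ e
  uniformizer : ∃ ϖ : E, ‖ϖ‖ = (p : ℝ)⁻¹ ∧ ∀ x : E, ‖x‖ < 1 → ‖x‖ ≤ ‖ϖ‖

/-- `K`, with the norm extending that of `ℚ_[p]`, has ramification index one:
`p` is a uniformizer of `K`. -/
def IsUnramified (p : ℕ) [Fact p.Prime] (K : Type*) [NormedField K] [NormedAlgebra ℚ_[p] K] :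
    Prop :=
  ∀ x : K, ‖x‖ < 1 → ‖x‖ ≤ ‖(p : K)‖

/-! ### Laurent series in `Y_0` and `Y_i / Y_0` -/

/-- Exponents: `(m, n)` stands for the monomial `Y_0 ^ m * ∏_{1 ≤ i ≤ f - 1} (Y_i / Y_0) ^ (n i)`;
the index `j : Fin (f - 1)` stands for `i = j + 1`. -/
abbrev Expo (f : ℕ) : Type := ℤ × (Fin (f - 1) → ℤ)

/-- The norm `p ^ (-m / s)` of the monomial with exponent `(m, n)`. -/
def weight (p s : ℕ) {f : ℕ} (k : Expo f) : ℝ := (p : ℝ) ^ (-(k.1 : ℝ) / (s : ℝ))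

section weight
variable {p : ℕ} [Fact p.Prime] {s f : ℕ}

lemma weight_pos (k : Expo f) : 0 < weight p s k :=
  Real.rpow_pos_of_pos (by exact_mod_cast (Fact.out : p.Prime).pos) _

lemma weight_add (k l : Expo f) : weight p s (k + l) = weight p s k * weight p s l := by
  have hp : (0 : ℝ) < p := by exact_mod_cast (Fact.out : p.Prime).pos
  rw [weight, weight, weight, ← Real.rpow_add hp]
  congr 1
  push_cast [Prod.fst_add]
  ring

lemma weight_zero : weight p s (0 : Expo f) = 1 := by simp [weight]

end weight

variable (p : ℕ) [Fact p.Prime] (s f : ℕ) (E : Type*) [NormedField E]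

/-- Laurent series `∑ a_{m,n} Y_0 ^ m ∏ (Y_i / Y_0) ^ (n i)` with coefficients in `E` such that
`‖a_{m,n}‖ p ^ (-m / s)` tends to zero: the `E`-Banach algebra of functions on
the polyannulus `|Y_0| = ... = |Y_{f-1}| = p ^ (-1 / s)`. -/
@[ext] structure Laurent where
  coeff : Expo f → E
  tendsto_coeff : Tendsto (fun k => ‖coeff k‖ * weight p s k) cofinite (𝓝 0)

namespace Laurent

variable {p s f E}

lemma coeff_injective : Function.Injective (coeff : Laurent p s f E → Expo f → E) :=
  fun _ _ h => Laurent.ext h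

instance : Zero (Laurent p s f E) := ⟨⟨0, by simp⟩⟩

instance : Neg (Laurent p s f E) := ⟨fun a => ⟨-a.coeff, by simpa using a.tendsto_coeff⟩⟩

instance : Add (Laurent p s f E) := ⟨fun a b => ⟨a.coeff + b.coeff, by
  have h := a.tendsto_coeff.add b.tendsto_coeff
  rw [add_zero] at h
  refine squeeze_zero (fun k => mul_nonneg (norm_nonneg _) (weight_pos k).le) (fun k => ?_) h
  rw [← add_mul]
  exact mul_le_mul_of_nonneg_right (norm_add_le _ _) (weight_pos k).le⟩⟩

instance : Sub (Laurent p s f E) := ⟨fun a b => ⟨a.coeff - b.coeff, by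
  have h := a.tendsto_coeff.add b.tendsto_coeff
  rw [add_zero] at h
  refine squeeze_zero (fun k => mul_nonneg (norm_nonneg _) (weight_pos k).le) (fun k => ?_) h
  rw [← add_mul]
  exact mul_le_mul_of_nonneg_right (norm_sub_le _ _) (weight_pos k).le⟩⟩

instance : SMul E (Laurent p s f E) := ⟨fun c a => ⟨c • a.coeff, by
  have h := a.tendsto_coeff.const_mul ‖c‖
  rw [mul_zero] at h
  refine h.congr fun k => ?_
  simp [mul_assoc]⟩⟩

instance : SMul ℕ (Laurent p s f E) := ⟨fun c a => ⟨c • a.coeff, by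
  have h := a.tendsto_coeff.const_mul ‖(c : E)‖
  rw [mul_zero] at h
  refine h.congr fun k => ?_
  simp [mul_assoc]⟩⟩

instance : SMul ℤ (Laurent p s f E) := ⟨fun c a => ⟨c • a.coeff, by
  have h := a.tendsto_coeff.const_mul ‖(c : E)‖
  rw [mul_zero] at h
  refine h.congr fun k => ?_
  simp [mul_assoc]⟩⟩

@[simp] lemma coeff_zero : (0 : Laurent p s f E).coeff = 0 := rfl
@[simp] lemma coeff_neg (a : Laurent p s f E) : (-a).coeff = -a.coeff := rfl
@[simp] lemma coeff_add (a b : Laurent p s f E) : (a + b).coeff = a.coeff + b.coeff := rfl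
@[simp] lemma coeff_sub (a b : Laurent p s f E) : (a - b).coeff = a.coeff - b.coeff := rfl
@[simp] lemma coeff_smul (c : E) (a : Laurent p s f E) : (c • a).coeff = c • a.coeff := rfl

instance instAddCommGroup : AddCommGroup (Laurent p s f E) :=
  coeff_injective.addCommGroup _ rfl (fun _ _ => rfl) (fun _ => rfl) (fun _ _ => rfl)
    (fun _ _ => rfl) (fun _ _ => rfl)

/-- The coefficients, as an additive homomorphism. -/
def coeffHom : Laurent p s f E →+ (Expo f → E) where
  toFun := coeff
  map_zero' := rfl
  map_add' _ _ := rfl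

instance : Module E (Laurent p s f E) :=
  coeff_injective.module E coeffHom (fun _ _ => rfl)

/-! #### The norm -/

/-- `‖∑ a_{m,n} Y_0 ^ m ∏ (Y_i / Y_0) ^ (n i)‖_s = sup ‖a_{m,n}‖ p ^ (-m / s)`. -/
instance : Norm (Laurent p s f E) := ⟨fun a => ⨆ k, ‖a.coeff k‖ * weight p s k⟩

lemma norm_def (a : Laurent p s f E) : ‖a‖ = ⨆ k, ‖a.coeff k‖ * weight p s k := rfl

lemma bddAbove (a : Laurent p s f E) :
    BddAbove (Set.range fun k => ‖a.coeff k‖ * weight p s k) :=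
  a.tendsto_coeff.bddAbove_range_of_cofinite

lemma le_norm (a : Laurent p s f E) (k : Expo f) : ‖a.coeff k‖ * weight p s k ≤ ‖a‖ :=
  le_ciSup a.bddAbove k

instance : NormedAddCommGroup (Laurent p s f E) :=
  AddGroupNorm.toNormedAddCommGroup
    { toFun := fun a => ‖a‖
      map_zero' := by simp [norm_def]
      neg' := fun a => by simp [norm_def]
      add_le' := fun a b => by
        refine ciSup_le fun k => ?_
        refine le_trans ?_ (add_le_add (a.le_norm k) (b.le_norm k))
        rw [← add_mul]
        exact mul_le_mul_of_nonneg_right (norm_add_le _ _) (weight_pos k).le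
      eq_zero_of_map_eq_zero' := fun a ha => by
        ext k
        have h := a.le_norm k
        rw [show ‖a‖ = 0 from ha] at h
        have hk := weight_pos (p := p) (s := s) k
        have : ‖a.coeff k‖ ≤ 0 := by
          by_contra hc
          push Not at hc
          exact absurd h (not_le.mpr (mul_pos hc hk))
        simpa using this }

/-! #### The ring structure -/

variable [IsUltrametricDist E] [CompleteSpace E]

lemma tendsto_prod (a b : Laurent p s f E) :
    Tendsto (fun x : Expo f × Expo f => ‖a.coeff x.1 * b.coeff x.2‖ * weight p s (x.1 + x.2))
      cofinite (𝓝 0) := by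
  refine (tendsto_mul_cofinite_nhds_zero a.tendsto_coeff b.tendsto_coeff).congr fun x => ?_
  rw [norm_mul, weight_add]
  ring

lemma tendsto_conv (a b : Laurent p s f E) (k : Expo f) :
    Tendsto (fun i => a.coeff i * b.coeff (k - i)) cofinite (𝓝 0) := by
  have h1 : Function.Injective (fun i : Expo f => (i, k - i)) := fun i j h => (Prod.ext_iff.mp h).1
  have h := ((tendsto_prod a b).comp h1.tendsto_cofinite).mul_const (weight p s k)⁻¹
  rw [zero_mul] at h
  rw [tendsto_zero_iff_norm_tendsto_zero]
  refine h.congr fun i => ?_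
  simp only [Function.comp_apply, add_sub_cancel]
  rw [mul_assoc, mul_inv_cancel₀ (weight_pos k).ne', mul_one]

lemma summable_conv (a b : Laurent p s f E) (k : Expo f) :
    Summable (fun i => a.coeff i * b.coeff (k - i)) :=
  NonarchimedeanAddGroup.summable_of_tendsto_cofinite_zero (tendsto_conv a b k)

lemma norm_conv_le (a b : Laurent p s f E) (k : Expo f) {C : ℝ} (hC : 0 ≤ C)
    (h : ∀ i, ‖a.coeff i * b.coeff (k - i)‖ ≤ C) :
    ‖∑' i, a.coeff i * b.coeff (k - i)‖ ≤ C :=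
  IsUltrametricDist.norm_tsum_le_of_forall_le_of_nonneg hC h

/-- Multiplication of Laurent series. -/
instance : Mul (Laurent p s f E) := ⟨fun a b =>
  ⟨fun k => ∑' i, a.coeff i * b.coeff (k - i), by
    rw [Metric.tendsto_nhds]
    intro ε hε
    have hfin := (Metric.tendsto_nhds.mp (tendsto_prod a b)) (ε / 2) (half_pos hε)
    rw [eventually_cofinite] at hfin ⊢
    refine (hfin.image (fun x => x.1 + x.2)).subset fun k hk => ?_
    by_contra hc
    apply hk
    have hw := weight_pos (p := p) (s := s) k
    have key : ∀ i, ‖a.coeff i * b.coeff (k - i)‖ ≤ ε / 2 / weight p s k := by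
      intro i
      by_contra hi
      refine hc ⟨(i, k - i), ?_, by simp⟩
      simp only [Set.mem_ofPred_eq, not_lt, add_sub_cancel, dist_zero_right]
      rw [Real.norm_of_nonneg (mul_nonneg (norm_nonneg _) hw.le)]
      rw [not_le, div_lt_iff₀ hw] at hi
      exact hi.le
    have h := norm_conv_le a b k (by positivity) key
    rw [le_div_iff₀ hw] at h
    rw [dist_zero_right, Real.norm_of_nonneg (mul_nonneg (norm_nonneg _) hw.le)]
    linarith⟩⟩

lemma coeff_mul (a b : Laurent p s f E) (k : Expo f) :
    (a * b).coeff k = ∑' i, a.coeff i * b.coeff (k - i) := rfl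

open Classical in
/-- The term `c * Y_0 ^ m * ∏ (Y_i / Y_0) ^ (n i)`, for `k = (m, n)`. -/
def single (k : Expo f) (c : E) : Laurent p s f E where
  coeff := Pi.single k c
  tendsto_coeff := by
    refine tendsto_nhds_of_eventually_eq ?_
    rw [eventually_cofinite]
    refine (Set.finite_singleton k).subset fun l hl => ?_
    by_contra hne
    apply hl
    simp only [Set.mem_singleton_iff] at hne
    simp [Pi.single_eq_of_ne hne]

instance : One (Laurent p s f E) := ⟨single 0 1⟩

lemma one_def : (1 : Laurent p s f E) = single 0 1 := rfl

lemma single_mul (k : Expo f) (c : E) (a : Laurent p s f E) (l : Expo f) :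
    (single k c * a).coeff l = c * a.coeff (l - k) := by
  classical
  rw [coeff_mul, tsum_eq_single k]
  · simp [single]
  · intro i hi
    simp [single, Pi.single_eq_of_ne hi]

protected lemma mul_comm (a b : Laurent p s f E) : a * b = b * a := by
  ext k
  rw [coeff_mul, coeff_mul, ← (Equiv.subLeft k).tsum_eq]
  refine tsum_congr fun i => ?_
  simp only [Equiv.subLeft_apply, sub_sub_cancel]
  exact mul_comm _ _

protected lemma one_mul (a : Laurent p s f E) : 1 * a = a := by
  ext k
  rw [one_def, single_mul]
  simp

protected lemma mul_add (a b c : Laurent p s f E) : a * (b + c) = a * b + a * c := by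
  ext k
  simp only [coeff_add, Pi.add_apply, coeff_mul]
  rw [← (summable_conv a b k).tsum_add (summable_conv a c k)]
  exact tsum_congr fun i => mul_add _ _ _

lemma tendsto_triple (a b c : Laurent p s f E) (k : Expo f) :
    Tendsto (Function.uncurry fun i j => a.coeff j * b.coeff (i - j) * c.coeff (k - i))
      cofinite (𝓝 0) := by
  have h0 := tendsto_mul_cofinite_nhds_zero
    (tendsto_mul_cofinite_nhds_zero a.tendsto_coeff b.tendsto_coeff) c.tendsto_coeff
  have h1 : Function.Injective
      (fun x : Expo f × Expo f => (((x.2, x.1 - x.2), k - x.1) : (Expo f × Expo f) × Expo f)) := by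
    rintro ⟨i, j⟩ ⟨i', j'⟩ h
    simp only [Prod.mk.injEq] at h
    obtain ⟨⟨h2, -⟩, h3⟩ := h
    simp only [Prod.mk.injEq]
    exact ⟨sub_right_injective h3, h2⟩
  have h := (h0.comp h1.tendsto_cofinite).mul_const (weight p s k)⁻¹
  rw [zero_mul] at h
  rw [tendsto_zero_iff_norm_tendsto_zero]
  refine h.congr ?_
  rintro ⟨i, j⟩
  have hw : weight p s k = weight p s j * weight p s (i - j) * weight p s (k - i) := by
    rw [← weight_add, ← weight_add]
    simp
  have hk := (weight_pos (p := p) (s := s) k).ne'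
  simp only [Function.comp_apply, Function.uncurry_apply_pair, norm_mul]
  rw [mul_inv_eq_iff_eq_mul₀ hk, hw]
  ring

protected lemma mul_assoc (a b c : Laurent p s f E) : a * b * c = a * (b * c) := by
  ext k
  have hs : Summable
      (Function.uncurry fun i j => a.coeff j * b.coeff (i - j) * c.coeff (k - i)) :=
    NonarchimedeanAddGroup.summable_of_tendsto_cofinite_zero (tendsto_triple a b c k)
  calc (a * b * c).coeff k
      = ∑' i, ∑' j, a.coeff j * b.coeff (i - j) * c.coeff (k - i) := by
        rw [coeff_mul]
        exact tsum_congr fun i => by rw [coeff_mul, tsum_mul_right]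
    _ = ∑' j, ∑' i, a.coeff j * b.coeff (i - j) * c.coeff (k - i) := hs.tsum_comm.symm
    _ = (a * (b * c)).coeff k := by
        rw [coeff_mul]
        refine tsum_congr fun j => ?_
        rw [coeff_mul, ← tsum_mul_left, ← (Equiv.addRight j).tsum_eq]
        refine tsum_congr fun i => ?_
        simp only [Equiv.coe_addRight, add_sub_cancel_right]
        rw [mul_assoc, sub_sub, add_comm j i]

instance : CommRing (Laurent p s f E) :=
  { instAddCommGroup with
    mul := (· * ·)
    one := 1
    mul_assoc := Laurent.mul_assoc
    one_mul := Laurent.one_mul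
    mul_one := fun a => by rw [Laurent.mul_comm, Laurent.one_mul]
    left_distrib := Laurent.mul_add
    right_distrib := fun a b c => by
      rw [Laurent.mul_comm, Laurent.mul_add, Laurent.mul_comm c a, Laurent.mul_comm c b]
    mul_comm := Laurent.mul_comm
    zero_mul := fun a => by ext k; simp [coeff_mul]
    mul_zero := fun a => by ext k; simp [coeff_mul] }

lemma smul_mul (c : E) (a b : Laurent p s f E) : c • a * b = c • (a * b) := by
  ext k
  simp only [coeff_mul, coeff_smul, Pi.smul_apply, smul_eq_mul, mul_assoc]
  exact tsum_mul_left

instance : Algebra E (Laurent p s f E) :=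
  Algebra.ofModule smul_mul fun c a b => by
    rw [Laurent.mul_comm, smul_mul, Laurent.mul_comm]

/-- The variable `Y_i`, for `0 ≤ i ≤ f - 1`, namely `Y_0 * (Y_i / Y_0)`. -/
def Y (i : Fin f) : Laurent p s f E :=
  single (1, fun j => if (j : ℕ) + 1 = (i : ℕ) then 1 else 0) 1

/-- The value `F(Y_0, ..., Y_{f-1})` of a formal power series with integral coefficients. -/
def eval (F : MvPowerSeries (Fin f) (intRing E)) : Laurent p s f E :=
  ∑' k : Fin f →₀ ℕ, ((MvPowerSeries.coeff k F : intRing E) : E) • ∏ i, (Y i : Laurent p s f E) ^ k i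

end Laurent

section Rings

variable [IsUltrametricDist E] [CompleteSpace E]

/-- The ring `A^{†,s⁻}`: series `∑ f_n(Y_0) ∏ (Y_i / Y_0) ^ (n i)` such that the coefficients
`a_{m,n}` of `f_n = ∑ a_{m,n} Y_0 ^ m` are integral with `‖a_{m,n}‖ p ^ (-m / s) ≤ 1`, and
`‖a_{m,n}‖ p ^ (-m / s)` tends to zero. -/
def ovRing : Subalgebra (intRing E) (Laurent p s f E) where
  carrier := {a | ∀ k, ‖a.coeff k‖ ≤ 1 ∧ ‖a.coeff k‖ * weight p s k ≤ 1}
  mul_mem' := by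
    intro a b ha hb k
    have hw := weight_pos (p := p) (s := s) k
    refine ⟨Laurent.norm_conv_le a b k zero_le_one fun i => ?_, ?_⟩
    · rw [norm_mul]
      exact mul_le_one₀ (ha i).1 (norm_nonneg _) (hb _).1
    · rw [← le_div_iff₀ hw]
      refine Laurent.norm_conv_le a b k (by positivity) fun i => ?_
      rw [le_div_iff₀ hw]
      have hk : weight p s k = weight p s i * weight p s (k - i) := by
        rw [← weight_add, add_sub_cancel]
      rw [norm_mul, hk, mul_mul_mul_comm]
      exact mul_le_one₀ (ha i).2
        (mul_nonneg (norm_nonneg _) (weight_pos _).le) (hb _).2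
  add_mem' := by
    intro a b ha hb k
    have hw := weight_pos (p := p) (s := s) k
    have h := IsUltrametricDist.norm_add_le_max (a.coeff k) (b.coeff k)
    refine ⟨h.trans (max_le (ha k).1 (hb k).1), ?_⟩
    refine (mul_le_mul_of_nonneg_right h hw.le).trans ?_
    rw [max_mul_of_nonneg _ _ hw.le]
    exact max_le (ha k).2 (hb k).2
  algebraMap_mem' := by
    classical
    intro c k
    have hc : (algebraMap (intRing E) (Laurent p s f E) c).coeff k
        = (c : E) * (Pi.single 0 1 : Expo f → E) k := rfl
    rw [hc]
    by_cases hk : k = 0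
    · subst hk
      have h : ‖(c : E)‖ ≤ 1 := c.2
      simpa [weight_zero] using h
    · simp [Pi.single_eq_of_ne hk]

/-- The monomial `Y_0`. -/
def Yzero : Laurent p s f E := Laurent.single (1, 0) 1

lemma Yzero_mem : Yzero p s f E ∈ ovRing p s f E := by
  classical
  intro k
  by_cases hk : k = (1, 0)
  · subst hk
    have h1 : (Yzero p s f E).coeff (1, 0) = 1 := by simp [Yzero, Laurent.single]
    have hp : (1 : ℝ) ≤ p := by exact_mod_cast (Fact.out : p.Prime).one_lt.le
    rw [h1, norm_one]
    refine ⟨le_rfl, ?_⟩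
    rw [one_mul, weight]
    refine Real.rpow_le_one_of_one_le_of_nonpos hp ?_
    exact div_nonpos_of_nonpos_of_nonneg (by simp) (by positivity)
  · have h1 : (Yzero p s f E).coeff k = 0 := by
      simp [Yzero, Laurent.single, Pi.single_eq_of_ne hk]
    simp [h1]

/-- The ring `A^{†,s⁻}[1 / Y_0]`, as a subring of the Banach algebra `Laurent p s f E`,
in which `Y_0` is invertible. -/
def ovRingInv : Subalgebra (intRing E) (Laurent p s f E) where
  carrier := {a | ∃ N : ℕ, Yzero p s f E ^ N * a ∈ ovRing p s f E}
  mul_mem' := by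
    rintro a b ⟨N, hN⟩ ⟨M, hM⟩
    refine ⟨N + M, ?_⟩
    rw [pow_add, mul_mul_mul_comm]
    exact mul_mem hN hM
  add_mem' := by
    rintro a b ⟨N, hN⟩ ⟨M, hM⟩
    have hY := Yzero_mem p s f E
    refine ⟨N + M, ?_⟩
    rw [mul_add]
    refine add_mem ?_ ?_
    · rw [pow_add, mul_comm (_ ^ N), mul_assoc]
      exact mul_mem (pow_mem hY M) hN
    · rw [pow_add, mul_assoc]
      exact mul_mem (pow_mem hY N) hM
  algebraMap_mem' := fun c => ⟨0, by
    rw [pow_zero, one_mul]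
    exact (ovRing p s f E).algebraMap_mem c⟩

end Rings

/-! ### The Iwasawa algebra `O_E[[O_K]]` -/

section Iwasawa

variable (K : Type*) [NormedField K] [IsUltrametricDist K] [IsUltrametricDist E]

/-- The ideal `p ^ n O_K`. -/
abbrev pIdeal (n : ℕ) : Ideal (intRing K) := Ideal.span {((p : intRing K) ^ n)}

/-- The group algebra `O_E[O_K / p ^ n O_K]` of the additive group `O_K / p ^ n O_K`. -/
abbrev GroupAlg (n : ℕ) : Type _ := AddMonoidAlgebra (intRing E) (intRing K ⧸ pIdeal p K n)

/-- The projection `O_K / p ^ (n + 1) → O_K / p ^ n`. -/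
def proj (n : ℕ) : (intRing K ⧸ pIdeal p K (n + 1)) →+ (intRing K ⧸ pIdeal p K n) :=
  (Ideal.Quotient.factor (Ideal.span_singleton_le_span_singleton.mpr
    (pow_dvd_pow _ n.le_succ)) : _ →+* _).toAddMonoidHom

/-- The transition map `O_E[O_K / p ^ (n + 1)] → O_E[O_K / p ^ n]`. -/
def transition (n : ℕ) : GroupAlg p E K (n + 1) →ₐ[intRing E] GroupAlg p E K n :=
  AddMonoidAlgebra.mapDomainAlgHom (intRing E) (intRing E) (proj p K n)

/-- The Iwasawa algebra `O_E[[O_K]] = lim O_E[O_K / p ^ n]` of the additive group `O_K`. -/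
def Iwasawa : Subalgebra (intRing E) (∀ n, GroupAlg p E K n) where
  carrier := {x | ∀ n, transition p E K n (x (n + 1)) = x n}
  mul_mem' := fun {a b} ha hb n => by
    rw [Pi.mul_apply, Pi.mul_apply, map_mul, ha n, hb n]
  add_mem' := fun {a b} ha hb n => by
    rw [Pi.add_apply, Pi.add_apply, map_add, ha n, hb n]
  algebraMap_mem' := fun c n => by
    rw [Pi.algebraMap_apply, Pi.algebraMap_apply, AlgHom.commutes]

variable {K} in
/-- The group-like element `[x]` of `O_E[[O_K]]`, for `x` in `O_K`. -/
def groupLike (x : intRing K) : Iwasawa p E K :=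
  ⟨fun n => AddMonoidAlgebra.single (Ideal.Quotient.mk (pIdeal p K n) x) 1, fun n => by
    simp only [transition, AddMonoidAlgebra.mapDomainAlgHom_apply,
      AddMonoidAlgebra.mapDomain_single]
    rfl⟩

variable {K} in
/-- Multiplication by `a` on `O_E[O_K / p ^ n]`, sending `[x]` to `[a x]`. -/
def levelMul (a : intRing K) (n : ℕ) : GroupAlg p E K n →ₐ[intRing E] GroupAlg p E K n :=
  AddMonoidAlgebra.mapDomainAlgHom (intRing E) (intRing E)
    (AddMonoidHom.mulLeft (Ideal.Quotient.mk (pIdeal p K n) a))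

variable {K} in
/-- The endomorphism of `O_E[[O_K]]` induced by multiplication by `a` on `O_K`:
it sends `[x]` to `[a x]`. -/
def iwasawaMul (a : intRing K) (F : Iwasawa p E K) : Iwasawa p E K :=
  ⟨fun n => levelMul p E a n (F.1 n), fun n => by
    have h : (transition p E K n).comp (levelMul p E a (n + 1))
        = (levelMul p E a n).comp (transition p E K n) := by
      have hc : (proj p K n).comp
          (AddMonoidHom.mulLeft (Ideal.Quotient.mk (pIdeal p K (n + 1)) a))
          = (AddMonoidHom.mulLeft (Ideal.Quotient.mk (pIdeal p K n) a)).comp (proj p K n) := by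
        ext x
        obtain ⟨x, rfl⟩ := Ideal.Quotient.mk_surjective x
        rfl
      rw [transition, levelMul, levelMul, ← AddMonoidAlgebra.mapDomainAlgHom_comp,
        ← AddMonoidAlgebra.mapDomainAlgHom_comp, hc]
    have hF : transition p E K n (F.1 (n + 1)) = F.1 n := F.2 n
    change transition p E K n (levelMul p E a (n + 1) (F.1 (n + 1))) = levelMul p E a n (F.1 n)
    rw [← hF]
    exact DFunLike.congr_fun h (F.1 (n + 1))⟩

end Iwasawa

/-! ### The elements `Y_{σ_i}` and the action of `O_K^×` -/

section Action

variable {E} (K : Type*) [NormedField K] [NormedAlgebra ℚ_[p] K] [IsUltrametricDist K]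
  [IsUltrametricDist E] [CompleteSpace E] [Algebra ℚ_[p] E]

lemma norm_eq_one_of_mem {F : Type*} [NormedField F] {n : ℕ} {x : F}
    (h : x ∈ Polynomial.nthRootsFinset n (1 : F)) : ‖x‖ = 1 := by
  have hn : 0 < n := by
    rcases Nat.eq_zero_or_pos n with rfl | hn
    · simp at h
    · exact hn
  rw [Polynomial.mem_nthRootsFinset hn] at h
  exact (pow_eq_one_iff_of_nonneg (norm_nonneg x) hn.ne').mp (by rw [← norm_pow, h, norm_one])

/-- The nonzero Teichmüller elements `[lam]`, `lam ∈ 𝔽_q^×`, of the unramified extension `K` of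
degree `f`: the `(q - 1)`-st roots of unity of `K`, where `q = p ^ f`. -/
abbrev Teich : Type _ := {ζ : K // ζ ∈ Polynomial.nthRootsFinset (p ^ f - 1) (1 : K)}

variable {K}

/-- A Teichmüller element as an element of `O_K`. -/
def Teich.toInt (ζ : Teich p f K) : intRing K := ⟨ζ.1, (norm_eq_one_of_mem ζ.2).le⟩

variable {p f} in
/-- The element `σ_i([lam])⁻¹` of `O_E`, for `ζ = [lam]`, where `σ_i = σ_0 ∘ Frob ^ i`
and `Frob([lam]) = [lam] ^ p`. -/
def Teich.charInv (σ₀ : K →ₐ[ℚ_[p]] E) (i : ℕ) (ζ : Teich p f K) : intRing E :=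
  ⟨(σ₀ (ζ.1 ^ p ^ i))⁻¹, by
    have h := Polynomial.map_mem_nthRootsFinset_one ζ.2 σ₀
    have h1 : ‖(σ₀ (ζ.1 ^ p ^ i))⁻¹‖ = 1 := by
      rw [map_pow, norm_inv, norm_pow, norm_eq_one_of_mem h, one_pow, inv_one]
    exact h1.le⟩

open Classical in
/-- The element `Y_{σ_i} = ∑_{lam ∈ 𝔽_q^×} σ_i([lam])⁻¹ [[lam]]` of `O_E[[O_K]]`;
for `K = ℚ_2` (that is, `q = 2`), `Y_{σ_0} = [1] - 1`. -/
def Ysig (σ₀ : K →ₐ[ℚ_[p]] E) (i : Fin f) : Iwasawa p E K :=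
  if p ^ f = 2 then groupLike p E 1 - 1
  else ∑ ζ : Teich p f K, ζ.charInv σ₀ i • groupLike p E (ζ.toInt p f)

/-- `ρ` is the action of `O_K^×` on `A^{†,s⁻}[1 / Y_0]` : each `a ∈ O_K^×` acts by a continuous
`O_E`-algebra automorphism, and on `O_E[[Y_0, ..., Y_{f-1}]] = O_E[[O_K]]` (the identification
sending `Y_i` to `Y_{σ_i}`) it acts by `a [x] = [a x]`. -/
def IsCanonicalAction (σ₀ : K →ₐ[ℚ_[p]] E)
    (ρ : (intRing K)ˣ →* (ovRingInv p s f E ≃ₐ[intRing E] ovRingInv p s f E)) : Prop :=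
  (∀ a, Continuous (ρ a)) ∧
  ∃ Θ : MvPowerSeries (Fin f) (intRing E) ≃ₐ[intRing E] Iwasawa p E K,
    (∀ i, Θ (MvPowerSeries.X i) = Ysig p f σ₀ i) ∧
    ∀ (a : (intRing K)ˣ) (F : MvPowerSeries (Fin f) (intRing E)) (x : ovRingInv p s f E),
      (x : Laurent p s f E) = Laurent.eval F →
      (ρ a x : Laurent p s f E) = Laurent.eval (Θ.symm (iwasawaMul p E (a : intRing K) (Θ F)))

/-- A function `o` on `O_K^×` with values in the `E`-vector space `V` is analytic on a neighbourhood
of `1`, for the structure of `f`-dimensional `p`-adic Lie group on `O_K^×`: in the coordinates `t`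
given by `γ = 1 + p ^ m ∑ t_j b_j`, `t ∈ ℤ_p ^ f`, where `b` is a basis of `K` over `ℚ_p`, it is the
sum of a power series `∑ t ^ k w_k` whose coefficients tend to `0`. -/
def IsAnalyticNearOne {V : Type*} [AddCommGroup V] [Module E V] [TopologicalSpace V]
    (o : (intRing K)ˣ → V) : Prop :=
  ∀ b : Module.Basis (Fin f) ℚ_[p] K, ∃ (m : ℕ) (w : (Fin f → ℕ) → V),
    Tendsto w cofinite (𝓝 0) ∧
    ∀ (t : Fin f → ℤ_[p]) (γ : (intRing K)ˣ),
      ((γ : intRing K) : K) = 1 + (p : K) ^ m * ∑ j, ((t j : ℤ_[p]) : ℚ_[p]) • b j →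
      HasSum (fun k => algebraMap ℚ_[p] E (∏ j, ((t j : ℤ_[p]) : ℚ_[p]) ^ k j) • w k) (o γ)

/-- The action `ρ` is locally `ℚ_p`-analytic: all orbit maps `γ ↦ γ(x)` are locally analytic, as
functions with values in the `E`-Banach space `Laurent p s f E`, the completion of
`A^{†,s⁻}[1 / Y_0][1 / p]` for `‖·‖_s`. -/
def IsLocallyAnalyticAction
    (ρ : (intRing K)ˣ →* (ovRingInv p s f E ≃ₐ[intRing E] ovRingInv p s f E)) : Prop :=
  ∀ x : ovRingInv p s f E,
    IsAnalyticNearOne p f (E := E) (fun γ => (ρ γ x : Laurent p s f E))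

end Action

end MultivarOC

end

open MultivarOC

noncomputable section

namespace MultivarOC

/-! ### The Banach algebra of Laurent series: norm, submultiplicativity, completeness. -/

namespace Laurent

variable {p : ℕ} [Fact p.Prime] {s f : ℕ} {E : Type*} [NormedField E]

/-! Let `r = rad p s = p ^ (-1 / s)` be the common norm of the variables, so `r ^ s = p⁻¹`. One
estimate carries most of the theorem. A group-like element `[x]` has augmentation one and the
`Y_{σ_i}` have augmentation zero, so `[x] - 1` is a power series in the `Y_i` without constant term
and has norm at most `r`. As `‖p‖ ≤ p⁻¹ ≤ r`, each `p`-th power gains a factor `r`, so `‖[p ^ n x] -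
1‖ ≤ r ^ (n + 1)` (`norm_embed_groupLike_pow_mul_sub_one_le`), and `a Y_{σ_i}` and `b Y_{σ_i}`
differ by at most `r ^ (n + 1)` when `a ≡ b` modulo `p ^ n` (`norm_actY_sub_le`).

To speak of power series one first needs `O_E[[Y_0, ..., Y_{f-1}]] = O_E[[O_K]]` (`exists_theta`).
Over the residue field of `O_E`, the `Y_{σ_i}` generate the augmentation ideal of the group algebra
of `O_K / p ^ n` modulo its square, because an additive map on `𝔽_q` is recovered from its `f`
character sums (`addMonoidHom_eq_zero_of_sum_eq_zero`). By Nakayama their monomials span; since `p ^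
n`-th powers vanish, the monomials with exponents below `p ^ n` suffice, and a count shows that they
form a basis. Approximation by powers of a uniformizer lifts this to `O_E` (`MonomialTower`).

The action: a Teichmüller element acts on `Y_{σ_i}` by a constant of norm one. Comparing `a` with
its Teichmüller representative gives `a Y_i = Y_i v_i` with `v_i` a unit of `A^{†,s⁻}`
(`exists_unit_mul_eq_actY`), and `a` acts by the substitution `Y_i ↦ Y_i v_i` (`subst`). The group
law and uniqueness hold because continuous endomorphisms are determined on the `Y_i`
(`ovRingInv_algHom_ext`). If `a ≡ 1` modulo `p ^ s`, then `‖v_i - 1‖ ≤ r ^ s = p⁻¹`; this bound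
passes to all monomials, and `p⁻¹ ≤ p ^ (-1 / (p - 1))`.

Analyticity comes from `[t y] = ∑ binom(t, n) ([y] - 1) ^ n` for `t ∈ ℤ_p`
(`hasSum_binomTerm_embed`), a convergent power series in `t` once `y` is divisible by a large power
of `p`. Analytic families are stable under products, convergent sums and inverses of families close
to one, so the `v_i` and then all orbit maps are analytic near `1` (`isAnalyticIn_act`). -/

lemma norm_le_of_forall {a : Laurent p s f E} {C : ℝ}
    (h : ∀ k, ‖a.coeff k‖ * weight p s k ≤ C) : ‖a‖ ≤ C := ciSup_le h

lemma norm_le_iff {a : Laurent p s f E} {C : ℝ} :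
    ‖a‖ ≤ C ↔ ∀ k, ‖a.coeff k‖ * weight p s k ≤ C :=
  ⟨fun h k => (a.le_norm k).trans h, norm_le_of_forall⟩

lemma norm_smul_eq (c : E) (a : Laurent p s f E) : ‖c • a‖ = ‖c‖ * ‖a‖ := by
  rw [norm_def, norm_def, Real.mul_iSup_of_nonneg (norm_nonneg c)]
  simp [mul_assoc]

lemma coeff_single_self (k : Expo f) (c : E) : (single k c : Laurent p s f E).coeff k = c := by
  simp [single]

lemma coeff_single_of_ne {k l : Expo f} (h : l ≠ k) (c : E) :
    (single k c : Laurent p s f E).coeff l = 0 := by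
  simp [single, Pi.single_eq_of_ne h]

lemma norm_single (k : Expo f) (c : E) :
    ‖(single k c : Laurent p s f E)‖ = ‖c‖ * weight p s k := by
  apply le_antisymm
  · refine norm_le_of_forall fun l => ?_
    by_cases h : l = k
    · rw [h, coeff_single_self]
    · rw [coeff_single_of_ne h, norm_zero, zero_mul]
      exact mul_nonneg (norm_nonneg _) (weight_pos k).le
  · have := (single k c : Laurent p s f E).le_norm k
    rwa [coeff_single_self] at this

lemma smul_single (k : Expo f) (c d : E) :
    c • (single k d : Laurent p s f E) = single k (c * d) := by
  ext l
  by_cases h : l = k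
  · subst h; simp [coeff_single_self]
  · simp [coeff_single_of_ne h]

instance instNormedSpace : NormedSpace E (Laurent p s f E) where
  norm_smul_le c a := (norm_smul_eq c a).le

variable [IsUltrametricDist E]

instance : IsUltrametricDist (Laurent p s f E) :=
  IsUltrametricDist.isUltrametricDist_of_forall_norm_add_le_max_norm fun a b => by
    refine norm_le_of_forall fun k => ?_
    have hw := (weight_pos (p := p) (s := s) k).le
    refine (mul_le_mul_of_nonneg_right (IsUltrametricDist.norm_add_le_max _ _) hw).trans ?_
    rw [max_mul_of_nonneg _ _ hw]
    exact max_le_max (a.le_norm k) (b.le_norm k)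

variable [CompleteSpace E]

lemma single_mul_single (k l : Expo f) (c d : E) :
    (single k c * single l d : Laurent p s f E) = single (k + l) (c * d) := by
  ext i
  rw [single_mul]
  by_cases h : i = k + l
  · subst h
    rw [add_sub_cancel_left, coeff_single_self, coeff_single_self]
  · rw [coeff_single_of_ne h, coeff_single_of_ne, mul_zero]
    rintro rfl
    exact h (by abel)

lemma norm_mul_le (a b : Laurent p s f E) : ‖a * b‖ ≤ ‖a‖ * ‖b‖ := by
  refine norm_le_of_forall fun k => ?_
  have hw := weight_pos (p := p) (s := s) k
  rw [← le_div_iff₀ hw, coeff_mul]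
  refine norm_conv_le a b k (by positivity) fun i => ?_
  rw [le_div_iff₀ hw]
  have hk : weight p s k = weight p s i * weight p s (k - i) := by
    rw [← weight_add, add_sub_cancel]
  rw [norm_mul, hk, mul_mul_mul_comm]
  exact mul_le_mul (a.le_norm i) (b.le_norm _)
    (mul_nonneg (norm_nonneg _) (weight_pos _).le) (norm_nonneg _)

/-- The normed ring structure of the Banach algebra of Laurent series. -/
abbrev normedCommRing : NormedCommRing (Laurent p s f E) :=
  { (inferInstance : NormedAddCommGroup (Laurent p s f E)),
    (inferInstance : CommRing (Laurent p s f E)) with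
    norm_mul_le := norm_mul_le }

/-- Coefficients converge because `E` is complete. The Cauchy bound is uniform in the exponent,
which transfers the decay to the limit and upgrades coefficientwise convergence to norm convergence.
-/
instance : CompleteSpace (Laurent p s f E) := by
  refine Metric.complete_of_cauchySeq_tendsto fun u hu => ?_
  have hbd : ∀ k n m, ‖(u n).coeff k - (u m).coeff k‖ * weight p s k ≤ ‖u n - u m‖ :=
    fun k n m => (u n - u m).le_norm k
  have hc : ∀ k, CauchySeq fun n => (u n).coeff k := by
    intro k
    have hw := weight_pos (p := p) (s := s) k
    rw [Metric.cauchySeq_iff] at hu ⊢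
    intro ε hε
    obtain ⟨N, hN⟩ := hu (ε * weight p s k) (mul_pos hε hw)
    refine ⟨N, fun m hm n hn => ?_⟩
    have h1 := hN m hm n hn
    rw [dist_eq_norm] at h1 ⊢
    exact lt_of_mul_lt_mul_right ((hbd k m n).trans_lt h1) hw.le
  choose v hv using fun k => cauchySeq_tendsto_of_complete (hc k)
  have key : ∀ ε > 0, ∃ N, ∀ n ≥ N, ∀ k, ‖(u n).coeff k - v k‖ * weight p s k ≤ ε := by
    intro ε hε
    obtain ⟨N, hN⟩ := Metric.cauchySeq_iff.mp hu ε hε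
    refine ⟨N, fun n hn k => ?_⟩
    refine le_of_tendsto ((((hv k).const_sub ((u n).coeff k)).norm).mul_const (weight p s k)) ?_
    filter_upwards [eventually_ge_atTop N] with m hm
    refine (hbd k n m).trans ?_
    have h1 := hN n hn m hm
    rw [dist_eq_norm] at h1
    exact h1.le
  have hv0 : Tendsto (fun k => ‖v k‖ * weight p s k) cofinite (𝓝 0) := by
    rw [Metric.tendsto_nhds]
    intro ε hε
    obtain ⟨N, hN⟩ := key (ε / 2) (half_pos hε)
    have h1 := Metric.tendsto_nhds.mp (u N).tendsto_coeff (ε / 2) (half_pos hε)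
    filter_upwards [h1] with k hk
    have hw := weight_pos (p := p) (s := s) k
    rw [dist_zero_right, Real.norm_of_nonneg (by positivity)] at hk ⊢
    have h2 : ‖v k‖ ≤ ‖(u N).coeff k‖ + ‖(u N).coeff k - v k‖ := by
      have := norm_sub_le ((u N).coeff k) ((u N).coeff k - v k)
      rwa [sub_sub_cancel] at this
    have h3 := mul_le_mul_of_nonneg_right h2 hw.le
    have h4 := hN N le_rfl k
    rw [add_mul] at h3
    linarith
  refine ⟨⟨v, hv0⟩, ?_⟩
  rw [Metric.tendsto_atTop]
  intro ε hε
  obtain ⟨N, hN⟩ := key (ε / 2) (half_pos hε)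
  refine ⟨N, fun n hn => ?_⟩
  rw [dist_eq_norm]
  have : ‖u n - ⟨v, hv0⟩‖ ≤ ε / 2 := norm_le_of_forall fun k => hN n hn k
  linarith

end Laurent

/-! ### Evaluation of power series in ultrametric Banach rings -/

section EvalHom

variable {R S : Type*} [CommRing R] [NormedCommRing S] [IsUltrametricDist S] [CompleteSpace S]
  [Algebra R S] {f : ℕ}

lemma summable_of_tendsto {ι S : Type*} [NormedAddCommGroup S] [IsUltrametricDist S]
    [CompleteSpace S] {u : ι → S} (h : Tendsto u cofinite (𝓝 0)) : Summable u :=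
  NonarchimedeanAddGroup.summable_of_tendsto_cofinite_zero h

lemma tendsto_zero_of_norm_le {ι S T : Type*} [SeminormedAddCommGroup S] [SeminormedAddCommGroup T]
    {l : Filter ι} {u : ι → S} {v : ι → T} (h : ∀ i, ‖v i‖ ≤ ‖u i‖) (hu : Tendsto u l (𝓝 0)) :
    Tendsto v l (𝓝 0) :=
  squeeze_zero_norm h (tendsto_zero_iff_norm_tendsto_zero.mp hu)

lemma finite_finsupp_lt (f N : ℕ) : {k : Fin f →₀ ℕ | ∀ i, k i < N}.Finite := by
  refine (Set.finite_Iic (Finsupp.equivFunOnFinite.symm fun _ : Fin f => N)).subset fun k hk => ?_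
  intro i
  exact (hk i).le

lemma norm_prod_pow_le_one {y : Fin f → S} (h1 : ‖(1 : S)‖ ≤ 1) (hy : ∀ i, ‖y i‖ ≤ 1)
    (t : Finset (Fin f)) (k : Fin f → ℕ) : ‖∏ i ∈ t, y i ^ k i‖ ≤ 1 := by
  classical
  induction t using Finset.induction_on with
  | empty => simpa using h1
  | insert a t ha ih =>
    rw [Finset.prod_insert ha]
    refine (norm_mul_le _ _).trans (mul_le_one₀ ?_ (norm_nonneg _) ih)
    rcases Nat.eq_zero_or_pos (k a) with h | h
    · simpa [h] using h1
    · exact (norm_pow_le' _ h).trans (pow_le_one₀ (norm_nonneg _) (hy a))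

lemma norm_prod_pow_le_of {y : Fin f → S} (h1 : ‖(1 : S)‖ ≤ 1) (hy : ∀ i, ‖y i‖ ≤ 1)
    (k : Fin f → ℕ) (i : Fin f) : ‖∏ i, y i ^ k i‖ ≤ ‖y i ^ k i‖ := by
  classical
  rw [← Finset.mul_prod_erase _ _ (Finset.mem_univ i)]
  exact (norm_mul_le _ _).trans
    (mul_le_of_le_one_right (norm_nonneg _) (norm_prod_pow_le_one h1 hy _ k))

/-- Outside the finite box of exponents below `N`, some factor has exponent at least `N` and is
small, while the other factors have norm at most one. -/
lemma tendsto_prod_pow {y : Fin f → S} (h1 : ‖(1 : S)‖ ≤ 1) (hy : ∀ i, ‖y i‖ ≤ 1)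
    (hy0 : ∀ i, Tendsto (fun n => y i ^ n) atTop (𝓝 0)) :
    Tendsto (fun k : Fin f →₀ ℕ => ∏ i, y i ^ k i) cofinite (𝓝 0) := by
  rw [Metric.tendsto_nhds]
  intro ε hε
  have h2 : ∀ᶠ n in atTop, ∀ i, dist (y i ^ n) 0 < ε :=
    eventually_all.mpr fun i => Metric.tendsto_nhds.mp (hy0 i) ε hε
  obtain ⟨N, hN⟩ := eventually_atTop.mp h2
  rw [eventually_cofinite]
  refine (finite_finsupp_lt f N).subset fun k hk i => ?_
  by_contra hi
  apply hk
  have h3 := hN (k i) (not_lt.mp hi) i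
  rw [dist_zero_right] at h3 ⊢
  exact (norm_prod_pow_le_of h1 hy k i).trans_lt h3

variable (hsm : ∀ (r : R) (x : S), ‖r • x‖ ≤ ‖x‖) {y : Fin f → S}
  (hy : Tendsto (fun k : Fin f →₀ ℕ => ∏ i, y i ^ k i) cofinite (𝓝 0))

include hsm hy in
lemma tendsto_coeff_smul_prod (F : MvPowerSeries (Fin f) R) :
    Tendsto (fun k : Fin f →₀ ℕ => MvPowerSeries.coeff k F • ∏ i, y i ^ k i) cofinite (𝓝 0) :=
  tendsto_zero_of_norm_le (fun _ => hsm _ _) hy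

include hsm hy in
lemma summable_coeff_smul_prod (F : MvPowerSeries (Fin f) R) :
    Summable (fun k : Fin f →₀ ℕ => MvPowerSeries.coeff k F • ∏ i, y i ^ k i) :=
  summable_of_tendsto (tendsto_coeff_smul_prod hsm hy F)

include hsm hy in
lemma tsum_coeff_mul_smul_prod (F G : MvPowerSeries (Fin f) R) :
    ∑' k : Fin f →₀ ℕ, MvPowerSeries.coeff k (F * G) • ∏ i, y i ^ k i =
      (∑' k : Fin f →₀ ℕ, MvPowerSeries.coeff k F • ∏ i, y i ^ k i) *
        ∑' k : Fin f →₀ ℕ, MvPowerSeries.coeff k G • ∏ i, y i ^ k i := by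
  classical
  have hF := summable_coeff_smul_prod hsm hy F
  have hG := summable_coeff_smul_prod hsm hy G
  have : NonarchimedeanRing S :=
    { is_nonarchimedean := NonarchimedeanAddGroup.is_nonarchimedean }
  have hFG := hF.mul_of_nonarchimedean hG
  rw [Summable.tsum_mul_tsum_eq_tsum_sum_antidiagonal hF hG hFG]
  refine tsum_congr fun n => ?_
  rw [MvPowerSeries.coeff_mul, Finset.sum_smul]
  refine Finset.sum_congr rfl fun x hx => ?_
  rw [Finset.HasAntidiagonal.mem_antidiagonal] at hx
  have hprod : ∏ i, y i ^ n i = (∏ i, y i ^ x.1 i) * ∏ i, y i ^ x.2 i := by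
    rw [← hx, ← Finset.prod_mul_distrib]
    simp only [Finsupp.add_apply, pow_add]
  rw [hprod, Algebra.smul_def, Algebra.smul_def, Algebra.smul_def, map_mul]
  ring

/-- Evaluation of formal power series at a tuple of topologically nilpotent elements. -/
def evalHom : MvPowerSeries (Fin f) R →ₐ[R] S where
  toFun F := ∑' k : Fin f →₀ ℕ, MvPowerSeries.coeff k F • ∏ i, y i ^ k i
  map_one' := by
    classical
    rw [tsum_eq_single 0]
    · simp
    · intro k hk
      rw [MvPowerSeries.coeff_one, if_neg hk, zero_smul]
  map_zero' := by simp
  map_add' F G := by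
    simp only [map_add, add_smul]
    exact (summable_coeff_smul_prod hsm hy F).tsum_add (summable_coeff_smul_prod hsm hy G)
  map_mul' F G := tsum_coeff_mul_smul_prod hsm hy F G
  commutes' c := by
    classical
    rw [tsum_eq_single 0]
    · simp [Algebra.algebraMap_eq_smul_one]
    · intro k hk
      rw [MvPowerSeries.algebraMap_apply, MvPowerSeries.coeff_C, if_neg hk, zero_smul]

lemma evalHom_apply (F : MvPowerSeries (Fin f) R) :
    evalHom hsm hy F = ∑' k : Fin f →₀ ℕ, MvPowerSeries.coeff k F • ∏ i, y i ^ k i := rfl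

lemma evalHom_X (i : Fin f) : evalHom hsm hy (MvPowerSeries.X i) = y i := by
  classical
  rw [evalHom_apply, tsum_eq_single (Finsupp.single i 1)]
  · rw [MvPowerSeries.coeff_X, if_pos rfl, one_smul, Finset.prod_eq_single i]
    · simp
    · intro j _ hj
      simp [Finsupp.single_eq_of_ne hj]
    · simp
  · intro k hk
    rw [MvPowerSeries.coeff_X, if_neg hk, zero_smul]

end EvalHom

/-! ### Power series: the constant coefficient and uniqueness of homomorphisms -/

section PowerSeries

variable {R : Type*} [CommRing R] {f : ℕ}

/-- The ideal of the variables. -/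
abbrev varIdeal (R : Type*) [CommRing R] (f : ℕ) : Ideal (MvPowerSeries (Fin f) R) :=
  Ideal.span (Set.range MvPowerSeries.X)

/-- A power series is its constant term plus a combination of the variables. -/
lemma exists_eq_C_add_sum (F : MvPowerSeries (Fin f) R) :
    ∃ G : Fin f → MvPowerSeries (Fin f) R,
      F = MvPowerSeries.C (MvPowerSeries.constantCoeff F) + ∑ i, MvPowerSeries.X i * G i := by
  classical
  have hfirst : ∀ k : Fin f →₀ ℕ, k ≠ 0 → ∃ i, k i ≠ 0 := fun k hk => by
    by_contra h
    push Not at h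
    exact hk (Finsupp.ext h)
  -- Each nonconstant monomial is assigned to the first variable dividing it: `G i` collects those
  -- with vanishing earlier exponents, divided by `X i`, so none is counted twice.
  obtain ⟨G, hG⟩ : ∃ G : Fin f → MvPowerSeries (Fin f) R, ∀ i k, MvPowerSeries.coeff k (G i) =
      if (∀ j < i, k j = 0) then MvPowerSeries.coeff (k + Finsupp.single i 1) F else 0 :=
    ⟨fun i => fun k => if (∀ j < i, k j = 0) then
      MvPowerSeries.coeff (k + Finsupp.single i 1) F else 0, fun _ _ => rfl⟩
  refine ⟨G, ?_⟩
  ext k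
  rw [map_add, map_sum, MvPowerSeries.coeff_C]
  by_cases hk : k = 0
  · subst hk
    simp
  · rw [if_neg hk, zero_add]
    have hne : (Finset.univ.filter fun i => k i ≠ 0).Nonempty := by
      obtain ⟨i, hi⟩ := hfirst k hk
      exact ⟨i, by simpa using hi⟩
    set i₀ := (Finset.univ.filter fun i => k i ≠ 0).min' hne with hi₀
    have h0 : k i₀ ≠ 0 := by
      have := Finset.min'_mem _ hne
      rw [← hi₀] at this
      simpa using this
    have hlt : ∀ j < i₀, k j = 0 := by
      intro j hj
      by_contra hc
      have := Finset.min'_le (Finset.univ.filter fun i => k i ≠ 0) j (by simpa using hc)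
      exact absurd hj (not_lt.mpr this)
    have hle : ∀ i, Finsupp.single i 1 ≤ k ↔ k i ≠ 0 := by
      intro i
      rw [Finsupp.single_le_iff, Nat.one_le_iff_ne_zero]
    rw [Finset.sum_eq_single i₀]
    · rw [MvPowerSeries.X, MvPowerSeries.coeff_monomial_mul, if_pos ((hle i₀).mpr h0), one_mul,
        hG, if_pos, tsub_add_cancel_of_le ((hle i₀).mpr h0)]
      intro j hj
      simp [hlt j hj]
    · intro i _ hi
      rw [MvPowerSeries.X, MvPowerSeries.coeff_monomial_mul]
      split_ifs with h
      · rw [one_mul, hG, if_neg]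
        intro hall
        rcases lt_trichotomy i i₀ with h1 | h1 | h1
        · exact (hle i).mp h (hlt i h1)
        · exact hi h1
        · have := hall i₀ h1
          rw [Finsupp.tsub_apply, Finsupp.single_eq_of_ne h1.ne, tsub_zero] at this
          exact h0 this
      · rfl
    · simp

/-- Iterating `exists_eq_C_add_sum` pushes the remainder into higher powers of the ideal. This
serves as density of polynomials without a topology on the power series ring. -/
lemma exists_sub_mem_varIdeal_pow (F : MvPowerSeries (Fin f) R) (n : ℕ) :
    ∃ P : MvPolynomial (Fin f) R, F - (P : MvPowerSeries (Fin f) R) ∈ varIdeal R f ^ n := by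
  induction n generalizing F with
  | zero => exact ⟨0, by simp⟩
  | succ n ih =>
    obtain ⟨G, hG⟩ := exists_eq_C_add_sum F
    choose P hP using fun i => ih (G i)
    refine ⟨MvPolynomial.C (MvPowerSeries.constantCoeff F) + ∑ i, MvPolynomial.X i * P i, ?_⟩
    have h : F - ((MvPolynomial.C (MvPowerSeries.constantCoeff F) +
        ∑ i, MvPolynomial.X i * P i : MvPolynomial (Fin f) R) : MvPowerSeries (Fin f) R)
        = ∑ i, MvPowerSeries.X i * (G i - (P i : MvPowerSeries (Fin f) R)) := by
      have h2 : ((∑ i, MvPolynomial.X i * P i : MvPolynomial (Fin f) R) : MvPowerSeries (Fin f) R)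
          = ∑ i, MvPowerSeries.X i * (P i : MvPowerSeries (Fin f) R) := by
        rw [← MvPolynomial.coeToMvPowerSeries.ringHom_apply, map_sum]
        simp
      rw [MvPolynomial.coe_add, h2]
      conv_lhs => rw [hG]
      simp [mul_sub]
    rw [h]
    refine Ideal.sum_mem _ fun i _ => ?_
    rw [pow_succ']
    exact Ideal.mul_mem_mul (Ideal.subset_span ⟨i, rfl⟩) (hP i)

/-- Each variable raises the order by one. Consequently the filtration by powers of `varIdeal` is
separated. -/
lemma coeff_eq_zero_of_mem_varIdeal_pow {n : ℕ} {F : MvPowerSeries (Fin f) R}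
    (h : F ∈ varIdeal R f ^ n) : ∀ k : Fin f →₀ ℕ, k.degree < n → MvPowerSeries.coeff k F = 0 := by
  classical
  induction n generalizing F with
  | zero => intro k hk; exact absurd hk (by simp)
  | succ n ih =>
    rw [pow_succ'] at h
    refine Submodule.mul_induction_on h (fun x hx G hG => ?_) (fun x y hx hy k hk => ?_)
    · refine Submodule.span_induction (p := fun x _ => ∀ k : Fin f →₀ ℕ, k.degree < n + 1 →
        MvPowerSeries.coeff k (x * G) = 0) ?_ ?_ ?_ ?_ hx
      · rintro _ ⟨i, rfl⟩ k hk
        rw [MvPowerSeries.X, MvPowerSeries.coeff_monomial_mul]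
        split_ifs with hle
        · rw [one_mul]
          apply ih hG
          have h2 : (k - Finsupp.single i 1 + Finsupp.single i 1).degree = k.degree := by
            rw [tsub_add_cancel_of_le hle]
          rw [map_add, Finsupp.degree_single] at h2
          omega
        · rfl
      · intro k hk
        simp
      · intro a b _ _ ha hb k hk
        rw [add_mul, map_add, ha k hk, hb k hk, add_zero]
      · intro a b _ hb k hk
        rw [smul_eq_mul, mul_assoc, MvPowerSeries.coeff_mul]
        refine Finset.sum_eq_zero fun x hx => ?_
        rw [Finset.HasAntidiagonal.mem_antidiagonal] at hx
        rw [hb x.2, mul_zero]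
        rw [← hx, map_add] at hk
        omega
    · rw [map_add, hx k hk, hy k hk, add_zero]

/-- An algebra endomorphism of the power series ring fixing the variables is the identity. -/
lemma algHom_eq_id_of_map_X
    (Φ : MvPowerSeries (Fin f) R →ₐ[R] MvPowerSeries (Fin f) R)
    (h : ∀ i, Φ (MvPowerSeries.X i) = MvPowerSeries.X i) (F : MvPowerSeries (Fin f) R) :
    Φ F = F := by
  have hpoly : ∀ P : MvPolynomial (Fin f) R,
      Φ (P : MvPowerSeries (Fin f) R) = (P : MvPowerSeries (Fin f) R) := by
    intro P
    have : Φ.comp (MvPolynomial.coeToMvPowerSeries.algHom R)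
        = MvPolynomial.coeToMvPowerSeries.algHom R := by
      ext i
      simp [h]
    have h2 := DFunLike.congr_fun this P
    simpa using h2
  -- No continuity of `Φ` is assumed: preserving the ideal of the variables, it preserves all its
  -- powers and is automatically continuous for that filtration.
  have hI : (varIdeal R f).map Φ.toRingHom ≤ varIdeal R f := by
    rw [Ideal.map_span]
    refine Ideal.span_mono ?_
    rintro _ ⟨_, ⟨i, rfl⟩, rfl⟩
    exact ⟨i, (h i).symm⟩
  ext k
  obtain ⟨P, hP⟩ := exists_sub_mem_varIdeal_pow F (k.degree + 1)
  have h1 : Φ (F - P) ∈ varIdeal R f ^ (k.degree + 1) := by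
    have := Ideal.mem_map_of_mem Φ.toRingHom hP
    rw [Ideal.map_pow] at this
    exact Ideal.pow_right_mono hI _ this
  have h2 : Φ F - F = Φ (F - P) - (F - P) := by
    rw [map_sub, hpoly]; ring
  have h3 := coeff_eq_zero_of_mem_varIdeal_pow (sub_mem h1 hP) k (Nat.lt_succ_self _)
  rw [← h2, map_sub, sub_eq_zero] at h3
  exact h3

end PowerSeries

/-! ### The ring of integers of `K` -/

section IntegersOfK

variable {p : ℕ} [Fact p.Prime] {K : Type*} [NormedField K] [NormedAlgebra ℚ_[p] K]

lemma norm_natCast_p : ‖(p : K)‖ = (p : ℝ)⁻¹ := by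
  have h := norm_algebraMap' K (p : ℚ_[p])
  rwa [map_natCast, Padic.norm_p] at h

variable (p K) in
lemma natCast_p_ne_zero : (p : K) ≠ 0 := by
  rw [← norm_pos_iff, norm_natCast_p]
  exact inv_pos.mpr (by exact_mod_cast (Fact.out : p.Prime).pos)

variable [IsUltrametricDist K]

lemma p_pow_dvd_iff {n : ℕ} {x : intRing K} :
    (p : intRing K) ^ n ∣ x ↔ ‖(x : K)‖ ≤ ((p : ℝ)⁻¹) ^ n := by
  have hp := natCast_p_ne_zero p K
  have hpp : (0 : ℝ) < (p : ℝ)⁻¹ := inv_pos.mpr (by exact_mod_cast (Fact.out : p.Prime).pos)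
  constructor
  · rintro ⟨y, rfl⟩
    have hy : ‖(y : K)‖ ≤ 1 := y.2
    push_cast
    rw [norm_mul, norm_pow, norm_natCast_p]
    exact mul_le_of_le_one_right (by positivity) hy
  · intro h
    refine ⟨⟨(x : K) / (p : K) ^ n, ?_⟩, ?_⟩
    · change ‖(x : K) / (p : K) ^ n‖ ≤ 1
      rw [norm_div, norm_pow, norm_natCast_p]
      exact div_le_one_of_le₀ h (by positivity)
    · ext
      push_cast
      field_simp

lemma mem_pIdeal_iff {n : ℕ} {x : intRing K} : x ∈ pIdeal p K n ↔ (p : intRing K) ^ n ∣ x :=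
  Ideal.mem_span_singleton

variable (p K) in
/-- The structure map `ℤ_p → O_K`. -/
def padicIntToInt : ℤ_[p] →+* intRing K :=
  ((algebraMap ℚ_[p] K).comp (algebraMap ℤ_[p] ℚ_[p])).codRestrict (intRing K) fun x => by
    change ‖algebraMap ℚ_[p] K (x : ℚ_[p])‖ ≤ 1
    rw [norm_algebraMap']
    exact x.2

lemma coe_padicIntToInt (x : ℤ_[p]) :
    ((padicIntToInt p K x : intRing K) : K) = algebraMap ℚ_[p] K (x : ℚ_[p]) := rfl

variable [FiniteDimensional ℚ_[p] K]

/-- The ring of integers `O_K` is free of rank `[K : ℚ_p]` over `ℤ_p`. -/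
lemma exists_integral_basis (f : ℕ) (hf : Module.finrank ℚ_[p] K = f) :
    ∃ c : intRing K ≃+ (Fin f → ℤ_[p]),
      ∀ (a : ℤ_[p]) (x : intRing K), c (padicIntToInt p K a * x) = a • c x := by
  let : Algebra ℤ_[p] (intRing K) := (padicIntToInt p K).toAlgebra
  let : Module ℤ_[p] K := Module.compHom K (algebraMap ℤ_[p] ℚ_[p])
  have : IsScalarTower ℤ_[p] ℚ_[p] K := ⟨fun a b x => by
    change ((algebraMap ℤ_[p] ℚ_[p] a) * b) • x = (algebraMap ℤ_[p] ℚ_[p] a) • b • x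
    exact mul_smul _ _ _⟩
  have hsmul : ∀ (a : ℤ_[p]) (x : intRing K), ((a • x : intRing K) : K) = (a : ℚ_[p]) • (x : K) := by
    intro a x
    rw [Algebra.smul_def a x, Algebra.smul_def (a : ℚ_[p])]
    rfl
  have hp := natCast_p_ne_zero p K
  have hp0 : (0 : ℝ) < p := by exact_mod_cast (Fact.out : p.Prime).pos
  have hp1 : (1 : ℝ) < p := by exact_mod_cast (Fact.out : p.Prime).one_lt
  -- finiteness
  have hfin : Module.Finite ℤ_[p] (intRing K) := by
    let b := Module.finBasis ℚ_[p] K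
    let l : ∀ i, K →L[ℚ_[p]] ℚ_[p] := fun i => LinearMap.toContinuousLinearMap (b.coord i)
    obtain ⟨n, hn⟩ : ∃ n : ℕ, ∀ i, ‖l i‖ ≤ (p : ℝ) ^ n := by
      have : ∀ᶠ n : ℕ in atTop, ∀ i, ‖l i‖ ≤ (p : ℝ) ^ n :=
        eventually_all.mpr fun i => (tendsto_pow_atTop_atTop_of_one_lt hp1).eventually_ge_atTop _
      exact this.exists
    have hle : ∀ i (x : intRing K), ‖(p : ℚ_[p]) ^ n * b.coord i (x : K)‖ ≤ 1 := by
      intro i x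
      rw [norm_mul, norm_pow, Padic.norm_p]
      have h1 : ‖b.coord i (x : K)‖ ≤ (p : ℝ) ^ n := by
        have h2 := (l i).le_opNorm (x : K)
        have hx : ‖(x : K)‖ ≤ 1 := x.2
        exact (h2.trans (mul_le_of_le_one_right (norm_nonneg _) hx)).trans (hn i)
      calc ((p : ℝ)⁻¹) ^ n * ‖b.coord i (x : K)‖ ≤ ((p : ℝ)⁻¹) ^ n * (p : ℝ) ^ n := by gcongr
        _ = 1 := by rw [← mul_pow, inv_mul_cancel₀ hp0.ne', one_pow]
    -- Coordinates are bounded by `p ^ n` on the unit ball; multiplied by `p ^ n` they become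
    -- integral and embed `O_K` in a finite free `ℤ_p`-module, so `O_K` is finite by noetherianity.
    let g : intRing K →ₗ[ℤ_[p]] (Fin (Module.finrank ℚ_[p] K) → ℤ_[p]) :=
      { toFun := fun x i => ⟨(p : ℚ_[p]) ^ n * b.coord i (x : K), hle i x⟩
        map_add' := fun x y => by
          funext i
          apply Subtype.ext
          change (p : ℚ_[p]) ^ n * b.coord i ((x + y : intRing K) : K) =
            (p : ℚ_[p]) ^ n * b.coord i (x : K) + (p : ℚ_[p]) ^ n * b.coord i (y : K)
          push_cast
          rw [map_add, mul_add]
        map_smul' := fun a x => by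
          funext i
          apply Subtype.ext
          change (p : ℚ_[p]) ^ n * b.coord i ((a • x : intRing K) : K) =
            (a : ℚ_[p]) * ((p : ℚ_[p]) ^ n * b.coord i (x : K))
          rw [hsmul, map_smul, smul_eq_mul]
          ring }
    refine Module.Finite.of_injective g fun x y hxy => ?_
    apply Subtype.ext
    apply b.ext_elem
    intro i
    have h1 := congrArg Subtype.val (congrFun hxy i)
    change (p : ℚ_[p]) ^ n * b.coord i (x : K) = (p : ℚ_[p]) ^ n * b.coord i (y : K) at h1
    exact mul_left_cancel₀ (pow_ne_zero _ (natCast_p_ne_zero p ℚ_[p])) h1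
  have : Module.IsTorsionFree ℤ_[p] (intRing K) := by
    rw [Module.isTorsionFree_iff_smul_eq_zero]
    intro a x h
    have h1 := congrArg (Subtype.val) h
    rw [hsmul] at h1
    rcases smul_eq_zero.mp h1 with h2 | h2
    · left; exact Subtype.ext h2
    · right; exact Subtype.ext h2
  -- Finite and torsion-free over a principal ideal domain, `O_K` is free. Its rank is read off in
  -- `K`: an integral basis is a `ℚ_p`-basis, as every element of `K` becomes integral after
  -- multiplication by a power of `p`.
  let b := Module.finBasis ℤ_[p] (intRing K)
  let v : Fin (Module.finrank ℤ_[p] (intRing K)) → K := fun i => (b i : K)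
  let incl : intRing K →ₗ[ℤ_[p]] K :=
    { toFun := fun x => (x : K)
      map_add' := fun x y => rfl
      map_smul' := fun a x => hsmul a x }
  have hli : LinearIndependent ℚ_[p] v := by
    rw [← LinearIndependent.iff_fractionRing ℤ_[p] ℚ_[p]]
    exact b.linearIndependent.map' incl (LinearMap.ker_eq_bot.mpr Subtype.val_injective)
  have hsp : ⊤ ≤ Submodule.span ℚ_[p] (Set.range v) := by
    intro x _
    obtain ⟨n, hn⟩ := pow_unbounded_of_one_lt ‖x‖ hp1
    have hx : ‖(p : K) ^ n * x‖ ≤ 1 := by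
      rw [norm_mul, norm_pow, norm_natCast_p]
      calc ((p : ℝ)⁻¹) ^ n * ‖x‖ ≤ ((p : ℝ)⁻¹) ^ n * (p : ℝ) ^ n := by gcongr
        _ = 1 := by rw [← mul_pow, inv_mul_cancel₀ hp0.ne', one_pow]
    have h1 : ∀ y : intRing K, (y : K) ∈ Submodule.span ℚ_[p] (Set.range v) := by
      intro y
      have h2 := congrArg incl (b.sum_repr y)
      rw [map_sum] at h2
      change _ = (y : K) at h2
      rw [← h2]
      refine Submodule.sum_mem _ fun i _ => ?_
      rw [map_smul]
      change (((b.repr y) i : ℤ_[p]) : ℚ_[p]) • v i ∈ _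
      exact Submodule.smul_mem _ _ (Submodule.subset_span ⟨i, rfl⟩)
    have h3 := Submodule.smul_mem _ (((p : ℚ_[p]) ^ n)⁻¹) (h1 ⟨(p : K) ^ n * x, hx⟩)
    have h4 : ((p : ℚ_[p]) ^ n)⁻¹ • ((p : K) ^ n * x) = x := by
      rw [Algebra.smul_def, map_inv₀, map_pow, map_natCast]
      field_simp
    rwa [h4] at h3
  have hrank : Module.finrank ℤ_[p] (intRing K) = f := by
    have := Module.finrank_eq_card_basis (Module.Basis.mk hli hsp)
    rw [Fintype.card_fin, hf] at this
    exact this.symm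
  subst hrank
  refine ⟨b.equivFun.toAddEquiv, fun a x => ?_⟩
  have h5 : padicIntToInt p K a * x = a • x := (Algebra.smul_def a x).symm
  rw [h5]
  exact b.equivFun.map_smul a x

/-- In an integral basis, divisibility by `p ^ n` is coordinatewise. Only the cardinality is needed
later, so a bijection of sets suffices. -/
lemma card_quotient_pIdeal (f : ℕ) (hf : Module.finrank ℚ_[p] K = f) (n : ℕ) :
    Nonempty ((intRing K ⧸ pIdeal p K n) ≃ (Fin f → ZMod (p ^ n))) := by
  obtain ⟨c, hc⟩ := exists_integral_basis f hf
  let g : intRing K →+ (Fin f → ZMod (p ^ n)) :=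
    { toFun := fun x i => PadicInt.toZModPow n (c x i)
      map_zero' := by funext i; simp
      map_add' := fun x y => by funext i; simp }
  have hg : ∀ x i, g x i = PadicInt.toZModPow n (c x i) := fun _ _ => rfl
  have hsurj : Function.Surjective g := by
    intro y
    choose z hz using fun i => ZMod.ringHom_surjective (PadicInt.toZModPow (p := p) n) (y i)
    refine ⟨c.symm z, ?_⟩
    funext i
    rw [hg, AddEquiv.apply_symm_apply, hz]
  have hpn : padicIntToInt p K ((p : ℤ_[p]) ^ n) = (p : intRing K) ^ n := by simp
  have hker : g.ker = (pIdeal p K n).toAddSubgroup := by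
    ext x
    rw [AddMonoidHom.mem_ker, Submodule.mem_toAddSubgroup, mem_pIdeal_iff]
    constructor
    · intro h
      have h1 : ∀ i, (p : ℤ_[p]) ^ n ∣ c x i := by
        intro i
        have h2 := congrFun h i
        rw [hg, Pi.zero_apply, ← RingHom.mem_ker, PadicInt.ker_toZModPow,
          Ideal.mem_span_singleton] at h2
        exact h2
      choose z hz using h1
      refine ⟨c.symm z, ?_⟩
      apply c.injective
      rw [← hpn, hc, AddEquiv.apply_symm_apply]
      funext i
      exact hz i
    · rintro ⟨y, rfl⟩
      funext i
      rw [hg, ← hpn, hc, Pi.smul_apply, smul_eq_mul, Pi.zero_apply, ← RingHom.mem_ker,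
        PadicInt.ker_toZModPow, Ideal.mem_span_singleton]
      exact dvd_mul_right _ _
  have e1 := (QuotientAddGroup.quotientKerEquivOfSurjective g hsurj).toEquiv
  have e2 := (QuotientAddGroup.quotientAddEquivOfEq hker).toEquiv
  exact ⟨(e2.symm.trans e1 : _)⟩

lemma finite_quotient_pIdeal (n : ℕ) : Finite (intRing K ⧸ pIdeal p K n) := by
  obtain ⟨e⟩ := card_quotient_pIdeal (p := p) (K := K) _ rfl n
  have : NeZero (p ^ n) := ⟨pow_ne_zero _ (Fact.out : p.Prime).ne_zero⟩
  exact Finite.of_equiv _ e.symm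

lemma natCard_quotient_pIdeal (f : ℕ) (hf : Module.finrank ℚ_[p] K = f) (n : ℕ) :
    Nat.card (intRing K ⧸ pIdeal p K n) = (p ^ n) ^ f := by
  obtain ⟨e⟩ := card_quotient_pIdeal (p := p) (K := K) f hf n
  rw [Nat.card_congr e, Nat.card_pi]
  simp

end IntegersOfK

/-! ### Additive maps on a finite field -/

section FiniteField

variable {p f : ℕ} [Fact p.Prime] {F : Type*} [Field F] [Fintype F] [CharP F p]

/-- This is the trace to `𝔽_p`: Frobenius permutes the terms cyclically since `y ^ p ^ f = y`, so
the sum lies in the prime field. -/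
lemma sum_frobenius_pow_eq_natCast (hF : Fintype.card F = p ^ f) (y : F) :
    ∃ n : ℕ, ∑ i ∈ Finset.range f, y ^ p ^ i = n := by
  have hfix : (∑ i ∈ Finset.range f, y ^ p ^ i) ^ p = ∑ i ∈ Finset.range f, y ^ p ^ i := by
    have h1 : (∑ i ∈ Finset.range f, y ^ p ^ i) ^ p = ∑ i ∈ Finset.range f, y ^ p ^ (i + 1) := by
      rw [← frobenius_def, map_sum]
      refine Finset.sum_congr rfl fun i _ => ?_
      rw [frobenius_def, ← pow_mul, pow_succ]
    have h2 := Finset.sum_range_succ (fun i => y ^ p ^ i) f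
    have h3 := Finset.sum_range_succ' (fun i => y ^ p ^ i) f
    rw [h1]
    have h4 : y ^ p ^ f = y := by rw [← hF, FiniteField.pow_card]
    rw [h4] at h2
    rw [pow_zero, pow_one, h2] at h3
    exact (add_right_cancel h3).symm
  have h5 := (Subfield.mem_bot_iff_pow_eq_self (F := F) (p := p)).mpr hfix
  let _ : Algebra (ZMod p) F := ZMod.algebra F p
  obtain ⟨z, hz⟩ := (bot_le : ⊥ ≤ (algebraMap (ZMod p) F).fieldRange) h5
  refine ⟨z.val, ?_⟩
  rw [← hz, ← map_natCast (algebraMap (ZMod p) F), ZMod.natCast_zmod_val]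

/-- After `u ↦ u⁻¹` this is the power sum of exponent `p ^ i - 1` over the units. It is nonzero only
if `q - 1` divides the exponent, which forces `i = 0` when `i < f`. -/
lemma sum_units_inv_pow_mul [DecidableEq F] (hF : Fintype.card F = p ^ f) {i : ℕ} (hi : i < f) :
    ∑ u : Fˣ, ((u⁻¹ : Fˣ) : F) ^ p ^ i * u = if i = 0 then -1 else 0 := by
  have hp := (Fact.out : p.Prime)
  have h1 : ∑ u : Fˣ, ((u⁻¹ : Fˣ) : F) ^ p ^ i * u = ∑ u : Fˣ, ((u ^ (p ^ i - 1) : Fˣ) : F) := by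
    rw [← Equiv.sum_comp (Equiv.inv Fˣ)]
    refine Finset.sum_congr rfl fun u _ => ?_
    rw [Equiv.inv_apply, inv_inv, ← Units.val_pow_eq_pow_val, ← Units.val_mul]
    congr 1
    have : p ^ i = p ^ i - 1 + 1 := (Nat.sub_add_cancel (Nat.one_le_pow _ _ hp.pos)).symm
    conv_lhs => rw [this, pow_succ]
    exact mul_inv_cancel_right _ _
  rw [h1]
  have h2 := FiniteField.sum_pow_units F (p ^ i - 1)
  simp only [Units.val_pow_eq_pow_val]
  rw [h2, hF]
  congr 1
  rw [eq_iff_iff]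
  constructor
  · intro h
    have hlt : p ^ i < p ^ f := Nat.pow_lt_pow_right hp.one_lt hi
    have h1le : 1 ≤ p ^ i := Nat.one_le_pow _ _ hp.pos
    have h0 := Nat.eq_zero_of_dvd_of_lt h (by omega)
    have h3 : p ^ i = 1 := by omega
    exact (Nat.pow_eq_one.mp h3).resolve_left hp.one_lt.ne'
  · rintro rfl
    simp

/-- An additive map on `𝔽_q` whose components along the `f` embeddings vanish is zero. -/
lemma addMonoidHom_eq_zero_of_sum_eq_zero [DecidableEq F] (hF : Fintype.card F = p ^ f)
    {k M : Type*} [CommRing k] [AddCommGroup M] [Module k M] (τ : F →+* k) (d : F →+ M)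
    (h : ∀ i < f, ∑ u : Fˣ, τ (((u⁻¹ : Fˣ) : F) ^ p ^ i) • d u = 0) (x : F) : d x = 0 := by
  have hf0 : 0 < f := by
    rcases Nat.eq_zero_or_pos f with rfl | h0
    · have := Fintype.one_lt_card (α := F)
      rw [hF] at this
      simp at this
    · exact h0
  -- Combining the hypotheses with coefficients `τ (x ^ p ^ i)` makes the trace of `x * u⁻¹` the
  -- coefficient of `d u`.
  have h1 : ∑ u : Fˣ, τ (∑ i ∈ Finset.range f, (x * ((u⁻¹ : Fˣ) : F)) ^ p ^ i) • d u = 0 := by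
    have h2 : ∑ i ∈ Finset.range f, τ (x ^ p ^ i) •
        ∑ u : Fˣ, τ (((u⁻¹ : Fˣ) : F) ^ p ^ i) • d u = 0 :=
      Finset.sum_eq_zero fun i hi => by rw [h i (Finset.mem_range.mp hi), smul_zero]
    rw [← h2]
    simp only [Finset.smul_sum]
    rw [Finset.sum_comm]
    refine Finset.sum_congr rfl fun u _ => ?_
    rw [map_sum, Finset.sum_smul]
    refine Finset.sum_congr rfl fun i _ => ?_
    rw [mul_pow, map_mul, mul_smul]
  -- The trace is the image of a natural number, so this scalar passes through `d`, which is only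
  -- additive.
  have h3 : ∀ u : Fˣ, τ (∑ i ∈ Finset.range f, (x * ((u⁻¹ : Fˣ) : F)) ^ p ^ i) • d u =
      d ((∑ i ∈ Finset.range f, (x * ((u⁻¹ : Fˣ) : F)) ^ p ^ i) * u) := by
    intro u
    obtain ⟨n, hn⟩ := sum_frobenius_pow_eq_natCast (p := p) hF (x * ((u⁻¹ : Fˣ) : F))
    rw [hn, map_natCast, ← nsmul_eq_mul, map_nsmul, Nat.cast_smul_eq_nsmul]
  rw [Finset.sum_congr rfl fun u _ => h3 u, ← map_sum] at h1
  have h4 : ∑ u : Fˣ, (∑ i ∈ Finset.range f, (x * ((u⁻¹ : Fˣ) : F)) ^ p ^ i) * u = -x := by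
    simp only [Finset.sum_mul]
    rw [Finset.sum_comm]
    have h5 : ∀ i ∈ Finset.range f, ∑ u : Fˣ, (x * ((u⁻¹ : Fˣ) : F)) ^ p ^ i * u
        = if i = 0 then -x else 0 := by
      intro i hi
      simp only [mul_pow, mul_assoc]
      rw [← Finset.mul_sum, sum_units_inv_pow_mul hF (Finset.mem_range.mp hi)]
      split_ifs with h0
      · subst h0; simp
      · simp
    rw [Finset.sum_congr rfl h5, Finset.sum_ite_eq' , if_pos (Finset.mem_range.mpr hf0)]
  rw [h4, map_neg, neg_eq_zero] at h1
  exact h1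

end FiniteField

/-! ### Teichmüller elements -/

section Teichmuller

variable {p : ℕ} [Fact p.Prime] {K : Type*} [NormedField K] [NormedAlgebra ℚ_[p] K]
  [IsUltrametricDist K]

lemma isUnit_of_norm_eq_one {F : Type*} [NormedField F] [IsUltrametricDist F] {x : intRing F}
    (h : ‖(x : F)‖ = 1) : IsUnit x := by
  have hx0 : (x : F) ≠ 0 := by
    rw [← norm_pos_iff, h]; exact one_pos
  refine IsUnit.of_mul_eq_one ⟨(x : F)⁻¹, ?_⟩ ?_
  · change ‖(x : F)⁻¹‖ ≤ 1
    rw [norm_inv, h, inv_one]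
  · ext
    exact mul_inv_cancel₀ hx0

lemma norm_unit_eq_one {F : Type*} [NormedField F] [IsUltrametricDist F] (a : (intRing F)ˣ) :
    ‖((a : intRing F) : F)‖ = 1 := by
  have h1 : ‖((a : intRing F) : F)‖ ≤ 1 := (a : intRing F).2
  have h2 : ‖(((a⁻¹ : (intRing F)ˣ) : intRing F) : F)‖ ≤ 1 := ((a⁻¹ : (intRing F)ˣ) : intRing F).2
  have h3 : ‖((a : intRing F) : F)‖ * ‖(((a⁻¹ : (intRing F)ˣ) : intRing F) : F)‖ = 1 := by
    rw [← norm_mul, ← Subring.coe_mul, Units.mul_inv, Subring.coe_one, norm_one]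
  refine le_antisymm h1 ?_
  rw [← h3]
  exact mul_le_of_le_one_right (norm_nonneg _) h2

lemma norm_eq_one_of_not_dvd (hK : IsUnramified p K) {x : intRing K}
    (h : ¬ (p : intRing K) ∣ x) : ‖(x : K)‖ = 1 := by
  have h1 : ‖(x : K)‖ ≤ 1 := x.2
  refine le_antisymm h1 (not_lt.mp fun hlt => h ?_)
  have h2 := hK _ hlt
  rw [norm_natCast_p] at h2
  have h3 := (p_pow_dvd_iff (p := p) (n := 1) (x := x)).mpr (by simpa using h2)
  simpa using h3

lemma isMaximal_pIdeal_one (hK : IsUnramified p K) : (pIdeal p K 1).IsMaximal := by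
  have hp1 : (1 : ℝ) < p := by exact_mod_cast (Fact.out : p.Prime).one_lt
  rw [Ideal.isMaximal_iff]
  constructor
  · rw [mem_pIdeal_iff, p_pow_dvd_iff]
    rw [Subring.coe_one, norm_one, pow_one, not_le]
    exact inv_lt_one_of_one_lt₀ hp1
  · intro J x hJ hx hxJ
    rw [mem_pIdeal_iff, pow_one] at hx
    obtain ⟨u, hu⟩ := isUnit_of_norm_eq_one (norm_eq_one_of_not_dvd hK hx)
    rw [← Ideal.eq_top_iff_one]
    exact Ideal.eq_top_of_isUnit_mem J hxJ ⟨u, hu⟩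

variable [FiniteDimensional ℚ_[p] K] {f : ℕ}

lemma dvd_pow_card_sub (hK : IsUnramified p K) (hf : Module.finrank ℚ_[p] K = f) (x : intRing K) :
    (p : intRing K) ∣ x ^ p ^ f - x := by
  have := isMaximal_pIdeal_one hK
  let _ : Field (intRing K ⧸ pIdeal p K 1) := Ideal.Quotient.field _
  have := finite_quotient_pIdeal (p := p) (K := K) 1
  let _ : Fintype (intRing K ⧸ pIdeal p K 1) := Fintype.ofFinite _
  have hc : Fintype.card (intRing K ⧸ pIdeal p K 1) = p ^ f := by
    rw [← Nat.card_eq_fintype_card, natCard_quotient_pIdeal f hf, pow_one]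
  have h1 := FiniteField.pow_card (Ideal.Quotient.mk (pIdeal p K 1) x)
  rw [hc, ← map_pow, Ideal.Quotient.eq, mem_pIdeal_iff, pow_one] at h1
  exact h1

/-- Each `p`-th power improves the congruence by a factor `p`; there are `f * n ≥ n` of them. -/
lemma pow_card_pow_congr {x y : intRing K} (h : (p : intRing K) ∣ x - y) (hf0 : 0 < f) (n : ℕ) :
    ‖((x ^ p ^ (f * n) : intRing K) : K) - ((y ^ p ^ (f * n) : intRing K) : K)‖
      ≤ ((p : ℝ)⁻¹) ^ n := by
  have hp1 : (1 : ℝ) < p := by exact_mod_cast (Fact.out : p.Prime).one_lt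
  have h1 := p_pow_dvd_iff.mp (dvd_sub_pow_of_dvd_sub h (f * n))
  change ‖((x ^ p ^ (f * n) : intRing K) : K) - ((y ^ p ^ (f * n) : intRing K) : K)‖ ≤ _ at h1
  refine h1.trans (pow_le_pow_of_le_one (by positivity) (inv_lt_one_of_one_lt₀ hp1).le ?_)
  nlinarith

/-- Every unit of `O_K` is congruent to a Teichmüller element. -/
lemma exists_teich (hK : IsUnramified p K) (hf : Module.finrank ℚ_[p] K = f) {x : intRing K}
    (hx : ¬ (p : intRing K) ∣ x) : ∃ ζ : Teich p f K, (p : intRing K) ∣ x - ζ.toInt p f := by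
  have hp1 : (1 : ℝ) < p := by exact_mod_cast (Fact.out : p.Prime).one_lt
  have hpi : ((p : ℝ)⁻¹) < 1 := inv_lt_one_of_one_lt₀ hp1
  have hf0 : 0 < f := hf ▸ Module.finrank_pos
  have hcompl : CompleteSpace K := FiniteDimensional.complete ℚ_[p] K
  -- Teichmüller's construction: since `x ^ q ≡ x` modulo `p` and the congruence improves under
  -- powers, `x ^ q ^ n` is Cauchy. Its limit is fixed by `z ↦ z ^ q` and congruent to `x`.
  let u : ℕ → K := fun n => ((x ^ p ^ (f * n) : intRing K) : K)
  have hu : ∀ n, u (n + 1) = u n ^ p ^ f := by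
    intro n
    simp only [u]
    rw [← Subring.coe_pow, ← pow_mul, ← pow_add, mul_add, mul_one]
  have hcau : CauchySeq u := by
    refine cauchySeq_of_le_geometric ((p : ℝ)⁻¹) 1 hpi fun n => ?_
    rw [one_mul, dist_comm, dist_eq_norm]
    have h1 := pow_card_pow_congr (dvd_pow_card_sub hK hf x) hf0 n
    rw [← pow_mul, ← pow_add, add_comm f, ← mul_add_one] at h1
    exact h1
  obtain ⟨z, hz⟩ := cauchySeq_tendsto_of_complete hcau
  have hxn := norm_eq_one_of_not_dvd hK hx
  have hzq : z ^ p ^ f = z := by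
    have h1 : Tendsto (fun n => u (n + 1)) atTop (𝓝 z) := hz.comp (tendsto_add_atTop_nat 1)
    have h2 : Tendsto (fun n => u n ^ p ^ f) atTop (𝓝 (z ^ p ^ f)) := hz.pow _
    simp only [hu] at h1
    exact tendsto_nhds_unique h2 h1
  have hzx : ‖(x : K) - z‖ ≤ (p : ℝ)⁻¹ := by
    refine le_of_tendsto (hz.const_sub (x : K)).norm (Eventually.of_forall fun n => ?_)
    have h1 : (p : intRing K) ∣ x - x ^ p ^ (f * n) := by
      induction n with
      | zero => simp
      | succ n ih =>
        have h2 := dvd_pow_card_sub hK hf (x ^ p ^ (f * n))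
        rw [← pow_mul, ← pow_add, ← mul_add_one] at h2
        have h3 := dvd_sub ih h2
        rwa [sub_sub_sub_cancel_right] at h3
    have h4 := (p_pow_dvd_iff (n := 1) (x := x - x ^ p ^ (f * n))).mp (by simpa using h1)
    simpa [u] using h4
  have hzn : ‖z‖ = 1 := by
    refine (tendsto_nhds_unique hz.norm (tendsto_const_nhds.congr fun n => ?_)).trans rfl
    simp [u, hxn]
  have hz0 : z ≠ 0 := by
    rw [← norm_pos_iff, hzn]; exact one_pos
  have hq : 1 < p ^ f := Nat.one_lt_pow hf0.ne' (Fact.out : p.Prime).one_lt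
  have hzmem : z ∈ Polynomial.nthRootsFinset (p ^ f - 1) (1 : K) := by
    rw [Polynomial.mem_nthRootsFinset (by omega)]
    have h1 : z ^ (p ^ f - 1) * z = 1 * z := by
      rw [← pow_succ, Nat.sub_add_cancel hq.le, hzq, one_mul]
    exact mul_right_cancel₀ hz0 h1
  refine ⟨⟨z, hzmem⟩, ?_⟩
  have h5 := (p_pow_dvd_iff (p := p) (n := 1) (x := x - Teich.toInt p f ⟨z, hzmem⟩)).mpr
    (by simpa [Teich.toInt] using hzx)
  simpa using h5

lemma Teich.pow_card (hf0 : 0 < f) (ζ : Teich p f K) : ζ.1 ^ p ^ f = ζ.1 := by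
  have hq : 1 < p ^ f := Nat.one_lt_pow hf0.ne' (Fact.out : p.Prime).one_lt
  have h1 := (Polynomial.mem_nthRootsFinset (by omega) _).mp ζ.2
  calc ζ.1 ^ p ^ f = ζ.1 ^ (p ^ f - 1) * ζ.1 := by
        rw [← pow_succ, Nat.sub_add_cancel hq.le]
    _ = ζ.1 := by rw [h1, one_mul]

lemma Teich.pow_card_pow (hf0 : 0 < f) (ζ : Teich p f K) (n : ℕ) :
    ζ.1 ^ p ^ (f * n) = ζ.1 := by
  induction n with
  | zero => simp
  | succ n ih => rw [mul_add_one, pow_add, pow_mul, ih, ζ.pow_card hf0]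

/-- Both elements equal their own `q ^ n`-th powers, so a congruence modulo `p` between them holds
modulo every `p ^ n`. -/
lemma Teich.eq_of_dvd (hf0 : 0 < f) {ζ η : Teich p f K}
    (h : (p : intRing K) ∣ ζ.toInt p f - η.toInt p f) : ζ = η := by
  have hp1 : (1 : ℝ) < p := by exact_mod_cast (Fact.out : p.Prime).one_lt
  have h1 : ∀ n, ‖ζ.1 - η.1‖ ≤ ((p : ℝ)⁻¹) ^ n := by
    intro n
    have h2 := pow_card_pow_congr h hf0 n
    have h3 : ∀ ξ : Teich p f K, ((ξ.toInt p f ^ p ^ (f * n) : intRing K) : K) = ξ.1 := by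
      intro ξ
      rw [Subring.coe_pow]
      exact ξ.pow_card_pow hf0 n
    rwa [h3, h3] at h2
  have h4 : ‖ζ.1 - η.1‖ ≤ 0 :=
    ge_of_tendsto (tendsto_pow_atTop_nhds_zero_of_lt_one (by positivity)
      (inv_lt_one_of_one_lt₀ hp1)) (Eventually.of_forall h1)
  exact Subtype.ext (sub_eq_zero.mp (norm_le_zero_iff.mp h4))

/-- Teichmüller elements correspond to the units of the residue field. -/
lemma Teich.exists_equiv_units (hK : IsUnramified p K) (hf : Module.finrank ℚ_[p] K = f) :
    ∃ e : Teich p f K ≃ (intRing K ⧸ pIdeal p K 1)ˣ,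
      ∀ ζ, (e ζ : intRing K ⧸ pIdeal p K 1) = Ideal.Quotient.mk (pIdeal p K 1) (ζ.toInt p f) := by
  have hf0 : 0 < f := hf ▸ Module.finrank_pos
  have hmax := isMaximal_pIdeal_one hK
  have hu : ∀ ζ : Teich p f K, IsUnit (Ideal.Quotient.mk (pIdeal p K 1) (ζ.toInt p f)) :=
    fun ζ => (isUnit_of_norm_eq_one (x := ζ.toInt p f) (norm_eq_one_of_mem ζ.2)).map _
  refine ⟨Equiv.ofBijective (fun ζ => (hu ζ).unit) ⟨fun ζ η h => ?_, fun u => ?_⟩, fun ζ => rfl⟩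
  · have h1 := congrArg Units.val h
    simp only [IsUnit.unit_spec] at h1
    rw [Ideal.Quotient.eq, mem_pIdeal_iff, pow_one] at h1
    exact Teich.eq_of_dvd hf0 h1
  · obtain ⟨x, hx⟩ := Ideal.Quotient.mk_surjective (u : intRing K ⧸ pIdeal p K 1)
    have hnd : ¬ (p : intRing K) ∣ x := by
      intro h
      have h1 : Ideal.Quotient.mk (pIdeal p K 1) x = 0 := by
        rw [Ideal.Quotient.eq_zero_iff_mem, mem_pIdeal_iff, pow_one]
        exact h
      have h2 := u.isUnit
      rw [← hx, h1] at h2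
      have := Ideal.Quotient.nontrivial_iff.mpr hmax.ne_top
      exact not_isUnit_zero h2
    obtain ⟨ζ, hζ⟩ := exists_teich hK hf hnd
    refine ⟨ζ, Units.ext ?_⟩
    rw [IsUnit.unit_spec, ← hx, eq_comm, Ideal.Quotient.eq, mem_pIdeal_iff, pow_one]
    exact hζ

/-- The product of two Teichmüller elements. -/
def Teich.mul (ζ η : Teich p f K) : Teich p f K :=
  ⟨ζ.1 * η.1, by
    have := Polynomial.mul_mem_nthRootsFinset ζ.2 η.2
    rwa [one_mul] at this⟩

lemma Teich.mul_bijective (ζ : Teich p f K) : Function.Bijective (Teich.mul ζ) := by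
  have : Finite (Teich p f K) := inferInstance
  refine Finite.injective_iff_bijective.mp fun η ξ h => ?_
  have h0 : ζ.1 ≠ 0 := by
    rw [← norm_pos_iff, norm_eq_one_of_mem ζ.2]; exact one_pos
  exact Subtype.ext (mul_left_cancel₀ h0 (congrArg Subtype.val h))

lemma Teich.toInt_mul (ζ η : Teich p f K) :
    (Teich.mul ζ η).toInt p f = ζ.toInt p f * η.toInt p f := rfl

end Teichmuller

/-! ### The ring of integers of `E` -/

section IntegersOfE

variable {p : ℕ} [Fact p.Prime] {E : Type*} [NormedField E] [IsUltrametricDist E]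
  [Algebra ℚ_[p] E]

lemma IsNormalizedPadicNorm.norm_natCast_le (hE : IsNormalizedPadicNorm p E) :
    ‖(p : E)‖ ≤ (p : ℝ)⁻¹ := by
  have hp1 : (1 : ℝ) < p := by exact_mod_cast (Fact.out : p.Prime).one_lt
  obtain ⟨e, he, h⟩ := hE.restrict
  have h1 := h (p : ℚ_[p])
  rw [map_natCast, Padic.norm_p] at h1
  rw [h1]
  exact pow_le_of_le_one (by positivity) (inv_lt_one_of_one_lt₀ hp1).le he.ne'

lemma IsNormalizedPadicNorm.norm_algebraMap_le (hE : IsNormalizedPadicNorm p E) (t : ℤ_[p]) :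
    ‖algebraMap ℚ_[p] E (t : ℚ_[p])‖ ≤ 1 := by
  obtain ⟨e, -, h⟩ := hE.restrict
  rw [h]
  exact pow_le_one₀ (norm_nonneg _) t.2

lemma norm_natCast_le_one' {F : Type*} [NormedField F] [IsUltrametricDist F] (n : ℕ) :
    ‖(n : F)‖ ≤ 1 := IsUltrametricDist.norm_natCast_le_one F n

variable {K : Type*} [NormedField K] [NormedAlgebra ℚ_[p] K] [IsUltrametricDist K]
  [FiniteDimensional ℚ_[p] K]

/-- No compatibility of `σ` with the norms is assumed. An integral basis bounds `σ` uniformly on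
`O_K`, and an image of norm above one would have powers exceeding that bound. -/
lemma norm_map_le_one (hE : IsNormalizedPadicNorm p E) (σ : K →ₐ[ℚ_[p]] E) (x : intRing K) :
    ‖σ (x : K)‖ ≤ 1 := by
  obtain ⟨f, hf⟩ : ∃ f, Module.finrank ℚ_[p] K = f := ⟨_, rfl⟩
  obtain ⟨c, hc⟩ := exists_integral_basis (p := p) (K := K) f hf
  let b : Fin f → intRing K := fun j => c.symm (Pi.single j 1)
  have hexp : ∀ y : intRing K, y = ∑ j, padicIntToInt p K (c y j) * b j := by
    intro y
    apply c.injective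
    rw [map_sum]
    simp only [hc, b, AddEquiv.apply_symm_apply]
    funext i
    simp [Pi.single_apply]
  have hbd : ∀ y : intRing K, ‖σ (y : K)‖ ≤ ∑ j, ‖σ (b j : K)‖ := by
    intro y
    have h1 : σ (y : K) = ∑ j, algebraMap ℚ_[p] E (c y j : ℚ_[p]) * σ (b j : K) := by
      conv_lhs => rw [hexp y]
      rw [AddSubmonoidClass.coe_finsetSum, map_sum]
      refine Finset.sum_congr rfl fun j _ => ?_
      rw [Subring.coe_mul, map_mul, coe_padicIntToInt, AlgHom.commutes]
    rw [h1]
    refine (norm_sum_le _ _).trans (Finset.sum_le_sum fun j _ => ?_)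
    rw [norm_mul]
    exact mul_le_of_le_one_left (norm_nonneg _) (hE.norm_algebraMap_le _)
  by_contra hlt
  rw [not_le] at hlt
  obtain ⟨n, hn⟩ := pow_unbounded_of_one_lt (∑ j, ‖σ (b j : K)‖) hlt
  have h2 := hbd (x ^ n)
  rw [Subring.coe_pow, map_pow, norm_pow] at h2
  exact absurd hn (not_lt.mpr h2)

/-- The restriction `O_K → O_E` of an embedding `K → E`. -/
def sigmaInt (hE : IsNormalizedPadicNorm p E) (σ : K →ₐ[ℚ_[p]] E) : intRing K →+* intRing E :=
  (σ.toRingHom.comp (intRing K).subtype).codRestrict (intRing E) fun x => norm_map_le_one hE σ x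

end IntegersOfE

/-! ### The elements `Y_{σ_i}` -/

section Ysig

variable {p : ℕ} [Fact p.Prime] {f : ℕ} {E : Type*} [NormedField E] [IsUltrametricDist E]
  [CompleteSpace E] [Algebra ℚ_[p] E]
  {K : Type*} [NormedField K] [NormedAlgebra ℚ_[p] K] [IsUltrametricDist K]
  [FiniteDimensional ℚ_[p] K]

lemma charInv_mul (σ₀ : K →ₐ[ℚ_[p]] E) (i : ℕ) (ζ η : Teich p f K) :
    (Teich.mul ζ η).charInv σ₀ i = ζ.charInv σ₀ i * η.charInv σ₀ i := by
  apply Subtype.ext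
  change (σ₀ ((ζ.1 * η.1) ^ p ^ i))⁻¹ = (σ₀ (ζ.1 ^ p ^ i))⁻¹ * (σ₀ (η.1 ^ p ^ i))⁻¹
  rw [mul_pow, map_mul, mul_inv]

lemma norm_charInv (σ₀ : K →ₐ[ℚ_[p]] E) (i : ℕ) (ζ : Teich p f K) :
    ‖((ζ.charInv σ₀ i : intRing E) : E)‖ = 1 := by
  have h := Polynomial.map_mem_nthRootsFinset_one ζ.2 σ₀
  change ‖(σ₀ (ζ.1 ^ p ^ i))⁻¹‖ = 1
  rw [map_pow, norm_inv, norm_pow, norm_eq_one_of_mem h, one_pow, inv_one]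

/-- As `q - 1` is prime to `p`, `ζ ^ p ^ i = 1` forces `ζ = 1`; for `q ≠ 2` there is another
Teichmüller element. So the character in the definition of `Y_{σ_i}` is nontrivial. -/
lemma pow_ne_self_of_lt [DecidableEq K] (hK : IsUnramified p K)
    (hf : Module.finrank ℚ_[p] K = f) (h2 : p ^ f ≠ 2) {i : ℕ} (hi : i < f) :
    ∃ ζ : Teich p f K, ζ.1 ^ p ^ i ≠ 1 := by
  have hp := (Fact.out : p.Prime)
  have hmax := isMaximal_pIdeal_one hK
  let _ : Field (intRing K ⧸ pIdeal p K 1) := Ideal.Quotient.field _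
  have := finite_quotient_pIdeal (p := p) (K := K) 1
  let _ : Fintype (intRing K ⧸ pIdeal p K 1) := Fintype.ofFinite _
  obtain ⟨e, -⟩ := Teich.exists_equiv_units hK hf
  have hcard : Fintype.card (Teich p f K) = p ^ f - 1 := by
    classical
    rw [Fintype.card_congr e, Fintype.card_units, ← Nat.card_eq_fintype_card,
      natCard_quotient_pIdeal f hf, pow_one]
  by_contra hc
  push Not at hc
  have hsub : ∀ ζ : Teich p f K, ζ.1 ∈ Polynomial.nthRootsFinset (p ^ i) (1 : K) := fun ζ =>
    (Polynomial.mem_nthRootsFinset (pow_pos hp.pos i) _).mpr (hc ζ)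
  have h1 : ∀ ζ : Teich p f K, ζ.1 = 1 := by
    intro ζ
    have hq : 1 < p ^ f := Nat.one_lt_pow (by omega) hp.one_lt
    have h3 := (Polynomial.mem_nthRootsFinset (by omega) _).mp ζ.2
    have h4 := hc ζ
    have hcop : Nat.Coprime (p ^ i) (p ^ f - 1) := by
      apply Nat.Coprime.pow_left
      rw [Nat.Prime.coprime_iff_not_dvd hp]
      intro hd
      have h5 : p ∣ p ^ f := dvd_pow_self p (by omega)
      have h6 := (Nat.dvd_sub_iff_right hq.le h5).mp hd
      exact hp.one_lt.ne' (Nat.dvd_one.mp h6)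
    have h7 := pow_gcd_eq_one.mpr ⟨h4, h3⟩
    rwa [hcop, pow_one] at h7
  have h8 : Fintype.card (Teich p f K) ≤ 1 :=
    Fintype.card_le_one_iff.mpr fun ζ η => Subtype.ext ((h1 ζ).trans (h1 η).symm)
  have hq : 1 < p ^ f := Nat.one_lt_pow (by omega) hp.one_lt
  omega

/-- Orthogonality: multiplication by `ξ` permutes the Teichmüller elements and scales the sum by a
character value different from one. -/
lemma sum_charInv_eq_zero (hK : IsUnramified p K)
    (hf : Module.finrank ℚ_[p] K = f) (h2 : p ^ f ≠ 2) (σ₀ : K →ₐ[ℚ_[p]] E) {i : ℕ} (hi : i < f) :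
    ∑ ζ : Teich p f K, ζ.charInv σ₀ i = 0 := by
  classical
  obtain ⟨ξ, hξ⟩ := pow_ne_self_of_lt hK hf h2 hi
  have h1 : ξ.charInv σ₀ i * ∑ ζ : Teich p f K, ζ.charInv σ₀ i =
      ∑ ζ : Teich p f K, ζ.charInv σ₀ i := by
    rw [Finset.mul_sum, ← Function.Bijective.sum_comp ξ.mul_bijective
      (fun ζ => ζ.charInv σ₀ i)]
    exact Finset.sum_congr rfl fun ζ _ => (charInv_mul σ₀ i ξ ζ).symm
  by_contra hne
  have h3 : ξ.charInv σ₀ i = 1 := by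
    apply Subtype.ext
    have h4 := congrArg (Subtype.val) h1
    rw [Subring.coe_mul] at h4
    exact mul_right_cancel₀ (fun h => hne (Subtype.ext h)) (h4.trans (one_mul _).symm)
  have h5 : (σ₀ (ξ.1 ^ p ^ i))⁻¹ = 1 := congrArg Subtype.val h3
  rw [inv_eq_one, ← map_one σ₀] at h5
  exact hξ (σ₀.toRingHom.injective h5)

lemma sum_smul_eq_sum_smul_sub_one {ι R A : Type*} [Fintype ι] [CommRing R] [Ring A] [Algebra R A]
    (c : ι → R) (g : ι → A) (h : ∑ i, c i = 0) : ∑ i, c i • g i = ∑ i, c i • (g i - 1) := by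
  simp only [_root_.smul_sub]
  rw [Finset.sum_sub_distrib, ← Finset.sum_smul, h, zero_smul, sub_zero]

lemma Iwasawa.map_sub {B : Type*} [Ring B] [Algebra (intRing E) B]
    (g : Iwasawa p E K →ₐ[intRing E] B) (x y : Iwasawa p E K) : g (x - y) = g x - g y :=
  _root_.map_sub g x y

/-- This unifies the two cases of the definition and exhibits `Y_{σ_i}` in the augmentation ideal.
For `q = 2` the only Teichmüller element is `1`; otherwise the subtracted constants add up to zero
by `sum_charInv_eq_zero`. -/
lemma Ysig_eq (hK : IsUnramified p K) (hf : Module.finrank ℚ_[p] K = f)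
    (σ₀ : K →ₐ[ℚ_[p]] E) (i : Fin f) :
    Ysig p f σ₀ i = ∑ ζ : Teich p f K, ζ.charInv σ₀ i • (groupLike p E (ζ.toInt p f) - 1) := by
  classical
  rw [Ysig]
  split_ifs with h
  · have hone : (1 : K) ∈ Polynomial.nthRootsFinset (p ^ f - 1) (1 : K) := by
      rw [Polynomial.mem_nthRootsFinset (by omega)]
      exact one_pow _
    have huniq : ∀ ζ : Teich p f K, ζ = ⟨1, hone⟩ := by
      intro ζ
      have h1 := (Polynomial.mem_nthRootsFinset (by omega) _).mp ζ.2
      have h3 : p ^ f - 1 = 1 := by omega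
      have h4 : ζ.1 ^ 1 = 1 := (congrArg (fun n => ζ.1 ^ n) h3).symm.trans h1
      exact Subtype.ext ((pow_one _).symm.trans h4)
    rw [Finset.sum_eq_single (⟨1, hone⟩ : Teich p f K) (fun ζ _ hζ => absurd (huniq ζ) hζ)
      (by simp)]
    have h2 : Teich.charInv σ₀ i (⟨1, hone⟩ : Teich p f K) = 1 := by
      apply Subtype.ext
      change (σ₀ ((1 : K) ^ p ^ (i : ℕ)))⁻¹ = 1
      simp
    rw [h2, one_smul]
    rfl
  · exact sum_smul_eq_sum_smul_sub_one (A := Iwasawa p E K) (fun ζ : Teich p f K => ζ.charInv σ₀ i)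
      (fun ζ => groupLike p E (ζ.toInt p f)) (sum_charInv_eq_zero hK hf h σ₀ i.2)

lemma groupLike_add (x y : intRing K) :
    groupLike p E (x + y) = groupLike p E x * groupLike p E y := by
  apply Subtype.ext
  funext n
  change AddMonoidAlgebra.single (Ideal.Quotient.mk (pIdeal p K n) (x + y)) (1 : intRing E) =
    AddMonoidAlgebra.single (Ideal.Quotient.mk (pIdeal p K n) x) (1 : intRing E) *
      AddMonoidAlgebra.single (Ideal.Quotient.mk (pIdeal p K n) y) (1 : intRing E)
  rw [AddMonoidAlgebra.single_mul_single, map_add, mul_one]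

lemma groupLike_zero : groupLike p E (0 : intRing K) = 1 := by
  apply Subtype.ext
  funext n
  change AddMonoidAlgebra.single (Ideal.Quotient.mk (pIdeal p K n) 0) 1 = 1
  rw [map_zero]
  rfl

lemma groupLike_natCast_mul (N : ℕ) (x : intRing K) :
    groupLike p E ((N : intRing K) * x) = groupLike p E x ^ N := by
  induction N with
  | zero => rw [Nat.cast_zero, zero_mul, groupLike_zero, pow_zero]
  | succ N ih => rw [Nat.cast_succ, add_mul, one_mul, groupLike_add, ih, pow_succ]

variable (p E) in
/-- The action of `a ∈ O_K` on the Iwasawa algebra, as an algebra homomorphism. -/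
def iwasawaHom (a : intRing K) : Iwasawa p E K →ₐ[intRing E] Iwasawa p E K where
  toFun := iwasawaMul p E a
  map_one' := Subtype.ext (funext fun n => map_one (levelMul p E a n))
  map_mul' x y := Subtype.ext (funext fun n => map_mul (levelMul p E a n) (x.1 n) (y.1 n))
  map_zero' := Subtype.ext (funext fun n => map_zero (levelMul p E a n))
  map_add' x y := Subtype.ext (funext fun n => map_add (levelMul p E a n) (x.1 n) (y.1 n))
  commutes' c := Subtype.ext (funext fun n => (levelMul p E a n).commutes c)

lemma iwasawaHom_groupLike (a x : intRing K) :
    iwasawaHom p E a (groupLike p E x) = groupLike p E (a * x) := by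
  apply Subtype.ext
  funext n
  change AddMonoidAlgebra.mapDomain _ (AddMonoidAlgebra.single _ _) = _
  rw [AddMonoidAlgebra.mapDomain_single]
  rfl

lemma iwasawaHom_comp (a b : intRing K) (x : Iwasawa p E K) :
    iwasawaHom p E a (iwasawaHom p E b x) = iwasawaHom p E (a * b) x := by
  apply Subtype.ext
  funext n
  change levelMul p E a n (levelMul p E b n (x.1 n)) = levelMul p E (a * b) n (x.1 n)
  rw [← AlgHom.comp_apply]
  congr 1
  rw [levelMul, levelMul, levelMul, ← AddMonoidAlgebra.mapDomainAlgHom_comp]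
  congr 1
  ext y
  simp [mul_assoc]

lemma iwasawaHom_one (x : Iwasawa p E K) : iwasawaHom p E (1 : intRing K) x = x := by
  apply Subtype.ext
  funext n
  change levelMul p E 1 n (x.1 n) = x.1 n
  have : levelMul p E (1 : intRing K) n = AlgHom.id _ _ := by
    rw [levelMul, ← AddMonoidAlgebra.mapDomainAlgHom_id]
    congr 1
    ext y
    simp
  rw [this]
  rfl

/-- The augmentation of the Iwasawa algebra. -/
def augmentation : Iwasawa p E K →ₐ[intRing E] intRing E :=
  (AddMonoidAlgebra.lift (intRing E) (intRing E) (intRing K ⧸ pIdeal p K 0)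
    (1 : Multiplicative _ →* intRing E)).comp
    ((Pi.evalAlgHom (intRing E) (fun n => GroupAlg p E K n) 0).comp (Iwasawa p E K).val)

lemma augmentation_groupLike (x : intRing K) :
    augmentation (groupLike p E x) = 1 := by
  change AddMonoidAlgebra.lift _ _ _ _ (AddMonoidAlgebra.single _ _) = _
  simp

lemma augmentation_Ysig (hK : IsUnramified p K) (hf : Module.finrank ℚ_[p] K = f)
    (σ₀ : K →ₐ[ℚ_[p]] E) (i : Fin f) : augmentation (Ysig p f σ₀ i) = 0 := by
  rw [Ysig_eq hK hf, map_sum]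
  refine Finset.sum_eq_zero fun ζ _ => ?_
  rw [map_smul, Iwasawa.map_sub, augmentation_groupLike, map_one, sub_self, smul_zero]

end Ysig

/-! ### Group algebras in characteristic `p` -/

section GroupAlgebra

variable {k G : Type*} [CommRing k] [AddCommGroup G]

variable (k G) in
/-- The augmentation ideal of a group algebra. -/
def augIdeal : Ideal (AddMonoidAlgebra k G) :=
  Ideal.span (Set.range fun g : G => AddMonoidAlgebra.single g (1 : k) - 1)

lemma exists_sub_algebraMap_mem_augIdeal (x : AddMonoidAlgebra k G) :
    ∃ c : k, x - algebraMap k _ c ∈ augIdeal k G := by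
  induction x using AddMonoidAlgebra.induction_linear with
  | zero => exact ⟨0, by simp⟩
  | add x y hx hy =>
    obtain ⟨c, hc⟩ := hx
    obtain ⟨d, hd⟩ := hy
    refine ⟨c + d, ?_⟩
    rw [map_add, add_sub_add_comm]
    exact add_mem hc hd
  | single g c =>
    refine ⟨c, ?_⟩
    have h : AddMonoidAlgebra.single g c - algebraMap k _ c =
        c • (AddMonoidAlgebra.single g (1 : k) - 1) := by
      rw [smul_sub, AddMonoidAlgebra.smul_single, smul_eq_mul, mul_one,
        Algebra.algebraMap_eq_smul_one]
    rw [h]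
    exact Submodule.smul_of_tower_mem _ c (Ideal.subset_span ⟨g, rfl⟩)

variable {p : ℕ} [Fact p.Prime] [CharP k p] [Finite G] {n : ℕ}

lemma charP_groupAlgebra : CharP (AddMonoidAlgebra k G) p := by
  refine charP_of_injective_algebraMap (R := k) (fun x y h => ?_) p
  have h1 := congrArg (fun z : AddMonoidAlgebra k G => z.coeff 0) h
  simpa using h1

/-- In characteristic `p`, `([g] - 1) ^ p ^ n = [p ^ n g] - 1 = 0`, and finitely many nilpotent
generators give a nilpotent ideal. -/
lemma isNilpotent_augIdeal (hG : ∀ g : G, p ^ n • g = 0) : IsNilpotent (augIdeal k G) := by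
  have := charP_groupAlgebra (k := k) (G := G) (p := p)
  have hfg : (augIdeal k G).FG := ⟨(Set.finite_range _).toFinset, by
    rw [Set.Finite.coe_toFinset]; rfl⟩
  rw [hfg.isNilpotent_iff_le_nilradical, augIdeal, Ideal.span_le]
  rintro _ ⟨g, rfl⟩
  refine ⟨p ^ n, ?_⟩
  rw [sub_pow_char_pow, one_pow, AddMonoidAlgebra.single_pow, hG, one_pow]
  exact sub_self _

variable {f : ℕ} {y : Fin f → AddMonoidAlgebra k G}

/-- Nakayama's lemma: the augmentation ideal is nilpotent, hence inside the Jacobson radical. -/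
lemma augIdeal_le_of_le_sup (hG : ∀ g : G, p ^ n • g = 0)
    (hI : augIdeal k G ≤ Ideal.span (Set.range y) ⊔ augIdeal k G * augIdeal k G) :
    augIdeal k G ≤ Ideal.span (Set.range y) := by
  have hfg : (augIdeal k G).FG := ⟨(Set.finite_range _).toFinset, by
    rw [Set.Finite.coe_toFinset]; rfl⟩
  refine Submodule.le_of_le_smul_of_le_jacobson_bot hfg ?_ hI
  have h1 := (hfg.isNilpotent_iff_le_nilradical).mp (isNilpotent_augIdeal (k := k) hG)
  refine h1.trans ?_
  rw [nilradical, Ideal.radical_eq_sInf]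
  refine le_sInf fun J hJ => sInf_le ⟨bot_le, ?_⟩
  exact hJ.2.isPrime

/-- If the `y i` generate the augmentation ideal modulo its square, their monomials span. -/
lemma exists_aeval_eq (hG : ∀ g : G, p ^ n • g = 0) (hy : ∀ i, y i ∈ augIdeal k G)
    (hI : augIdeal k G ≤ Ideal.span (Set.range y) ⊔ augIdeal k G * augIdeal k G)
    (x : AddMonoidAlgebra k G) : ∃ P : MvPolynomial (Fin f) k, MvPolynomial.aeval y P = x := by
  have hle := augIdeal_le_of_le_sup hG hI
  have hJ : Ideal.span (Set.range y) ≤ augIdeal k G := by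
    rw [Ideal.span_le]
    rintro _ ⟨i, rfl⟩
    exact hy i
  obtain ⟨N, hN⟩ := isNilpotent_augIdeal (k := k) hG
  -- Approximation by polynomials in the `y i` modulo every power of the augmentation ideal becomes
  -- exact at a power that vanishes.
  have key : ∀ m : ℕ, ∀ x : AddMonoidAlgebra k G, ∃ P : MvPolynomial (Fin f) k,
      x - MvPolynomial.aeval y P ∈ augIdeal k G ^ m := by
    intro m
    induction m with
    | zero => exact fun x => ⟨0, by simp⟩
    | succ m ih =>
      intro x
      obtain ⟨c, hc⟩ := exists_sub_algebraMap_mem_augIdeal x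
      obtain ⟨z, hz⟩ := Ideal.mem_span_range_iff_exists_fun.mp (hle hc)
      choose P hP using fun i => ih (z i)
      refine ⟨MvPolynomial.C c + ∑ i, P i * MvPolynomial.X i, ?_⟩
      have h : x - MvPolynomial.aeval y (MvPolynomial.C c + ∑ i, P i * MvPolynomial.X i) =
          ∑ i, (z i - MvPolynomial.aeval y (P i)) * y i := by
        rw [map_add, map_sum]
        simp only [map_mul, MvPolynomial.aeval_X, MvPolynomial.aeval_C, sub_mul]
        rw [Finset.sum_sub_distrib, hz]
        abel
      rw [h]
      exact Ideal.sum_mem _ fun i _ => Ideal.mul_mem_mul (hP i) (hy i)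
  obtain ⟨P, hP⟩ := key N x
  rw [hN] at hP
  exact ⟨P, (sub_eq_zero.mp (by simpa using hP)).symm⟩

/-- Monomials outside the box vanish by `hy0`, so those inside span. Their number is the order of
`G`, which is the rank of the group algebra, so they are independent. -/
lemma linearIndependent_monomials (hG : ∀ g : G, p ^ n • g = 0)
    (hcard : Nat.card G = (p ^ n) ^ f) (hy : ∀ i, y i ∈ augIdeal k G)
    (hy0 : ∀ i, y i ^ p ^ n = 0)
    (hI : augIdeal k G ≤ Ideal.span (Set.range y) ⊔ augIdeal k G * augIdeal k G) :
    ⊤ ≤ Submodule.span k (Set.range fun j : Fin f → Fin (p ^ n) => ∏ i, y i ^ (j i : ℕ)) ∧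
    LinearIndependent k (fun j : Fin f → Fin (p ^ n) => ∏ i, y i ^ (j i : ℕ)) := by
  classical
  have hspan : ⊤ ≤ Submodule.span k
      (Set.range fun j : Fin f → Fin (p ^ n) => ∏ i, y i ^ (j i : ℕ)) := by
    intro x _
    obtain ⟨P, rfl⟩ := exists_aeval_eq hG hy hI x
    rw [MvPolynomial.aeval_def, MvPolynomial.eval₂_eq']
    refine Submodule.sum_mem _ fun m _ => ?_
    rw [← Algebra.smul_def]
    refine Submodule.smul_mem _ _ ?_
    by_cases hm : ∀ i, m i < p ^ n
    · exact Submodule.subset_span ⟨fun i => ⟨m i, hm i⟩, rfl⟩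
    · push Not at hm
      obtain ⟨i, hi⟩ := hm
      have h0 : y i ^ m i = 0 := pow_eq_zero_of_le hi (hy0 i)
      rw [Finset.prod_eq_zero (Finset.mem_univ i) h0]
      exact Submodule.zero_mem _
  refine ⟨hspan, ?_⟩
  have : Nontrivial k := CharP.nontrivial_of_char_ne_one (Fact.out : p.Prime).ne_one
  let _ : Fintype G := Fintype.ofFinite G
  let b : Module.Basis G k (AddMonoidAlgebra k G) := AddMonoidAlgebra.basis G k
  have : Module.Finite k (AddMonoidAlgebra k G) := Module.Finite.of_basis b
  refine linearIndependent_of_top_le_span_of_card_eq_finrank hspan ?_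
  rw [Module.finrank_eq_card_basis b, ← Nat.card_eq_fintype_card (α := G), hcard]
  simp

end GroupAlgebra

/-! ### Reduction of the `Y_{σ_i}` modulo the maximal ideal of `O_E` -/

section Residue

/-- The maximal ideal of the ring of integers. -/
def maxIdeal (E : Type*) [NormedField E] [IsUltrametricDist E] : Ideal (intRing E) where
  carrier := {x | ‖(x : E)‖ < 1}
  add_mem' {a b} ha hb := (IsUltrametricDist.norm_add_le_max (a : E) b).trans_lt (max_lt ha hb)
  zero_mem' := by simp
  smul_mem' c x hx := by
    have hc : ‖(c : E)‖ ≤ 1 := c.2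
    change ‖(c : E) * (x : E)‖ < 1
    rw [norm_mul]
    exact (mul_le_of_le_one_left (norm_nonneg _) hc).trans_lt hx

lemma mem_maxIdeal {E : Type*} [NormedField E] [IsUltrametricDist E] {x : intRing E} :
    x ∈ maxIdeal E ↔ ‖(x : E)‖ < 1 := Iff.rfl

/-- The residue field of `O_E`. -/
abbrev Residue (E : Type*) [NormedField E] [IsUltrametricDist E] : Type _ := intRing E ⧸ maxIdeal E

variable {p : ℕ} [Fact p.Prime] {f : ℕ} {E : Type*} [NormedField E] [IsUltrametricDist E]
  [Algebra ℚ_[p] E]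
  {K : Type*} [NormedField K] [NormedAlgebra ℚ_[p] K] [IsUltrametricDist K]
  [FiniteDimensional ℚ_[p] K]

lemma charP_residue (hE : IsNormalizedPadicNorm p E) : CharP (Residue E) p := by
  have hp1 : (1 : ℝ) < p := by exact_mod_cast (Fact.out : p.Prime).one_lt
  have : Nontrivial (Residue E) := Ideal.Quotient.nontrivial_iff.mpr fun h => by
    have h1 : (1 : intRing E) ∈ maxIdeal E := h ▸ Submodule.mem_top
    rw [mem_maxIdeal, Subring.coe_one, norm_one] at h1
    exact lt_irrefl _ h1
  rw [CharP.charP_iff_prime_eq_zero (Fact.out : p.Prime)]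
  rw [← map_natCast (Ideal.Quotient.mk (maxIdeal E)), Ideal.Quotient.eq_zero_iff_mem, mem_maxIdeal]
  exact hE.norm_natCast_le.trans_lt (inv_lt_one_of_one_lt₀ hp1)

variable {G : Type*} [AddCommGroup G] (q : intRing K →+ G) {k : Type*} [CommRing k]
  (red : intRing E →+* k)

/-- The reduction of `Y_{σ_i}` in the group algebra over the residue field of a quotient
of `O_K`. -/
def Ybar (σ₀ : K →ₐ[ℚ_[p]] E) (i : Fin f) : AddMonoidAlgebra k G :=
  ∑ ζ : Teich p f K, red (ζ.charInv σ₀ i) •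
    (AddMonoidAlgebra.single (q (ζ.toInt p f)) 1 - 1)

lemma Ybar_mem_augIdeal (σ₀ : K →ₐ[ℚ_[p]] E) (i : Fin f) :
    Ybar q red σ₀ i ∈ augIdeal k G :=
  Ideal.sum_mem _ fun _ _ => Submodule.smul_of_tower_mem _ _ (Ideal.subset_span ⟨_, rfl⟩)

lemma Ybar_pow_eq_zero [CharP k p] [Finite G] {n : ℕ} (hG : ∀ g : G, p ^ n • g = 0)
    (σ₀ : K →ₐ[ℚ_[p]] E) (i : Fin f) :
    Ybar q red σ₀ i ^ p ^ n = 0 := by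
  have := charP_groupAlgebra (k := k) (G := G) (p := p)
  rw [Ybar, sum_pow_char_pow]
  refine Finset.sum_eq_zero fun ζ _ => ?_
  rw [smul_pow, sub_pow_char_pow, one_pow, AddMonoidAlgebra.single_pow,
    hG, one_pow]
  rw [← AddMonoidAlgebra.one_def, sub_self, smul_zero]

/-- The reductions of the `Y_{σ_i}` generate the augmentation ideal modulo its square. -/
lemma augIdeal_le_span_Ybar [CharP k p] (hq : Function.Surjective q) (hK : IsUnramified p K)
    (hf : Module.finrank ℚ_[p] K = f)
    (hE : IsNormalizedPadicNorm p E) (σ₀ : K →ₐ[ℚ_[p]] E) :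
    augIdeal k G ≤
      Ideal.span (Set.range (Ybar (f := f) q red σ₀)) ⊔
        augIdeal k G *
          augIdeal k G := by
  classical
  have hmax := isMaximal_pIdeal_one hK
  let _ : Field (intRing K ⧸ pIdeal p K 1) := Ideal.Quotient.field _
  have := finite_quotient_pIdeal (p := p) (K := K) 1
  let _ : Fintype (intRing K ⧸ pIdeal p K 1) := Fintype.ofFinite _
  have hc : Fintype.card (intRing K ⧸ pIdeal p K 1) = p ^ f := by
    rw [← Nat.card_eq_fintype_card, natCard_quotient_pIdeal f hf, pow_one]
  have hp0 : ((p : ℕ) : intRing K ⧸ pIdeal p K 1) = 0 := by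
    rw [← map_natCast (Ideal.Quotient.mk (pIdeal p K 1)), Ideal.Quotient.eq_zero_iff_mem,
      mem_pIdeal_iff, pow_one]
  have hcharF : CharP (intRing K ⧸ pIdeal p K 1) p :=
    (CharP.charP_iff_prime_eq_zero (Fact.out : p.Prime)).mpr hp0
  set I := augIdeal k G with hI
  set J := Ideal.span (Set.range (Ybar (f := f) q red σ₀)) ⊔ I * I with hJ
  let π := Ideal.Quotient.mk J
  let e : intRing K → AddMonoidAlgebra k G :=
    fun x => AddMonoidAlgebra.single (q x) 1 - 1
  have he : ∀ x, e x ∈ I := fun x => Ideal.subset_span ⟨q x, rfl⟩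
  have hII : ∀ x z, e x * e z ∈ J := fun x z =>
    (le_sup_right : I * I ≤ J) (Ideal.mul_mem_mul (he x) (he z))
  -- Since `[x + z] - 1` differs from `([x] - 1) + ([z] - 1)` by the product of the two brackets, `x
  -- ↦ [x] - 1` is additive modulo `I * I`. The target is killed by `p`, so the map factors through
  -- the residue field.
  let d₀ : intRing K →+ (AddMonoidAlgebra k G ⧸ J) :=
    AddMonoidHom.mk' (fun x => π (e x)) fun x z => by
      rw [← map_add, Ideal.Quotient.eq]
      have h1 : e (x + z) - (e x + e z) = e x * e z := by
        have h2 : AddMonoidAlgebra.single (q (x + z)) (1 : k) =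
            AddMonoidAlgebra.single (q x) 1 * AddMonoidAlgebra.single (q z) 1 := by
          rw [AddMonoidAlgebra.single_mul_single, map_add, mul_one]
        simp only [e]
        rw [h2]
        ring
      rw [h1]
      exact hII x z
  have hpz : ∀ z : AddMonoidAlgebra k G ⧸ J, p • z = 0 := by
    intro z
    rw [← Nat.cast_smul_eq_nsmul k, CharP.cast_eq_zero, zero_smul]
  have hd₀ : ∀ x ∈ pIdeal p K 1, d₀ x = 0 := by
    intro x hx
    rw [mem_pIdeal_iff, pow_one] at hx
    obtain ⟨z, rfl⟩ := hx
    rw [← nsmul_eq_mul, map_nsmul, hpz]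
  let d : (intRing K ⧸ pIdeal p K 1) →+
      (AddMonoidAlgebra k G ⧸ J) :=
    QuotientAddGroup.lift (pIdeal p K 1).toAddSubgroup d₀ hd₀
  have hd : ∀ x, d (Ideal.Quotient.mk _ x) = π (e x) := fun x => rfl
  let τ : (intRing K ⧸ pIdeal p K 1) →+* k :=
    Ideal.Quotient.lift _ (red.comp (sigmaInt hE σ₀)) fun x hx => by
      rw [mem_pIdeal_iff, pow_one] at hx
      obtain ⟨z, rfl⟩ := hx
      rw [map_mul, map_natCast, CharP.cast_eq_zero, zero_mul]
  have hτ : ∀ x, τ (Ideal.Quotient.mk _ x) = red (sigmaInt hE σ₀ x) :=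
    fun x => rfl
  obtain ⟨ε, hε⟩ := Teich.exists_equiv_units hK hf
  -- The character sums of `d` are the classes of the `Ybar`, which vanish because `J` contains
  -- them.
  have hsum : ∀ i < f, ∑ u : (intRing K ⧸ pIdeal p K 1)ˣ,
      τ (((u⁻¹ : (intRing K ⧸ pIdeal p K 1)ˣ) : intRing K ⧸ pIdeal p K 1) ^ p ^ i) •
        d (u : intRing K ⧸ pIdeal p K 1) = 0 := by
    intro i hi
    rw [← Equiv.sum_comp ε]
    have h1 : ∀ ζ : Teich p f K,
        τ ((((ε ζ)⁻¹ : (intRing K ⧸ pIdeal p K 1)ˣ) : intRing K ⧸ pIdeal p K 1) ^ p ^ i) =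
          red (ζ.charInv σ₀ i) := by
      intro ζ
      have h2 : τ ((ε ζ : intRing K ⧸ pIdeal p K 1) ^ p ^ i) *
          red (ζ.charInv σ₀ i) = 1 := by
        rw [hε, ← map_pow, hτ, ← map_mul, ← map_one red]
        congr 1
        apply Subtype.ext
        change σ₀ (((ζ.toInt p f : intRing K) : K) ^ p ^ i) * (σ₀ (ζ.1 ^ p ^ i))⁻¹ = 1
        refine mul_inv_cancel₀ ?_
        have h3 : ζ.1 ≠ 0 := by
          rw [← norm_pos_iff, norm_eq_one_of_mem ζ.2]; exact one_pos
        exact (map_ne_zero σ₀).mpr (pow_ne_zero _ h3)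
      have h4 : τ ((((ε ζ)⁻¹ : (intRing K ⧸ pIdeal p K 1)ˣ) : intRing K ⧸ pIdeal p K 1) ^ p ^ i) *
          τ ((ε ζ : intRing K ⧸ pIdeal p K 1) ^ p ^ i) = 1 := by
        rw [← map_mul, ← mul_pow, Units.inv_mul, one_pow, map_one]
      exact left_inv_eq_right_inv h4 h2
    have h5 : ∑ ζ : Teich p f K,
        τ ((((ε ζ)⁻¹ : (intRing K ⧸ pIdeal p K 1)ˣ) : intRing K ⧸ pIdeal p K 1) ^ p ^ i) •
          d (ε ζ : intRing K ⧸ pIdeal p K 1) = π (Ybar q red σ₀ (⟨i, hi⟩ : Fin f)) := by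
      rw [Ybar, map_sum]
      refine Finset.sum_congr rfl fun ζ _ => ?_
      rw [h1, hε, hd]
      rfl
    rw [h5, Ideal.Quotient.eq_zero_iff_mem]
    exact (le_sup_left : _ ≤ J) (Ideal.subset_span ⟨_, rfl⟩)
  have hzero := addMonoidHom_eq_zero_of_sum_eq_zero (p := p) hc τ d hsum
  rw [hI, augIdeal, Ideal.span_le]
  rintro _ ⟨g, rfl⟩
  obtain ⟨x, rfl⟩ := hq g
  have h6 := hzero (Ideal.Quotient.mk _ x)
  rw [hd, Ideal.Quotient.eq_zero_iff_mem] at h6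
  exact h6

/-- The monomials in the `Y_{σ_i}` with exponents `< p ^ n` form a basis of the group algebra of
`O_K / p ^ n` over the residue field. -/
lemma Ybar_monomials [CharP k p] [Finite G] {n : ℕ} (hG : ∀ g : G, p ^ n • g = 0)
    (hcard : Nat.card G = (p ^ n) ^ f) (hq : Function.Surjective q)
    (hK : IsUnramified p K) (hf : Module.finrank ℚ_[p] K = f)
    (hE : IsNormalizedPadicNorm p E) (σ₀ : K →ₐ[ℚ_[p]] E) :
    ⊤ ≤ Submodule.span k
      (Set.range fun j : Fin f → Fin (p ^ n) => ∏ i, Ybar q red σ₀ i ^ (j i : ℕ)) ∧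
    LinearIndependent k
      (fun j : Fin f → Fin (p ^ n) => ∏ i, Ybar q red σ₀ i ^ (j i : ℕ)) := by
  exact linearIndependent_monomials (p := p) hG hcard (Ybar_mem_augIdeal q red σ₀)
    (Ybar_pow_eq_zero q red hG σ₀) (augIdeal_le_span_Ybar q red hq hK hf hE σ₀)

end Residue

/-! ### The sup norm on a group algebra -/

section NormedGroupAlgebra

variable (R G : Type*) [NormedCommRing R] [IsUltrametricDist R] [AddCommGroup G] [Fintype G]

/-- The coefficients of an element of a group algebra, as an additive homomorphism. -/
def groupAlgCoeff : AddMonoidAlgebra R G →+ (G → R) where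
  toFun x g := x.coeff g
  map_zero' := rfl
  map_add' _ _ := rfl

lemma groupAlgCoeff_injective : Function.Injective (groupAlgCoeff R G) := fun x y h => by
  ext g
  exact congrFun h g

/-- The group algebra of a finite group, with the supremum norm on coefficients. -/
abbrev groupAlgNormedGroup : NormedAddCommGroup (AddMonoidAlgebra R G) :=
  NormedAddCommGroup.induced _ (G → R) (groupAlgCoeff R G) (groupAlgCoeff_injective R G)

/-- The group algebra of a finite group is a normed ring for the supremum norm. -/
abbrev groupAlgNormedRing : NormedCommRing (AddMonoidAlgebra R G) :=
  { groupAlgNormedGroup R G, (inferInstance : CommRing (AddMonoidAlgebra R G)) with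
    norm_mul_le := fun x y => by
      change ‖groupAlgCoeff R G (x * y)‖ ≤ ‖groupAlgCoeff R G x‖ * ‖groupAlgCoeff R G y‖
      refine (pi_norm_le_iff_of_nonneg (by positivity)).mpr fun g => ?_
      change ‖(x * y).coeff g‖ ≤ _
      rw [AddMonoidAlgebra.coeff_mul_apply_left]
      refine IsUltrametricDist.norm_sum_le_of_forall_le_of_nonneg (by positivity) fun h _ => ?_
      refine (norm_mul_le _ _).trans ?_
      exact mul_le_mul (norm_le_pi_norm (groupAlgCoeff R G x) h)
        (norm_le_pi_norm (groupAlgCoeff R G y) _) (norm_nonneg _) (norm_nonneg _) }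

attribute [local instance] groupAlgNormedRing

variable {R G}

lemma norm_groupAlg_le {x : AddMonoidAlgebra R G} {C : ℝ} (hC : 0 ≤ C) :
    ‖x‖ ≤ C ↔ ∀ g, ‖x.coeff g‖ ≤ C :=
  pi_norm_le_iff_of_nonneg hC

lemma norm_groupAlg_lt {x : AddMonoidAlgebra R G} {C : ℝ} (hC : 0 < C) :
    ‖x‖ < C ↔ ∀ g, ‖x.coeff g‖ < C :=
  pi_norm_lt_iff hC

lemma isUltrametricDist_groupAlg : IsUltrametricDist (AddMonoidAlgebra R G) :=
  IsUltrametricDist.isUltrametricDist_of_forall_norm_add_le_max_norm fun x y => by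
    refine (norm_groupAlg_le (le_max_of_le_left (norm_nonneg _))).mpr fun g => ?_
    exact (IsUltrametricDist.norm_add_le_max (x.coeff g) (y.coeff g)).trans
      (max_le_max (norm_le_pi_norm (groupAlgCoeff R G x) g)
        (norm_le_pi_norm (groupAlgCoeff R G y) g))

lemma completeSpace_groupAlg [CompleteSpace R] : CompleteSpace (AddMonoidAlgebra R G) := by
  have hiso : Isometry (groupAlgCoeff R G) :=
    AddMonoidHomClass.isometry_of_norm _ fun x => rfl
  refine hiso.isUniformInducing.completeSpace ?_
  have hrange : Set.range (groupAlgCoeff R G) = Set.univ := by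
    refine Set.eq_univ_of_forall fun v => ⟨.ofCoeff (Finsupp.equivFunOnFinite.symm v), ?_⟩
    rfl
  rw [hrange]
  exact isClosed_univ.isComplete

lemma norm_smul_groupAlg_le (hR : ∀ r : R, ‖r‖ ≤ 1) (r : R) (x : AddMonoidAlgebra R G) :
    ‖r • x‖ ≤ ‖x‖ := by
  refine (norm_groupAlg_le (norm_nonneg _)).mpr fun g => ?_
  change ‖r * x.coeff g‖ ≤ _
  exact (norm_mul_le _ _).trans ((mul_le_of_le_one_left (norm_nonneg _) (hR r)).trans
    (norm_le_pi_norm (groupAlgCoeff R G x) g))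

lemma norm_groupAlg_le_one (hR : ∀ r : R, ‖r‖ ≤ 1) (x : AddMonoidAlgebra R G) : ‖x‖ ≤ 1 :=
  (norm_groupAlg_le zero_le_one).mpr fun _ => hR _

lemma norm_mapDomain_le {H : Type*} [AddCommGroup H] [Fintype H] (φ : G → H)
    (x : AddMonoidAlgebra R G) : ‖AddMonoidAlgebra.mapDomain φ x‖ ≤ ‖x‖ := by
  classical
  refine (norm_groupAlg_le (norm_nonneg _)).mpr fun h => ?_
  change ‖Finsupp.mapDomain φ x.coeff h‖ ≤ _
  rw [Finsupp.mapDomain, Finsupp.sum_apply]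
  refine IsUltrametricDist.norm_sum_le_of_forall_le_of_nonneg (norm_nonneg _) fun g _ => ?_
  beta_reduce
  rw [Finsupp.single_apply]
  split_ifs
  · exact norm_le_pi_norm (groupAlgCoeff R G x) g
  · rw [norm_zero]; exact norm_nonneg _

end NormedGroupAlgebra

/-! ### Topologically nilpotent elements and tails of ultrametric series. -/

section Tools

variable {S : Type*} [NormedCommRing S]

/-- Division of `n` by `N` leaves a power of `y ^ N`, decaying geometrically, times a bounded
factor. In the tower only the `p ^ n`-th power of a generator is known to have norm below one. -/
lemma tendsto_pow_of_norm_pow_lt_one (h1 : ‖(1 : S)‖ ≤ 1) {y : S} (hy : ‖y‖ ≤ 1) {N : ℕ}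
    (hN : 0 < N) (h : ‖y ^ N‖ < 1) : Tendsto (fun n => y ^ n) atTop (𝓝 0) := by
  have h2 : Tendsto (fun n : ℕ => ‖y ^ N‖ ^ (n / N)) atTop (𝓝 0) :=
    (tendsto_pow_atTop_nhds_zero_of_lt_one (norm_nonneg _) h).comp
      (Nat.tendsto_div_const_atTop hN.ne')
  have hpow : ∀ (z : S) (_ : ‖z‖ ≤ 1) (m : ℕ), ‖z ^ m‖ ≤ ‖z‖ ^ m := by
    intro z hz m
    rcases Nat.eq_zero_or_pos m with rfl | hm
    · simpa using h1
    · exact norm_pow_le' z hm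
  refine squeeze_zero_norm (fun n => ?_) h2
  have h3 : y ^ n = (y ^ N) ^ (n / N) * y ^ (n % N) := by
    rw [← pow_mul, ← pow_add, Nat.div_add_mod]
  rw [h3]
  refine (norm_mul_le _ _).trans ((mul_le_of_le_one_right (norm_nonneg _) ?_).trans
    (hpow _ h.le _))
  exact (hpow y hy _).trans (pow_le_one₀ (norm_nonneg _) hy)

lemma norm_tsum_sub_sum_le {ι S : Type*} [NormedAddCommGroup S] [IsUltrametricDist S]
    {u : ι → S} (hu : Summable u) (t : Finset ι) {C : ℝ} (hC : 0 ≤ C)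
    (h : ∀ k ∉ t, ‖u k‖ ≤ C) : ‖∑' k, u k - ∑ k ∈ t, u k‖ ≤ C := by
  classical
  have h1 : HasSum (fun k => if k ∈ t then 0 else u k) (∑' k, u k - ∑ k ∈ t, u k) := by
    have h2 : HasSum (fun k => if k ∈ t then u k else 0) (∑ k ∈ t, u k) := by
      have h3 : HasSum (fun k => if k ∈ t then u k else 0) (∑ k ∈ t, if k ∈ t then u k else 0) :=
        hasSum_sum_of_ne_finset_zero fun k hk => if_neg hk
      rwa [Finset.sum_congr rfl fun k hk => if_pos hk] at h3
    convert! hu.hasSum.sub h2 using 1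
    funext k
    split_ifs <;> simp
  rw [← h1.tsum_eq]
  refine IsUltrametricDist.norm_tsum_le_of_forall_le_of_nonneg hC fun k => ?_
  split_ifs with hk
  · simpa using hC
  · exact h k hk

end Tools

/-! ### Power series rings as inverse limits of group algebras -/

section Tower

/-- Exponents all of whose entries are `< N`. -/
def expBox (f N : ℕ) : Finset (Fin f →₀ ℕ) := (finite_finsupp_lt f N).toFinset

lemma mem_expBox {f N : ℕ} {k : Fin f →₀ ℕ} : k ∈ expBox f N ↔ ∀ i, k i < N := by
  simp [expBox]

/-- A tower of group algebras `R[G n]` with compatible elements `y n i`, whose reductions are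
nilpotent and whose monomials with exponents `< p ^ n` reduce to a basis of `k[G n]`. -/
structure MonomialTower {R k : Type*} [NormedCommRing R] [CommRing k] (red : R →+* k) (ϖ : R)
    (p : ℕ) {G : ℕ → Type*} [∀ n, AddCommGroup (G n)] (t : ∀ n, G (n + 1) →+ G n) {f : ℕ}
    (y : ∀ n, Fin f → AddMonoidAlgebra R (G n)) : Prop where
  one_lt : 1 < p
  norm_le : ∀ r : R, ‖r‖ ≤ 1
  red_eq_zero : ∀ r : R, red r = 0 ↔ ‖r‖ < 1
  red_surj : Function.Surjective red
  norm_unif : ‖ϖ‖ < 1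
  dvd : ∀ r : R, ‖r‖ < 1 → ∃ z, r = ϖ * z
  cancel : ∀ r : R, ϖ * r = 0 → r = 0
  map_y : ∀ n i, AddMonoidAlgebra.mapDomain (t n) (y (n + 1) i) = y n i
  pow_y : ∀ n i, AddMonoidAlgebra.mapRingHom (G n) red (y n i) ^ p ^ n = 0
  span : ∀ n (x : AddMonoidAlgebra k (G n)), ∃ d : (Fin f →₀ ℕ) → k,
    ∑ j ∈ expBox f (p ^ n), d j • ∏ i, AddMonoidAlgebra.mapRingHom (G n) red (y n i) ^ j i = x
  indep : ∀ n (d : (Fin f →₀ ℕ) → k),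
    ∑ j ∈ expBox f (p ^ n), d j • ∏ i, AddMonoidAlgebra.mapRingHom (G n) red (y n i) ^ j i = 0 →
      ∀ j ∈ expBox f (p ^ n), d j = 0

variable {R k : Type*} [NormedCommRing R] [IsUltrametricDist R] [CompleteSpace R] [CommRing k]
  {red : R →+* k} {ϖ : R} {p : ℕ} {G : ℕ → Type*} [∀ n, AddCommGroup (G n)] [∀ n, Fintype (G n)]
  {t : ∀ n, G (n + 1) →+ G n} {f : ℕ} {y : ∀ n, Fin f → AddMonoidAlgebra R (G n)}

attribute [local instance] groupAlgNormedRing isUltrametricDist_groupAlg completeSpace_groupAlg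

namespace MonomialTower

variable (h : MonomialTower red ϖ p t y)

include h in
lemma map_eq_zero_iff (n : ℕ) (x : AddMonoidAlgebra R (G n)) :
    AddMonoidAlgebra.mapRingHom (G n) red x = 0 ↔ ‖x‖ < 1 := by
  rw [norm_groupAlg_lt one_pos]
  constructor
  · intro h0 g
    rw [← h.red_eq_zero, ← AddMonoidAlgebra.coeff_mapRingHom, h0]
    rfl
  · intro h0
    ext g
    rw [AddMonoidAlgebra.coeff_mapRingHom, (h.red_eq_zero _).mpr (h0 g)]
    rfl

include h in
lemma norm_pow_y_lt (n : ℕ) (i : Fin f) : ‖y n i ^ p ^ n‖ < 1 := by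
  rw [← h.map_eq_zero_iff, map_pow, h.pow_y]

include h in
lemma tendsto_prod (n : ℕ) :
    Tendsto (fun j : Fin f →₀ ℕ => ∏ i, y n i ^ j i) cofinite (𝓝 0) :=
  tendsto_prod_pow (norm_groupAlg_le_one h.norm_le _)
    (fun i => norm_groupAlg_le_one h.norm_le _) fun i =>
    tendsto_pow_of_norm_pow_lt_one (norm_groupAlg_le_one h.norm_le _)
      (norm_groupAlg_le_one h.norm_le _) (pow_pos (by have := h.one_lt; omega) n)
      (h.norm_pow_y_lt n i)

/-- Evaluation of power series at level `n`. -/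
def level (n : ℕ) : MvPowerSeries (Fin f) R →ₐ[R] AddMonoidAlgebra R (G n) :=
  evalHom (norm_smul_groupAlg_le h.norm_le) (h.tendsto_prod n)

lemma level_X (n : ℕ) (i : Fin f) : h.level n (MvPowerSeries.X i) = y n i := evalHom_X _ _ i

lemma map_level (n : ℕ) (F : MvPowerSeries (Fin f) R) :
    AddMonoidAlgebra.mapDomain (t n) (h.level (n + 1) F) = h.level n F := by
  let T : AddMonoidAlgebra R (G (n + 1)) →+* AddMonoidAlgebra R (G n) :=
    AddMonoidAlgebra.mapDomainRingHom R (t n)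
  have hT : Continuous T :=
    AddMonoidHomClass.continuous_of_bound T 1 fun x => by
      rw [one_mul]; exact norm_mapDomain_le (t n) x
  have hs := (summable_coeff_smul_prod (norm_smul_groupAlg_le h.norm_le)
    (h.tendsto_prod (n + 1)) F).hasSum.map T hT
  have h1 : T (h.level (n + 1) F) = ∑' j : Fin f →₀ ℕ, MvPowerSeries.coeff j F •
      ∏ i, y n i ^ j i := by
    refine hs.tsum_eq.symm.trans (tsum_congr fun j => ?_)
    have h2 : ∀ i, T (y (n + 1) i) = y n i := h.map_y n
    have h3 : ∀ (c : R) (x : AddMonoidAlgebra R (G (n + 1))), T (c • x) = c • T x :=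
      fun c x => map_smul (AddMonoidAlgebra.mapDomainAlgHom R R (t n)) c x
    rw [Function.comp_apply, h3, map_prod]
    simp only [map_pow, h2]
  exact h1

/-- A monomial outside the box contains some `y n i ^ p ^ n`, of norm below one, so only a finite
sum survives reduction. -/
lemma red_level (n : ℕ) (F : MvPowerSeries (Fin f) R) :
    AddMonoidAlgebra.mapRingHom (G n) red (h.level n F) = ∑ j ∈ expBox f (p ^ n),
      red (MvPowerSeries.coeff j F) • ∏ i, AddMonoidAlgebra.mapRingHom (G n) red (y n i) ^ j i := by
  have hone := norm_groupAlg_le_one (G := G n) h.norm_le 1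
  have hle : ∀ i, ‖y n i‖ ≤ 1 := fun i => norm_groupAlg_le_one h.norm_le _
  have hsmul : ∀ (c : R) (x : AddMonoidAlgebra R (G n)),
      AddMonoidAlgebra.mapRingHom (G n) red (c • x) =
        red c • AddMonoidAlgebra.mapRingHom (G n) red x := by
    intro c x
    ext g
    simp
  have h1 : ‖h.level n F - ∑ j ∈ expBox f (p ^ n), MvPowerSeries.coeff j F • ∏ i, y n i ^ j i‖
      < 1 := by
    -- A bound uniform over the omitted terms is required: the sup norm of the finite tuple `i ↦ y n
    -- i ^ p ^ n`, again below one.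
    refine (norm_tsum_sub_sum_le (summable_coeff_smul_prod (norm_smul_groupAlg_le h.norm_le)
      (h.tendsto_prod n) F) (expBox f (p ^ n)) (norm_nonneg fun i => y n i ^ p ^ n)
      fun j hj => ?_).trans_lt ((pi_norm_lt_iff one_pos).mpr (h.norm_pow_y_lt n))
    rw [mem_expBox] at hj
    push Not at hj
    obtain ⟨i, hi⟩ := hj
    refine (norm_smul_groupAlg_le h.norm_le _ _).trans ?_
    refine (norm_prod_pow_le_of hone hle j i).trans ?_
    refine le_trans ?_ (norm_le_pi_norm (fun i => y n i ^ p ^ n) i)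
    rw [← Nat.add_sub_of_le hi, pow_add]
    exact (norm_mul_le _ _).trans
      (mul_le_of_le_one_right (norm_nonneg _) (norm_groupAlg_le_one h.norm_le _))
  rw [← h.map_eq_zero_iff, map_sub, sub_eq_zero, map_sum] at h1
  rw [h1]
  refine Finset.sum_congr rfl fun j _ => ?_
  rw [hsmul, map_prod]
  simp only [map_pow]

/-- Independence applies at any level whose box contains `j`; level `j.degree` qualifies because `m
< p ^ m`. -/
lemma norm_coeff_lt_one {F : MvPowerSeries (Fin f) R} (hF : ∀ n, h.level n F = 0)
    (j : Fin f →₀ ℕ) : ‖MvPowerSeries.coeff j F‖ < 1 := by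
  rw [← h.red_eq_zero]
  have h1 := h.red_level j.degree F
  rw [hF, map_zero] at h1
  refine h.indep j.degree (fun j => red (MvPowerSeries.coeff j F)) h1.symm j ?_
  rw [mem_expBox]
  exact fun i => (Finsupp.le_degree i j).trans_lt (Nat.lt_pow_self h.one_lt)

include h in
lemma exists_smul_eq {F : MvPowerSeries (Fin f) R}
    (hF : ∀ j, ‖MvPowerSeries.coeff j F‖ < 1) : ∃ F' : MvPowerSeries (Fin f) R, F = ϖ • F' := by
  choose z hz using fun j => h.dvd _ (hF j)
  exact ⟨fun j => z j, MvPowerSeries.ext fun j => hz j⟩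

include h in
lemma smul_cancel {n : ℕ} {x : AddMonoidAlgebra R (G n)} (hx : ϖ • x = 0) : x = 0 := by
  ext g
  exact h.cancel _ (congrArg (fun z : AddMonoidAlgebra R (G n) => z.coeff g) hx)

/-- All coefficients are divisible by `ϖ`, and the quotient vanishes at all levels too because `ϖ`
can be cancelled. Iteration makes the coefficients divisible by every power of `ϖ`. -/
lemma eq_zero_of_level_eq_zero {F : MvPowerSeries (Fin f) R} (hF : ∀ n, h.level n F = 0) :
    F = 0 := by
  have key : ∀ m : ℕ, ∃ F' : MvPowerSeries (Fin f) R, F = ϖ ^ m • F' ∧ ∀ n, h.level n F' = 0 := by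
    intro m
    induction m with
    | zero => exact ⟨F, by simp, hF⟩
    | succ m ih =>
      obtain ⟨F', rfl, h0⟩ := ih
      obtain ⟨F'', rfl⟩ := h.exists_smul_eq (h.norm_coeff_lt_one h0)
      refine ⟨F'', by rw [smul_smul, pow_succ], fun n => h.smul_cancel ?_⟩
      rw [← map_smul, h0]
  ext j
  rw [map_zero, ← norm_le_zero_iff]
  refine ge_of_tendsto (tendsto_pow_atTop_nhds_zero_of_lt_one (norm_nonneg _) h.norm_unif)
    ((eventually_gt_atTop 0).mono fun m hm => ?_)
  obtain ⟨F', rfl, -⟩ := key m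
  rw [map_smul, smul_eq_mul]
  exact (norm_mul_le _ _).trans ((mul_le_of_le_one_right (norm_nonneg _) (h.norm_le _)).trans
    (norm_pow_le' _ hm))

/-- Compatible families of elements of the tower. -/
def Compat (t : ∀ n, G (n + 1) →+ G n) (x : ∀ n, AddMonoidAlgebra R (G n)) : Prop :=
  ∀ n, AddMonoidAlgebra.mapDomain (t n) (x (n + 1)) = x n

/-- Surjectivity modulo `ϖ`: by independence the coordinates at consecutive levels agree on the
smaller box, so each coordinate stabilises and prescribes a coefficient of `F`. -/
lemma exists_red_eq {x : ∀ n, AddMonoidAlgebra R (G n)} (hx : Compat t x) :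
    ∃ F : MvPowerSeries (Fin f) R, ∀ n,
      AddMonoidAlgebra.mapRingHom (G n) red (x n - h.level n F) = 0 := by
  choose d hd using fun n => h.span n (AddMonoidAlgebra.mapRingHom (G n) red (x n))
  have hp0 : 0 < p := by have := h.one_lt; omega
  have hT : ∀ (n : ℕ) (z : AddMonoidAlgebra R (G (n + 1))),
      AddMonoidAlgebra.mapDomainRingHom k (t n) (AddMonoidAlgebra.mapRingHom (G (n + 1)) red z) =
        AddMonoidAlgebra.mapRingHom (G n) red (AddMonoidAlgebra.mapDomain (t n) z) := by
    intro n z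
    induction z using AddMonoidAlgebra.induction_linear with
    | zero => simp [AddMonoidAlgebra.mapDomain_zero]
    | add a b ha hb => rw [map_add, map_add, ha, hb, AddMonoidAlgebra.mapDomain_add, map_add]
    | single g c => simp
  have hmono : Monotone fun n => expBox f (p ^ n) := fun n m hnm j hj => by
    rw [mem_expBox] at hj ⊢
    exact fun i => (hj i).trans_le (Nat.pow_le_pow_right hp0 hnm)
  have hstep : ∀ n, ∀ j ∈ expBox f (p ^ n), d (n + 1) j = d n j := by
    intro n j hj
    rw [← sub_eq_zero]
    refine h.indep n (fun j => d (n + 1) j - d n j) ?_ j hj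
    simp only [sub_smul]
    rw [Finset.sum_sub_distrib, hd, sub_eq_zero]
    have h1 := congrArg (AddMonoidAlgebra.mapDomainRingHom k (t n)) (hd (n + 1))
    rw [hT, hx n, map_sum] at h1
    rw [← h1]
    have h2 : ∀ j : Fin f →₀ ℕ, AddMonoidAlgebra.mapDomainRingHom k (t n) (d (n + 1) j •
        ∏ i, AddMonoidAlgebra.mapRingHom (G (n + 1)) red (y (n + 1) i) ^ j i) =
        d (n + 1) j • ∏ i, AddMonoidAlgebra.mapRingHom (G n) red (y n i) ^ j i := by
      intro j
      have h3 : ∀ (c : k) (z : AddMonoidAlgebra k (G (n + 1))),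
          AddMonoidAlgebra.mapDomainRingHom k (t n) (c • z) =
            c • AddMonoidAlgebra.mapDomainRingHom k (t n) z :=
        fun c z => map_smul (AddMonoidAlgebra.mapDomainAlgHom k k (t n)) c z
      rw [h3, map_prod]
      simp only [map_pow, hT, h.map_y]
    simp only [h2]
    refine Finset.sum_subset (hmono n.le_succ) fun j _ hj => ?_
    rw [mem_expBox] at hj
    push Not at hj
    obtain ⟨i, hi⟩ := hj
    have h0 : AddMonoidAlgebra.mapRingHom (G n) red (y n i) ^ j i = 0 :=
      pow_eq_zero_of_le hi (h.pow_y n i)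
    rw [Finset.prod_eq_zero (Finset.mem_univ i) h0, smul_zero]
  have hstep' : ∀ n m, n ≤ m → ∀ j ∈ expBox f (p ^ n), d m j = d n j := by
    intro n m hnm j hj
    induction m, hnm using Nat.le_induction with
    | base => rfl
    | succ m hnm ih => rw [hstep m j (hmono hnm hj), ih]
  choose l hl using h.red_surj
  obtain ⟨F, hF⟩ : ∃ F : MvPowerSeries (Fin f) R,
      ∀ j, MvPowerSeries.coeff j F = l (d j.degree j) :=
    ⟨fun j => l (d j.degree j), fun _ => rfl⟩
  refine ⟨F, fun n => ?_⟩
  rw [map_sub, sub_eq_zero, h.red_level, ← hd n]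
  refine Finset.sum_congr rfl fun j hj => ?_
  congr 1
  rw [hF]
  have hj' : j ∈ expBox f (p ^ j.degree) := by
    rw [mem_expBox]
    exact fun i => (Finsupp.le_degree i j).trans_lt (Nat.lt_pow_self h.one_lt)
  rw [hl, ← hstep' n _ (le_max_left n j.degree) j hj, hstep' j.degree _ (le_max_right _ _) j hj']

lemma exists_eq_add_smul {x : ∀ n, AddMonoidAlgebra R (G n)} (hx : Compat t x) :
    ∃ (F : MvPowerSeries (Fin f) R) (x' : ∀ n, AddMonoidAlgebra R (G n)), Compat t x' ∧
      ∀ n, x n = h.level n F + ϖ • x' n := by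
  obtain ⟨F, hF⟩ := h.exists_red_eq hx
  have h1 : ∀ n, ∃ z : AddMonoidAlgebra R (G n), x n - h.level n F = ϖ • z := by
    intro n
    have h2 := (norm_groupAlg_lt one_pos).mp ((h.map_eq_zero_iff n _).mp (hF n))
    choose z hz using fun g => h.dvd _ (h2 g)
    refine ⟨.ofCoeff (Finsupp.equivFunOnFinite.symm z), ?_⟩
    ext g
    exact hz g
  choose x' hx' using h1
  refine ⟨F, x', fun n => ?_, fun n => by rw [← hx' n]; abel⟩
  rw [← sub_eq_zero]
  apply h.smul_cancel
  have h3 : ∀ (c : R) (z : AddMonoidAlgebra R (G (n + 1))),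
      AddMonoidAlgebra.mapDomain (t n) (c • z) = c • AddMonoidAlgebra.mapDomain (t n) z :=
    fun c z => map_smul (AddMonoidAlgebra.mapDomainAlgHom R R (t n)) c z
  have h4 : AddMonoidAlgebra.mapDomain (t n) (x (n + 1) - h.level (n + 1) F) =
      x n - h.level n F := by
    rw [← h.map_level n F]
    conv_rhs => rw [← hx n]
    exact map_sub (AddMonoidAlgebra.mapDomainRingHom R (t n)) _ _
  rw [smul_sub, ← h3, ← hx', ← hx', h4, sub_self]

/-- Successive approximation: the error in `exists_eq_add_smul` is `ϖ` times another compatible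
family, so the corrections sum with weights `ϖ ^ m`. -/
lemma exists_level_eq {x : ∀ n, AddMonoidAlgebra R (G n)} (hx : Compat t x) :
    ∃ F : MvPowerSeries (Fin f) R, ∀ n, h.level n F = x n := by
  choose Fs nx hnx heq using
    fun x : {x : ∀ n, AddMonoidAlgebra R (G n) // Compat t x} => h.exists_eq_add_smul x.2
  let a : ℕ → {x : ∀ n, AddMonoidAlgebra R (G n) // Compat t x} :=
    fun m => (fun x => ⟨nx x, hnx x⟩)^[m] ⟨x, hx⟩
  have ha : ∀ m, (a (m + 1)).1 = nx (a m) := fun m => by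
    simp only [a]
    rw [Function.iterate_succ_apply']
  have hunif : ∀ (m : ℕ) (r : R), ‖ϖ ^ m * r‖ ≤ ‖ϖ‖ ^ m := by
    intro m r
    rcases Nat.eq_zero_or_pos m with rfl | hm
    · simpa using h.norm_le r
    · exact (norm_mul_le _ _).trans ((mul_le_of_le_one_right (norm_nonneg _) (h.norm_le _)).trans
        (norm_pow_le' _ hm))
  have hlim := tendsto_pow_atTop_nhds_zero_of_lt_one (norm_nonneg _) h.norm_unif
  have hsum : ∀ (m : ℕ) (j : Fin f →₀ ℕ),
      Summable fun i => ϖ ^ i * MvPowerSeries.coeff j (Fs (a (i + m))) := by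
    intro m j
    refine summable_of_tendsto ?_
    rw [Nat.cofinite_eq_atTop]
    exact squeeze_zero_norm (fun i => hunif i _) hlim
  -- `T m` is the tail of the correction series from index `m`, divided by `ϖ ^ m`. Naming every
  -- tail turns the limit into the exact recursion `hT`.
  let T : ℕ → MvPowerSeries (Fin f) R :=
    fun m j => ∑' i, ϖ ^ i * MvPowerSeries.coeff j (Fs (a (i + m)))
  have hT : ∀ m, T m = Fs (a m) + ϖ • T (m + 1) := by
    intro m
    ext j
    change ∑' i, ϖ ^ i * MvPowerSeries.coeff j (Fs (a (i + m))) =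
      MvPowerSeries.coeff j (Fs (a m)) +
        ϖ * ∑' i, ϖ ^ i * MvPowerSeries.coeff j (Fs (a (i + (m + 1))))
    rw [(hsum m j).tsum_eq_zero_add, ← (hsum (m + 1) j).tsum_mul_left]
    simp only [pow_zero, one_mul, zero_add, pow_succ']
    congr 1
    refine tsum_congr fun i => ?_
    rw [mul_assoc, show i + 1 + m = i + (m + 1) by omega]
  have key : ∀ m n, h.level n (T 0) - x n = ϖ ^ m • (h.level n (T m) - (a m).1 n) := by
    intro m n
    induction m with
    | zero => rw [pow_zero, one_smul]; rfl
    | succ m ih =>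
      rw [ih, hT m, heq (a m) n, ha, map_add, map_smul, add_sub_add_left_eq_sub, ← smul_sub,
        smul_smul, pow_succ]
  refine ⟨T 0, fun n => ?_⟩
  rw [← sub_eq_zero, ← norm_le_zero_iff]
  refine ge_of_tendsto hlim (Eventually.of_forall fun m => ?_)
  rw [key m n]
  refine (norm_groupAlg_le (pow_nonneg (norm_nonneg _) _)).mpr fun g => ?_
  exact hunif m _

end MonomialTower

end Tower

/-! ### The isomorphism between the power series ring and the Iwasawa algebra -/

section Theta

variable {p : ℕ} [Fact p.Prime] {f : ℕ} {E : Type*} [NormedField E] [IsUltrametricDist E]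
  [CompleteSpace E] [Algebra ℚ_[p] E]
  {K : Type*} [NormedField K] [NormedAlgebra ℚ_[p] K] [IsUltrametricDist K]
  [FiniteDimensional ℚ_[p] K]

lemma isClosed_intRing : IsClosed (intRing E : Set E) := by
  change IsClosed {x : E | ‖x‖ ≤ 1}
  exact isClosed_le continuous_norm continuous_const

lemma completeSpace_intRing : CompleteSpace (intRing E) :=
  isClosed_intRing.completeSpace_coe

lemma mapRingHom_smul_single_sub_one {R k G : Type*} [CommRing R] [CommRing k] [AddCommGroup G]
    (red : R →+* k) (c : R) (g : G) :
    AddMonoidAlgebra.mapRingHom G red (c • (AddMonoidAlgebra.single g 1 - 1)) =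
      red c • (AddMonoidAlgebra.single g 1 - 1) := by
  have h : ∀ x, AddMonoidAlgebra.mapRingHom G red (c • x) =
      red c • AddMonoidAlgebra.mapRingHom G red x := by
    intro x
    ext g
    simp
  rw [h, map_sub, map_one, AddMonoidAlgebra.mapRingHom_single, map_one]

lemma mapRingHom_Ysig {k : Type*} [CommRing k] (red : intRing E →+* k) (hK : IsUnramified p K)
    (hf : Module.finrank ℚ_[p] K = f) (σ₀ : K →ₐ[ℚ_[p]] E) (n : ℕ) (i : Fin f) :
    AddMonoidAlgebra.mapRingHom (intRing K ⧸ pIdeal p K n) red ((Ysig p f σ₀ i).1 n) =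
      Ybar (Ideal.Quotient.mk (pIdeal p K n)).toAddMonoidHom red σ₀ i := by
  have h1 : (Ysig p f σ₀ i).1 n = ∑ ζ : Teich p f K, ζ.charInv σ₀ i •
      (AddMonoidAlgebra.single (Ideal.Quotient.mk (pIdeal p K n) (ζ.toInt p f)) 1 - 1) := by
    have h2 := congrArg (fun x : Iwasawa p E K =>
      (Pi.evalAlgHom (intRing E) (fun n => GroupAlg p E K n) n).comp (Iwasawa p E K).val x)
      (Ysig_eq hK hf σ₀ i)
    refine h2.trans ?_
    rw [map_sum]
    rfl
  rw [h1, map_sum, Ybar]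
  exact Finset.sum_congr rfl fun ζ _ => mapRingHom_smul_single_sub_one red _ _

lemma monomialTower (hK : IsUnramified p K) (hf : Module.finrank ℚ_[p] K = f)
    (hE : IsNormalizedPadicNorm p E) (σ₀ : K →ₐ[ℚ_[p]] E) {ϖ : intRing E}
    (hϖ : ‖(ϖ : E)‖ = (p : ℝ)⁻¹) (hϖ' : ∀ x : E, ‖x‖ < 1 → ‖x‖ ≤ ‖(ϖ : E)‖) :
    MonomialTower (Ideal.Quotient.mk (maxIdeal E)) ϖ p
      (G := fun n => intRing K ⧸ pIdeal p K n) (fun n => proj p K n)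
      (fun n (i : Fin f) => (Ysig p f σ₀ i).1 n) := by
  classical
  have hp1 : (1 : ℝ) < p := by exact_mod_cast (Fact.out : p.Prime).one_lt
  have hchar := charP_residue hE
  have hfin : ∀ n, Finite (intRing K ⧸ pIdeal p K n) := fun n => finite_quotient_pIdeal n
  have hϖ0 : (ϖ : E) ≠ 0 := by
    rw [← norm_pos_iff, hϖ]; positivity
  have hG : ∀ (n : ℕ) (g : intRing K ⧸ pIdeal p K n), p ^ n • g = 0 := by
    intro n g
    obtain ⟨x, rfl⟩ := Ideal.Quotient.mk_surjective g
    rw [← map_nsmul, Ideal.Quotient.eq_zero_iff_mem, mem_pIdeal_iff, nsmul_eq_mul, Nat.cast_pow]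
    exact dvd_mul_right _ _
  have hmon := fun n => Ybar_monomials (n := n) (f := f)
    (Ideal.Quotient.mk (pIdeal p K n)).toAddMonoidHom
    (Ideal.Quotient.mk (maxIdeal E)) (hG n) (natCard_quotient_pIdeal f hf n)
    Ideal.Quotient.mk_surjective hK hf hE σ₀
  have hbox : ∀ n (d : (Fin f →₀ ℕ) → Residue E),
      ∑ j ∈ expBox f (p ^ n), d j • ∏ i, AddMonoidAlgebra.mapRingHom (intRing K ⧸ pIdeal p K n)
        (Ideal.Quotient.mk (maxIdeal E)) ((Ysig p f σ₀ i).1 n) ^ j i =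
      ∑ j : Fin f → Fin (p ^ n), d (Finsupp.equivFunOnFinite.symm fun i => (j i : ℕ)) •
        ∏ i, Ybar (Ideal.Quotient.mk (pIdeal p K n)).toAddMonoidHom
          (Ideal.Quotient.mk (maxIdeal E)) σ₀ i ^ (j i : ℕ) := by
    intro n d
    simp only [mapRingHom_Ysig _ hK hf]
    symm
    refine Finset.sum_bij' (fun j _ => Finsupp.equivFunOnFinite.symm fun i => (j i : ℕ))
      (fun j hj i => ⟨j i, mem_expBox.mp hj i⟩) ?_ ?_ ?_ ?_ ?_
    · intro j _
      rw [mem_expBox]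
      exact fun i => (j i).2
    · intro j _
      exact Finset.mem_univ _
    · intro j _
      rfl
    · intro j _
      ext i
      rfl
    · intro j _
      rfl
  refine
    { one_lt := (Fact.out : p.Prime).one_lt
      norm_le := fun r => r.2
      red_eq_zero := fun r => by
        rw [Ideal.Quotient.eq_zero_iff_mem]
        exact mem_maxIdeal
      red_surj := Ideal.Quotient.mk_surjective
      norm_unif := hϖ.trans_lt (inv_lt_one_of_one_lt₀ hp1)
      dvd := fun r hr => ?_
      cancel := fun r hr => ?_
      map_y := fun n i => (Ysig p f σ₀ i).2 n
      pow_y := fun n i => ?_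
      span := fun n x => ?_
      indep := fun n d hd => ?_ }
  · refine ⟨⟨(ϖ : E)⁻¹ * r, ?_⟩, ?_⟩
    · change ‖(ϖ : E)⁻¹ * r‖ ≤ 1
      rw [norm_mul, norm_inv, inv_mul_le_iff₀ (norm_pos_iff.mpr hϖ0), mul_one]
      exact hϖ' _ hr
    · apply Subtype.ext
      exact (mul_inv_cancel_left₀ hϖ0 _).symm
  · apply Subtype.ext
    exact (mul_eq_zero.mp (congrArg Subtype.val hr)).resolve_left hϖ0
  · rw [mapRingHom_Ysig _ hK hf]
    exact Ybar_pow_eq_zero _ _ (hG n) σ₀ i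
  · obtain ⟨c, hc⟩ := (Submodule.mem_span_range_iff_exists_fun _).mp ((hmon n).1 (x := x) trivial)
    refine ⟨fun j => if hj : ∀ i, j i < p ^ n then c fun i => ⟨j i, hj i⟩ else 0, ?_⟩
    refine (hbox n _).trans (Eq.trans (Finset.sum_congr rfl fun j _ => ?_) hc)
    exact congrArg (· • _) (dif_pos fun i => (j i).2)
  · intro j hj
    have h1 := (hbox n d).symm.trans hd
    have h2 := Fintype.linearIndependent_iff.mp (hmon n).2 _ h1 fun i => ⟨j i, mem_expBox.mp hj i⟩
    have h3 : (Finsupp.equivFunOnFinite.symm fun i => j i) = j := Finsupp.ext fun _ => rfl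
    exact (congrArg d h3).symm.trans h2

attribute [local instance] groupAlgNormedRing isUltrametricDist_groupAlg completeSpace_groupAlg

/-- The identification `O_E[[Y_0, ..., Y_{f-1}]] = O_E[[O_K]]`. -/
lemma exists_theta (hK : IsUnramified p K) (hf : Module.finrank ℚ_[p] K = f)
    (hE : IsNormalizedPadicNorm p E) (σ₀ : K →ₐ[ℚ_[p]] E) :
    ∃ Θ : MvPowerSeries (Fin f) (intRing E) ≃ₐ[intRing E] Iwasawa p E K,
      ∀ i, Θ (MvPowerSeries.X i) = Ysig p f σ₀ i := by
  have hp1 : (1 : ℝ) < p := by exact_mod_cast (Fact.out : p.Prime).one_lt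
  obtain ⟨ϖ, h1, h2⟩ := hE.uniformizer
  have hc := completeSpace_intRing (E := E)
  have := fun n => finite_quotient_pIdeal (p := p) (K := K) n
  let _ := fun n => Fintype.ofFinite (intRing K ⧸ pIdeal p K n)
  have hϖ : ‖ϖ‖ ≤ 1 := h1.trans_le (inv_lt_one_of_one_lt₀ hp1).le
  have h := monomialTower hK hf hE σ₀ (ϖ := ⟨ϖ, hϖ⟩) h1 h2
  let g : MvPowerSeries (Fin f) (intRing E) →ₐ[intRing E] Iwasawa p E K :=
    (AlgHom.pi h.level).codRestrict _
      fun F n => h.map_level n F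
  have hg : ∀ F n, (g F).1 n = h.level n F := fun F n => rfl
  refine ⟨AlgEquiv.ofBijective g ⟨?_, ?_⟩, fun i => ?_⟩
  · rw [injective_iff_map_eq_zero]
    intro F hF
    exact h.eq_zero_of_level_eq_zero fun n => by
      rw [← hg, hF]; rfl
  · intro x
    obtain ⟨F, hF⟩ := h.exists_level_eq (x := x.1) x.2
    exact ⟨F, Subtype.ext (funext hF)⟩
  · exact Subtype.ext (funext fun n => h.level_X n i)

/-- The identification of the power series ring with the Iwasawa algebra is unique. -/
lemma theta_unique {σ₀ : K →ₐ[ℚ_[p]] E}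
    {Θ Θ' : MvPowerSeries (Fin f) (intRing E) ≃ₐ[intRing E] Iwasawa p E K}
    (h : ∀ i, Θ (MvPowerSeries.X i) = Ysig p f σ₀ i)
    (h' : ∀ i, Θ' (MvPowerSeries.X i) = Ysig p f σ₀ i) : Θ = Θ' := by
  ext1 F
  have h1 := algHom_eq_id_of_map_X ((Θ.trans Θ'.symm : _ ≃ₐ[intRing E] _) : _ →ₐ[intRing E] _)
    (fun i => by
      change Θ'.symm (Θ (MvPowerSeries.X i)) = _
      rw [h, ← h', AlgEquiv.symm_apply_apply]) F
  change Θ'.symm (Θ F) = F at h1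
  rw [← Θ'.apply_symm_apply (Θ F), h1]

end Theta

/-! ### Functions given by convergent power series in `p`-adic integer parameters -/

section Analytic

variable {p : ℕ} [Fact p.Prime] {f : ℕ} {E : Type*} [NormedField E] [IsUltrametricDist E]
  [Algebra ℚ_[p] E]

lemma hasSum_of_eq {ι S : Type*} [AddCommMonoid S] [TopologicalSpace S] {u v : ι → S} {a : S}
    (h : HasSum u a) (e : ∀ i, u i = v i) : HasSum v a :=
  (funext e : u = v) ▸ h

lemma padicInt_coe_prod {ι : Type*} (t : Finset ι) (u : ι → ℤ_[p]) :
    ((∏ i ∈ t, u i : ℤ_[p]) : ℚ_[p]) = ∏ i ∈ t, (u i : ℚ_[p]) :=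
  map_prod (PadicInt.Coe.ringHom (p := p)) u t

variable (E) in
/-- The monomial `t ^ k`, as an element of `E`. -/
def tmono (t : Fin f → ℤ_[p]) (k : Fin f → ℕ) : E :=
  algebraMap ℚ_[p] E (∏ j, ((t j : ℤ_[p]) : ℚ_[p]) ^ k j)

lemma norm_tmono_le (hE : IsNormalizedPadicNorm p E) (t : Fin f → ℤ_[p]) (k : Fin f → ℕ) :
    ‖tmono E t k‖ ≤ 1 := by
  have h := hE.norm_algebraMap_le (∏ j, t j ^ k j)
  rw [padicInt_coe_prod] at h
  simpa [tmono] using h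

lemma tmono_zero (t : Fin f → ℤ_[p]) : tmono E t 0 = 1 := by simp [tmono]

lemma tmono_add (t : Fin f → ℤ_[p]) (k l : Fin f → ℕ) :
    tmono E t (k + l) = tmono E t k * tmono E t l := by
  simp [tmono, pow_add, Finset.prod_mul_distrib]

lemma tmono_single (t : Fin f → ℤ_[p]) (j : Fin f) :
    tmono E t (Pi.single j 1) = algebraMap ℚ_[p] E (t j : ℚ_[p]) := by
  rw [tmono, Finset.prod_eq_single j]
  · simp
  · intro i _ hi
    simp [Pi.single_eq_of_ne hi]
  · simp

variable {S : Type*} [NormedCommRing S] [NormedAlgebra E S] {P : Type*}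

variable (E) in
/-- The function `o` is the sum of a power series in the parameters `τ`, with coefficients
tending to zero and bounded by `C`. -/
def IsAnalyticIn (τ : P → Fin f → ℤ_[p]) (C : ℝ) (o : P → S) : Prop :=
  ∃ w : (Fin f → ℕ) → S, Tendsto w cofinite (𝓝 0) ∧ (∀ k, ‖w k‖ ≤ C) ∧
    ∀ x, HasSum (fun k => tmono E (τ x) k • w k) (o x)

namespace IsAnalyticIn

variable {τ : P → Fin f → ℤ_[p]} {C D : ℝ} {o o' : P → S}

lemma nonneg (h : IsAnalyticIn E τ C o) : 0 ≤ C := by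
  obtain ⟨w, -, h2, -⟩ := h
  exact (norm_nonneg _).trans (h2 0)

lemma mono (h : IsAnalyticIn E τ C o) (hCD : C ≤ D) : IsAnalyticIn E τ D o := by
  obtain ⟨w, h1, h2, h3⟩ := h
  exact ⟨w, h1, fun k => (h2 k).trans hCD, h3⟩

variable [IsUltrametricDist S] [CompleteSpace S]

/-- Terms with equal exponents are collected; ultrametric bounds and decay pass to the fibre sums.
This permits series indexed by any type, with repeated exponents. -/
lemma of_hasSum {ι : Type*} (d : ι → Fin f → ℕ) {w : ι → S} (hw : Tendsto w cofinite (𝓝 0))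
    (hC : 0 ≤ C) (hwC : ∀ i, ‖w i‖ ≤ C)
    (h : ∀ x, HasSum (fun i => tmono E (τ x) (d i) • w i) (o x)) : IsAnalyticIn E τ C o := by
  have hs : ∀ k, Summable fun i : {i // d i = k} => w i := fun k =>
    summable_of_tendsto (hw.comp Subtype.val_injective.tendsto_cofinite)
  refine ⟨fun k => ∑' i : {i // d i = k}, w i, ?_, fun k => ?_, fun x => ?_⟩
  · rw [Metric.tendsto_nhds]
    intro ε hε
    have h1 := Metric.tendsto_nhds.mp hw (ε / 2) (half_pos hε)
    rw [eventually_cofinite] at h1 ⊢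
    refine (h1.image d).subset fun k hk => ?_
    by_contra hc
    apply hk
    rw [dist_zero_right]
    refine (IsUltrametricDist.norm_tsum_le_of_forall_le_of_nonneg (half_pos hε).le
      fun i => ?_).trans_lt (half_lt_self hε)
    by_contra hi
    refine hc ⟨i.1, ?_, i.2⟩
    rw [Set.mem_ofPred_eq, dist_zero_right]
    exact fun h2 => hi h2.le
  · exact IsUltrametricDist.norm_tsum_le_of_forall_le_of_nonneg hC fun i => hwC i
  · have h1 := (Equiv.sigmaFiberEquiv d).hasSum_iff.mpr (h x)
    refine h1.sigma fun k => ?_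
    have h2 := (hs k).hasSum.const_smul (tmono E (τ x) k)
    refine hasSum_of_eq h2 fun i => ?_
    change tmono E (τ x) k • w i = tmono E (τ x) (d i) • w i
    rw [i.2]

lemma mul (hE : IsNormalizedPadicNorm p E) (h : IsAnalyticIn E τ C o) (h' : IsAnalyticIn E τ D o') :
    IsAnalyticIn E τ (C * D) fun x => o x * o' x := by
  obtain ⟨w, h1, h2, h3⟩ := id h
  obtain ⟨w', h1', h2', h3'⟩ := id h'
  refine of_hasSum (fun k : (Fin f → ℕ) × (Fin f → ℕ) => k.1 + k.2)
    (w := fun k => w k.1 * w' k.2) ?_ (mul_nonneg h.nonneg h'.nonneg) (fun k => ?_) fun x => ?_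
  · exact tendsto_mul_cofinite_nhds_zero h1 h1'
  · exact (norm_mul_le _ _).trans (mul_le_mul (h2 _) (h2' _) (norm_nonneg _) h.nonneg)
  · have h5 : Summable fun k : (Fin f → ℕ) × (Fin f → ℕ) =>
        (tmono E (τ x) k.1 • w k.1) * (tmono E (τ x) k.2 • w' k.2) :=
      summable_of_tendsto (tendsto_zero_of_norm_le (fun k => by
        rw [smul_mul_smul_comm, ← tmono_add, norm_smul]
        exact mul_le_of_le_one_left (norm_nonneg _) (norm_tmono_le hE _ _))
        (tendsto_mul_cofinite_nhds_zero h1 h1'))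
    have h4 := HasSum.mul (h3 x) (h3' x) h5
    refine hasSum_of_eq h4 fun k => ?_
    rw [tmono_add, smul_mul_smul_comm]

/-- The double family of coefficients tends to zero: `C i` is small for all but finitely many `i`,
and each remaining `i` has finitely many large coefficients. It may therefore be regrouped by
exponent. -/
lemma tsum (hE : IsNormalizedPadicNorm p E) {ι : Type*} {C : ι → ℝ} {o : ι → P → S} {O : P → S}
    (h : ∀ i, IsAnalyticIn E τ (C i) (o i)) (hC : Tendsto C cofinite (𝓝 0)) (hD : 0 ≤ D)
    (hCD : ∀ i, C i ≤ D) (hO : ∀ x, HasSum (fun i => o i x) (O x)) : IsAnalyticIn E τ D O := by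
  choose w h1 h2 h3 using h
  have hw : Tendsto (fun k : ι × (Fin f → ℕ) => w k.1 k.2) cofinite (𝓝 0) := by
    rw [Metric.tendsto_nhds]
    intro ε hε
    have h4 := Metric.tendsto_nhds.mp hC ε hε
    have h5 := fun i => Metric.tendsto_nhds.mp (h1 i) ε hε
    simp only [eventually_cofinite] at h4 h5 ⊢
    refine (h4.biUnion fun i _ => (h5 i).image (Prod.mk i)).subset ?_
    rintro ⟨i, k⟩ hk
    rw [Set.mem_ofPred_eq, dist_zero_right, not_lt] at hk
    simp only [Set.mem_iUnion]
    refine ⟨i, ?_, k, ?_, rfl⟩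
    · rw [Set.mem_ofPred_eq, dist_zero_right, not_lt]
      exact (hk.trans (h2 i k)).trans (le_abs_self _)
    · rw [Set.mem_ofPred_eq, dist_zero_right, not_lt]
      exact hk
  refine of_hasSum (fun k : ι × (Fin f → ℕ) => k.2) hw hD (fun k => (h2 _ _).trans (hCD _))
    fun x => ?_
  have hs : Summable fun k : ι × (Fin f → ℕ) => tmono E (τ x) k.2 • w k.1 k.2 := by
    refine summable_of_tendsto (tendsto_zero_of_norm_le (fun k => ?_) hw)
    rw [norm_smul]
    exact mul_le_of_le_one_left (norm_nonneg _) (norm_tmono_le hE _ _)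
  have h6 := hs.hasSum.prod_fiberwise fun i => h3 i x
  rw [(hO x).unique h6]
  exact hs.hasSum

lemma sum (hE : IsNormalizedPadicNorm p E) {ι : Type*} [Fintype ι] {o : ι → P → S} (hD : 0 ≤ D)
    (h : ∀ i, IsAnalyticIn E τ D (o i)) : IsAnalyticIn E τ D fun x => ∑ i, o i x :=
  tsum hE h (by rw [cofinite_eq_bot]; exact tendsto_bot) hD (fun _ => le_rfl)
    fun x => hasSum_fintype _

lemma add (hE : IsNormalizedPadicNorm p E) (h : IsAnalyticIn E τ D o)
    (h' : IsAnalyticIn E τ D o') : IsAnalyticIn E τ D fun x => o x + o' x := by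
  have := sum hE (o := fun i : Bool => if i then o else o') h.nonneg fun i => by
    cases i <;> simpa
  simpa using this

lemma const (τ : P → Fin f → ℤ_[p]) (b : S) : IsAnalyticIn E τ ‖b‖ fun _ => b := by
  refine of_hasSum (fun _ : Unit => 0) (w := fun _ => b)
    (by rw [cofinite_eq_bot]; exact tendsto_bot)
    (norm_nonneg _) (fun _ => le_rfl) fun x => ?_
  simp [tmono_zero]

lemma const_mul (hE : IsNormalizedPadicNorm p E) (b : S) (h : IsAnalyticIn E τ C o) :
    IsAnalyticIn E τ (‖b‖ * C) fun x => b * o x := (const τ b).mul hE h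

variable [NormOneClass S]

lemma coord (τ : P → Fin f → ℤ_[p]) (j : Fin f) :
    IsAnalyticIn E τ 1 fun x => algebraMap ℚ_[p] E (τ x j : ℚ_[p]) • (1 : S) := by
  refine of_hasSum (fun _ : Unit => Pi.single j 1) (w := fun _ => (1 : S))
    (by rw [cofinite_eq_bot]; exact tendsto_bot) zero_le_one (fun _ => norm_one.le) fun x => ?_
  simp [tmono_single]

lemma prod (hE : IsNormalizedPadicNorm p E) {ι : Type*} (t : Finset ι) {o : ι → P → S}
    (h : ∀ i ∈ t, IsAnalyticIn E τ 1 (o i)) : IsAnalyticIn E τ 1 fun x => ∏ i ∈ t, o i x := by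
  classical
  induction t using Finset.induction_on with
  | empty => simpa only [Finset.prod_empty, norm_one] using const (E := E) τ (1 : S)
  | insert a t ha ih =>
    have h1 := (h a (by simp)).mul hE (ih fun i hi => h i (by simp [hi]))
    simpa [Finset.prod_insert ha] using h1

lemma pow (hE : IsNormalizedPadicNorm p E) (h : IsAnalyticIn E τ C o) (n : ℕ) :
    IsAnalyticIn E τ (C ^ n) fun x => o x ^ n := by
  induction n with
  | zero => simpa only [pow_zero, norm_one] using const (E := E) τ (1 : S)
  | succ n ih => simpa only [pow_succ] using ih.mul hE h

/-- The inverse is the geometric series in `1 - o`, whose terms are analytic with bounds `C ^ n`. -/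
lemma inverse (hE : IsNormalizedPadicNorm p E) (hC : C < 1)
    (h : IsAnalyticIn E τ C fun x => o x - 1)
    (hi : ∀ x, o' x * o x = 1) (ho : ∀ x, ‖o x - 1‖ < 1) : IsAnalyticIn E τ 1 o' := by
  have h0 := h.nonneg
  have h1 : IsAnalyticIn E τ C fun x => 1 - o x := by
    have := h.const_mul hE (-1)
    simpa using this
  refine tsum hE (fun n : ℕ => h1.pow hE n) ?_ zero_le_one (fun n => pow_le_one₀ h0 hC.le)
    fun x => ?_
  · rw [Nat.cofinite_eq_atTop]
    exact tendsto_pow_atTop_nhds_zero_of_lt_one h0 hC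
  · have h2 : ‖1 - o x‖ < 1 := by rw [norm_sub_rev]; exact ho x
    have h3 := geom_series_mul_neg (1 - o x) h2
    rw [sub_sub_cancel] at h3
    have h4 : ∑' n, (1 - o x) ^ n = o' x := by
      calc _ = (o' x * o x) * ∑' n, (1 - o x) ^ n := by rw [hi, one_mul]
        _ = o' x * ((∑' n, (1 - o x) ^ n) * o x) := by ring
        _ = o' x := by rw [h3, mul_one]
    rw [← h4]
    exact (summable_geometric_of_norm_lt_one h2).hasSum

end IsAnalyticIn

/-! ### Binomial series -/

variable (E) in
/-- The term `binom(t, n) z ^ n`. -/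
def binomTerm (t : ℤ_[p]) (z : S) (n : ℕ) : S :=
  algebraMap ℚ_[p] E ((descPochhammer ℤ_[p] n).eval t : ℤ_[p]) • ((n.factorial : E)⁻¹ • z ^ n)

variable [IsUltrametricDist S] [CompleteSpace S]

lemma norm_binomTerm_le (hE : IsNormalizedPadicNorm p E) (t : ℤ_[p]) (z : S) (n : ℕ) :
    ‖binomTerm E t z n‖ ≤ ‖(n.factorial : E)⁻¹ • z ^ n‖ := by
  rw [binomTerm, norm_smul]
  exact mul_le_of_le_one_left (norm_nonneg _) (hE.norm_algebraMap_le _)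

lemma summable_binomTerm (hE : IsNormalizedPadicNorm p E) (t : ℤ_[p]) {z : S}
    (hz : Tendsto (fun n : ℕ => (n.factorial : E)⁻¹ • z ^ n) atTop (𝓝 0)) :
    Summable (binomTerm E t z) := by
  rw [← Nat.cofinite_eq_atTop] at hz
  exact summable_of_tendsto (tendsto_zero_of_norm_le (norm_binomTerm_le hE t z) hz)

lemma hasSum_binomTerm_natCast (N : ℕ) (z : S) :
    HasSum (binomTerm E (N : ℤ_[p]) z) ((1 + z) ^ N) := by
  have hp0 : ∀ n : ℕ, (n.factorial : E) ≠ 0 := by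
    intro n
    rw [← map_natCast (algebraMap ℚ_[p] E), Ne, map_eq_zero]
    exact_mod_cast n.factorial_ne_zero
  have h1 : ∀ n, binomTerm E (N : ℤ_[p]) z n = (N.choose n) • z ^ n := by
    intro n
    rw [binomTerm, descPochhammer_eval_eq_descFactorial, Nat.descFactorial_eq_factorial_mul_choose,
      smul_smul]
    push_cast
    rw [mul_right_comm, mul_inv_cancel₀ (hp0 n), one_mul,
      Nat.cast_smul_eq_nsmul]
  rw [add_comm, add_pow]
  have h2 : HasSum (binomTerm E (N : ℤ_[p]) z)
      (∑ n ∈ Finset.range (N + 1), binomTerm E (N : ℤ_[p]) z n) :=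
    hasSum_sum_of_ne_finset_zero fun n hn => by
      rw [h1, Nat.choose_eq_zero_of_lt, zero_smul]
      simpa [Nat.lt_succ_iff] using hn
  have h3 : ∑ n ∈ Finset.range (N + 1), binomTerm E (N : ℤ_[p]) z n =
      ∑ n ∈ Finset.range (N + 1), z ^ n * 1 ^ (N - n) * (N.choose n : S) :=
    Finset.sum_congr rfl fun n _ => by rw [h1, nsmul_eq_mul, one_pow, mul_one, mul_comm]
  rwa [h3] at h2

/-- With `n!` kept next to `z ^ n`, the dependence on `t` is an integral polynomial, so `t - u`
divides the difference of its values. -/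
lemma norm_binomTerm_sub_le (hE : IsNormalizedPadicNorm p E) {t u : ℤ_[p]} {N : ℕ}
    (h : (p : ℤ_[p]) ^ N ∣ t - u) {z : S} (n : ℕ) (hz : ‖(n.factorial : E)⁻¹ • z ^ n‖ ≤ 1) :
    ‖binomTerm E t z n - binomTerm E u z n‖ ≤ ((p : ℝ)⁻¹) ^ N := by
  obtain ⟨v, hv⟩ := h.trans (Polynomial.sub_dvd_eval_sub t u (descPochhammer ℤ_[p] n))
  have h1 : algebraMap ℚ_[p] E ((descPochhammer ℤ_[p] n).eval t : ℤ_[p]) -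
      algebraMap ℚ_[p] E ((descPochhammer ℤ_[p] n).eval u : ℤ_[p]) =
      (p : E) ^ N * algebraMap ℚ_[p] E (v : ℚ_[p]) := by
    rw [← map_sub, ← PadicInt.coe_sub, hv]
    push_cast
    simp
  rw [binomTerm, binomTerm, ← sub_smul, norm_smul, h1, norm_mul, norm_pow]
  have h2 := pow_le_pow_left₀ (norm_nonneg _) hE.norm_natCast_le N
  calc _ ≤ ((p : ℝ)⁻¹) ^ N * 1 * 1 := by
        gcongr
        exact hE.norm_algebraMap_le v
    _ = _ := by ring

/-- A function on `ℤ_p` which is `p`-adically continuous and interpolates `N ↦ (1 + z) ^ N` is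
given by the binomial series. -/
lemma hasSum_binomTerm (hE : IsNormalizedPadicNorm p E) {z : S}
    (hz : Tendsto (fun n : ℕ => (n.factorial : E)⁻¹ • z ^ n) atTop (𝓝 0))
    (hz1 : ∀ n : ℕ, ‖(n.factorial : E)⁻¹ • z ^ n‖ ≤ 1) {g : ℤ_[p] → S}
    (hg : ∀ N : ℕ, g N = (1 + z) ^ N) {δ : ℕ → ℝ} (hδ : Tendsto δ atTop (𝓝 0))
    (hgc : ∀ (t u : ℤ_[p]) (N : ℕ), (p : ℤ_[p]) ^ N ∣ t - u → ‖g t - g u‖ ≤ δ N) (t : ℤ_[p]) :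
    HasSum (binomTerm E t z) (g t) := by
  have hp1 : (1 : ℝ) < p := by exact_mod_cast (Fact.out : p.Prime).one_lt
  have hs := summable_binomTerm hE t hz
  have key : ∀ N : ℕ, ‖∑' n, binomTerm E t z n - g t‖ ≤ max (((p : ℝ)⁻¹) ^ N) (δ N) := by
    intro N
    -- Both sides are compared at a natural number close to `t`, where the series is the finite
    -- binomial theorem.
    have hd : (p : ℤ_[p]) ^ N ∣ t - (t.appr N : ℕ) :=
      Ideal.mem_span_singleton.mp (PadicInt.appr_spec N t)
    have h1 := hasSum_binomTerm_natCast (p := p) (E := E) (t.appr N) z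
    have h2 : ∑' n, binomTerm E t z n - g t =
        ∑' n, (binomTerm E t z n - binomTerm E ((t.appr N : ℕ) : ℤ_[p]) z n) +
          (g ((t.appr N : ℕ) : ℤ_[p]) - g t) := by
      rw [hs.tsum_sub h1.summable, h1.tsum_eq, hg]
      abel
    rw [h2]
    refine (IsUltrametricDist.norm_add_le_max _ _).trans (max_le_max ?_ ?_)
    · exact IsUltrametricDist.norm_tsum_le_of_forall_le_of_nonneg (by positivity) fun n =>
        norm_binomTerm_sub_le hE hd n (hz1 n)
    · rw [norm_sub_rev]
      exact hgc _ _ N hd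
  have h3 : ‖∑' n, binomTerm E t z n - g t‖ ≤ 0 := by
    refine ge_of_tendsto' (x := atTop) ?_ key
    have h4 := (tendsto_pow_atTop_nhds_zero_of_lt_one (by positivity)
      (inv_lt_one_of_one_lt₀ hp1)).max hδ
    simpa using h4
  rw [norm_le_zero_iff, sub_eq_zero] at h3
  rw [← h3]
  exact hs.hasSum

/-- The `n`-th term is a product of factors `t - i` of bound one times an element of norm at most `c
^ n`. Removing the term `n = 0`, which is `1`, leaves the bound `c`. -/
lemma isAnalyticIn_binomial [NormOneClass S] (hE : IsNormalizedPadicNorm p E)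
    (τ : P → Fin f → ℤ_[p]) (j : Fin f) {z : S} {c : ℝ} (hc : c < 1)
    (hz : ∀ n : ℕ, ‖(n.factorial : E)⁻¹ • z ^ n‖ ≤ c ^ n) {g : P → S}
    (hg : ∀ x, HasSum (binomTerm E (τ x j) z) (g x)) :
    IsAnalyticIn E τ c fun x => g x - 1 := by
  have hc0 : 0 ≤ c := by simpa using (norm_nonneg _).trans (hz 1)
  have h1 : ∀ n, IsAnalyticIn E τ (c ^ n) fun x => binomTerm E (τ x j) z n := by
    intro n
    have h2 : IsAnalyticIn E τ 1 fun x => ∏ i ∈ Finset.range n,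
        (algebraMap ℚ_[p] E (τ x j : ℚ_[p]) • (1 : S) + (-(i : E)) • 1) := by
      refine IsAnalyticIn.prod hE _ fun i _ => IsAnalyticIn.add hE (IsAnalyticIn.coord τ j) ?_
      refine (IsAnalyticIn.const τ _).mono ?_
      rw [norm_smul, norm_neg, norm_one, mul_one]
      exact norm_natCast_le_one' i
    have h3 := (IsAnalyticIn.const_mul hE ((n.factorial : E)⁻¹ • z ^ n) h2).mono
      ((mul_one _).le.trans (hz n))
    refine (congrArg (IsAnalyticIn E τ (c ^ n)) (funext fun x => ?_)).mp h3
    rw [binomTerm, descPochhammer_eval_eq_prod_range, padicInt_coe_prod, map_prod, mul_comm]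
    simp only [← add_smul]
    rw [← Finset.prod_congr rfl fun i _ => Algebra.algebraMap_eq_smul_one _, ← map_prod,
      ← Algebra.smul_def]
    congr 2
    funext i
    simp [sub_eq_add_neg]
  have h4 : ∀ x, HasSum (fun n => binomTerm E (τ x j) z (n + 1)) (g x - 1) := by
    intro x
    have h5 := (hasSum_nat_add_iff' 1).mpr (hg x)
    simpa [binomTerm] using h5
  refine IsAnalyticIn.tsum hE (fun n => h1 (n + 1)) ?_ hc0 (fun n => ?_) h4
  · rw [Nat.cofinite_eq_atTop]
    exact (tendsto_add_atTop_iff_nat 1).mpr (tendsto_pow_atTop_nhds_zero_of_lt_one hc0 hc)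
  · exact pow_le_of_le_one hc0 hc.le n.succ_ne_zero

end Analytic

/-! ### The Banach algebra of Laurent series and its integral subrings -/

section Radius

variable {p : ℕ} [Fact p.Prime] {s f : ℕ}

variable (p s) in
/-- The common norm `p ^ (-1 / s)` of the variables. -/
def rad : ℝ := (p : ℝ) ^ (-(1 : ℝ) / (s : ℝ))

lemma rad_pos : 0 < rad p s :=
  Real.rpow_pos_of_pos (by exact_mod_cast (Fact.out : p.Prime).pos) _

lemma rad_lt_one (hs : 1 ≤ s) : rad p s < 1 := by
  have hp1 : (1 : ℝ) < p := by exact_mod_cast (Fact.out : p.Prime).one_lt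
  refine Real.rpow_lt_one_of_one_lt_of_neg hp1 ?_
  have : (0 : ℝ) < s := by exact_mod_cast hs
  exact div_neg_of_neg_of_pos (by norm_num) this

lemma rad_pow (hs : 1 ≤ s) : rad p s ^ s = (p : ℝ)⁻¹ := by
  have hp0 : (0 : ℝ) ≤ p := Nat.cast_nonneg _
  have hs0 : (s : ℝ) ≠ 0 := by exact_mod_cast (by omega : s ≠ 0)
  rw [rad, ← Real.rpow_natCast, ← Real.rpow_mul hp0, div_mul_cancel₀ _ hs0, Real.rpow_neg_one]

lemma weight_eq (k : Expo f) : weight p s k = rad p s ^ k.1 := by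
  have hp0 : (0 : ℝ) ≤ p := Nat.cast_nonneg _
  rw [weight, rad, ← Real.rpow_intCast, ← Real.rpow_mul hp0]
  congr 1
  ring

/-- The exponent of the variable `Y_i`. -/
def Yexp (i : Fin f) : Expo f := (1, fun j => if (j : ℕ) + 1 = (i : ℕ) then 1 else 0)

lemma weight_Yexp (i : Fin f) : weight p s (Yexp i) = rad p s := by
  rw [weight_eq]
  exact zpow_one _

lemma expo_eq_sum (hf : 0 < f) (k : Expo f) :
    k = k.1 • Yexp ⟨0, hf⟩ +
      ∑ j : Fin (f - 1), k.2 j • (Yexp ⟨j + 1, by omega⟩ - Yexp ⟨0, hf⟩) := by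
  have h1 : (∑ j : Fin (f - 1), k.2 j • (Yexp (⟨j + 1, by omega⟩ : Fin f) - Yexp ⟨0, hf⟩)) =
      (0, k.2) := by
    refine Prod.ext ?_ (funext fun i => ?_)
    · rw [Prod.fst_sum]
      refine Finset.sum_eq_zero fun j _ => ?_
      change k.2 j • ((1 : ℤ) - 1) = 0
      simp
    · rw [Prod.snd_sum, Finset.sum_apply, Finset.sum_eq_single i]
      · change k.2 i * ((if (i : ℕ) + 1 = i + 1 then 1 else 0) - if (i : ℕ) + 1 = 0 then 1 else 0) =
          k.2 i
        simp
      · intro j _ hj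
        have hj' : (i : ℕ) ≠ j := fun h => hj (Fin.ext h.symm)
        change k.2 j *
          ((if (i : ℕ) + 1 = j + 1 then 1 else 0) - if (i : ℕ) + 1 = 0 then 1 else 0) = 0
        simp [hj']
      · simp
  rw [h1]
  refine Prod.ext ?_ (funext fun i => ?_)
  · change k.1 = k.1 * 1 + 0
    simp
  · change k.2 i = k.1 * (if (i : ℕ) + 1 = 0 then 1 else 0) + k.2 i
    simp

/-- Reduces statements about all monomials, negative exponents included, to the variables `Y_i`. -/
lemma expo_mem_of_Yexp_mem (hf : 0 < f) (H : AddSubgroup (Expo f)) (h : ∀ i, Yexp i ∈ H)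
    (k : Expo f) : k ∈ H := by
  rw [expo_eq_sum hf k]
  exact H.add_mem (H.zsmul_mem (h _) _)
    (H.sum_mem fun j _ => H.zsmul_mem (H.sub_mem (h _) (h _)) _)

end Radius

lemma mem_of_hasSum {ι S : Type*} [AddCommGroup S] [TopologicalSpace S] {M : AddSubgroup S}
    (hM : IsClosed (M : Set S)) {u : ι → S} {a : S} (h : HasSum u a) (hu : ∀ i, u i ∈ M) :
    a ∈ M :=
  hM.mem_of_tendsto h (Eventually.of_forall fun _ => M.sum_mem fun i _ => hu i)

namespace Laurent

variable {p : ℕ} [Fact p.Prime] {s f : ℕ} {E : Type*} [NormedField E] [IsUltrametricDist E]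
  [CompleteSpace E]

section Normed

attribute [local instance] normedCommRing

/-- The normed algebra structure of the Banach algebra of Laurent series. -/
abbrev normedAlgebra : NormedAlgebra E (Laurent p s f E) :=
  { (inferInstance : Algebra E (Laurent p s f E)) with
    norm_smul_le := fun c a => (norm_smul_eq c a).le }

lemma normOneClass : NormOneClass (Laurent p s f E) :=
  ⟨by rw [one_def, norm_single, norm_one, one_mul, weight_zero]⟩

end Normed

/-- A coefficient, as an additive homomorphism. -/
def coeffAt (k : Expo f) : Laurent p s f E →+ E where
  toFun a := a.coeff k
  map_zero' := rfl
  map_add' _ _ := rfl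

lemma continuous_coeffAt (k : Expo f) :
    Continuous (coeffAt k : Laurent p s f E →+ E) := by
  refine AddMonoidHomClass.continuous_of_bound _ (weight p s k)⁻¹ fun a => ?_
  rw [inv_mul_eq_div, le_div_iff₀ (weight_pos k)]
  exact a.le_norm k

lemma hasSum_coeff_smul_single (a : Laurent p s f E) :
    HasSum (fun k => a.coeff k • (single k 1 : Laurent p s f E)) a := by
  have hs : Summable fun k => a.coeff k • (single k 1 : Laurent p s f E) := by
    refine summable_of_tendsto (tendsto_zero_iff_norm_tendsto_zero.mpr
      (a.tendsto_coeff.congr fun k => ?_))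
    rw [norm_smul_eq, norm_single, norm_one, one_mul]
  have h : ∑' k, a.coeff k • (single k 1 : Laurent p s f E) = a := by
    ext l
    have h1 := hs.hasSum.map (coeffAt l) (continuous_coeffAt l)
    refine h1.unique ?_
    have h2 : a.coeff l = a.coeff l • (single l 1 : Laurent p s f E).coeff l := by
      rw [coeff_single_self, smul_eq_mul, mul_one]
    rw [h2]
    refine _root_.hasSum_single (f := fun k => a.coeff k • (single k 1 : Laurent p s f E).coeff l) l
      fun k hk => ?_
    rw [coeff_single_of_ne hk.symm, smul_zero]
  exact (congrArg (HasSum _) h).mp hs.hasSum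

lemma single_mul_single_neg (k : Expo f) :
    (single k 1 * single (-k) 1 : Laurent p s f E) = 1 := by
  rw [single_mul_single, add_neg_cancel, one_mul, one_def]

/-- A monomial and its inverse have reciprocal norms, so submultiplicativity used twice gives
equality. This is what allows `Y_i` to be cancelled in estimates. -/
lemma norm_single_mul (k : Expo f) (a : Laurent p s f E) :
    ‖single k 1 * a‖ = weight p s k * ‖a‖ := by
  have hw : ∀ k, ‖(single k 1 : Laurent p s f E)‖ = weight p s k := fun k => by
    rw [norm_single, norm_one, one_mul]
  have hpos := weight_pos (p := p) (s := s) k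
  refine le_antisymm ((norm_mul_le _ _).trans_eq (by rw [hw])) ?_
  have h1 : a = single (-k) 1 * (single k 1 * a) := by
    rw [← mul_assoc, mul_comm (single (-k) 1), single_mul_single_neg, one_mul]
  have h2 : weight p s k * weight p s (-k) = 1 := by
    rw [← weight_add, add_neg_cancel, weight_zero]
  calc weight p s k * ‖a‖ ≤ weight p s k * (weight p s (-k) * ‖single k 1 * a‖) := by
        refine mul_le_mul_of_nonneg_left ?_ hpos.le
        conv_lhs => rw [h1]
        exact (norm_mul_le _ _).trans_eq (by rw [hw])
    _ = ‖single k 1 * a‖ := by rw [← mul_assoc, h2, one_mul]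

lemma Y_eq (i : Fin f) : (Y i : Laurent p s f E) = single (Yexp i) 1 := rfl

lemma norm_Y_mul (i : Fin f) (a : Laurent p s f E) : ‖Y i * a‖ = rad p s * ‖a‖ := by
  rw [Y_eq, norm_single_mul, weight_Yexp]

lemma norm_Y (i : Fin f) : ‖(Y i : Laurent p s f E)‖ = rad p s := by
  rw [Y_eq, norm_single, norm_one, one_mul, weight_Yexp]

end Laurent

section Integral

variable {p : ℕ} [Fact p.Prime] {s f : ℕ} {E : Type*} [NormedField E] [IsUltrametricDist E]
  [CompleteSpace E]

open Laurent

lemma mem_ovRing_iff {a : Laurent p s f E} :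
    a ∈ ovRing p s f E ↔ (∀ k, ‖a.coeff k‖ ≤ 1) ∧ ‖a‖ ≤ 1 := by
  rw [norm_le_iff]
  exact forall_and

lemma norm_le_one_of_mem_ovRing {a : Laurent p s f E} (h : a ∈ ovRing p s f E) : ‖a‖ ≤ 1 :=
  (mem_ovRing_iff.mp h).2

lemma Yzero_pow (N : ℕ) : Yzero p s f E ^ N = single (N, 0) 1 := by
  induction N with
  | zero => rw [pow_zero]; rfl
  | succ N ih =>
    rw [pow_succ, ih, Yzero, single_mul_single, one_mul]
    congr 1

/-- Multiplication by `Y_0 ^ N` shifts the coefficients and scales the norm by `rad p s ^ N`,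
bringing any norm below one. After inverting `Y_0` only integrality remains as a condition. -/
lemma mem_ovRingInv_iff (hs : 1 ≤ s) {a : Laurent p s f E} :
    a ∈ ovRingInv p s f E ↔ ∀ k, ‖a.coeff k‖ ≤ 1 := by
  have hco : ∀ (N : ℕ) (k : Expo f),
      (Yzero p s f E ^ N * a).coeff k = a.coeff (k - ((N : ℤ), 0)) := by
    intro N k
    rw [Yzero_pow, Laurent.single_mul, one_mul]
  constructor
  · rintro ⟨N, hN⟩ k
    have h1 := (mem_ovRing_iff.mp hN).1 (k + ((N : ℤ), 0))
    rwa [hco, add_sub_cancel_right] at h1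
  · intro h
    have h1 : Tendsto (fun N : ℕ => rad p s ^ N * ‖a‖) atTop (𝓝 (0 * ‖a‖)) :=
      (tendsto_pow_atTop_nhds_zero_of_lt_one rad_pos.le (rad_lt_one hs)).mul_const _
    rw [zero_mul] at h1
    obtain ⟨N, hN⟩ := (h1.eventually (eventually_le_nhds zero_lt_one)).exists
    refine ⟨N, mem_ovRing_iff.mpr ⟨fun k => ?_, ?_⟩⟩
    · rw [hco]
      exact h _
    · rw [Yzero_pow, norm_single_mul, weight_eq]
      simpa using hN

lemma isClosed_integral : IsClosed {a : Laurent p s f E | ∀ k, ‖a.coeff k‖ ≤ 1} := by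
  have : {a : Laurent p s f E | ∀ k, ‖a.coeff k‖ ≤ 1} = ⋂ k, {a | ‖a.coeff k‖ ≤ 1} := by
    ext; simp
  rw [this]
  exact isClosed_iInter fun k => isClosed_le (continuous_coeffAt k).norm continuous_const

lemma isClosed_ovRing : IsClosed (ovRing p s f E : Set (Laurent p s f E)) := by
  have : (ovRing p s f E : Set (Laurent p s f E)) =
      {a : Laurent p s f E | ∀ k, ‖a.coeff k‖ ≤ 1} ∩ {a | ‖a‖ ≤ 1} := by
    ext a
    exact mem_ovRing_iff
  rw [this]
  exact isClosed_integral.inter (isClosed_le continuous_norm continuous_const)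

lemma isClosed_ovRingInv (hs : 1 ≤ s) : IsClosed (ovRingInv p s f E : Set (Laurent p s f E)) := by
  have : (ovRingInv p s f E : Set (Laurent p s f E)) =
      {a : Laurent p s f E | ∀ k, ‖a.coeff k‖ ≤ 1} := by
    ext a
    exact mem_ovRingInv_iff hs
  rw [this]
  exact isClosed_integral

lemma ovRing_le_ovRingInv : ovRing p s f E ≤ ovRingInv p s f E := fun a ha =>
  ⟨0, by rwa [pow_zero, one_mul]⟩

lemma single_mem_ovRingInv (hs : 1 ≤ s) (k : Expo f) :
    (single k 1 : Laurent p s f E) ∈ ovRingInv p s f E := by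
  rw [mem_ovRingInv_iff hs]
  intro l
  by_cases h : l = k
  · rw [h, coeff_single_self, norm_one]
  · rw [coeff_single_of_ne h, norm_zero]
    exact zero_le_one

lemma mem_ovRing_of_mem_ovRingInv (hs : 1 ≤ s) {a : Laurent p s f E}
    (h : a ∈ ovRingInv p s f E) (h1 : ‖a‖ ≤ 1) : a ∈ ovRing p s f E :=
  mem_ovRing_iff.mpr ⟨(mem_ovRingInv_iff hs).mp h, h1⟩

lemma Y_mem_ovRing (hs : 1 ≤ s) (i : Fin f) : (Y i : Laurent p s f E) ∈ ovRing p s f E :=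
  mem_ovRing_of_mem_ovRingInv hs (single_mem_ovRingInv hs _)
    ((norm_Y i).trans_le (rad_lt_one hs).le)

lemma prod_Y_mem_ovRing (hs : 1 ≤ s) (k : Fin f → ℕ) :
    ∏ i, (Y i : Laurent p s f E) ^ k i ∈ ovRing p s f E :=
  prod_mem fun i _ => pow_mem (Y_mem_ovRing hs i) _

lemma norm_mul_le_of_le_one_left {a b : Laurent p s f E} (ha : ‖a‖ ≤ 1) : ‖a * b‖ ≤ ‖b‖ :=
  (Laurent.norm_mul_le a b).trans (mul_le_of_le_one_left (norm_nonneg _) ha)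

lemma norm_mul_le_of_le_one_right {a b : Laurent p s f E} (hb : ‖b‖ ≤ 1) : ‖a * b‖ ≤ ‖a‖ :=
  (Laurent.norm_mul_le a b).trans (mul_le_of_le_one_right (norm_nonneg _) hb)

lemma norm_integer_smul_le (c : intRing E) (a : Laurent p s f E) : ‖c • a‖ ≤ ‖a‖ :=
  (norm_smul_eq (c : E) a).trans_le (mul_le_of_le_one_left (norm_nonneg _) c.2)

section Eval

attribute [local instance] Laurent.normedCommRing

lemma tendsto_prod_Y (hs : 1 ≤ s) :
    Tendsto (fun k : Fin f →₀ ℕ => ∏ i, (Y i : Laurent p s f E) ^ k i) cofinite (𝓝 0) := by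
  have := normOneClass (p := p) (s := s) (f := f) (E := E)
  refine tendsto_prod_pow norm_one.le (fun i => ?_) fun i => ?_
  · exact (norm_Y i).trans_le (rad_lt_one hs).le
  · exact tendsto_pow_atTop_nhds_zero_of_norm_lt_one ((norm_Y i).trans_lt (rad_lt_one hs))

variable (E f) in
/-- Evaluation of formal power series with integral coefficients at the variables `Y_i`. -/
def evalY (hs : 1 ≤ s) : MvPowerSeries (Fin f) (intRing E) →ₐ[intRing E] Laurent p s f E :=
  evalHom norm_integer_smul_le (tendsto_prod_Y hs)

lemma evalY_apply (hs : 1 ≤ s) (F : MvPowerSeries (Fin f) (intRing E)) :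
    evalY f E hs F = (Laurent.eval F : Laurent p s f E) := rfl

lemma evalY_X (hs : 1 ≤ s) (i : Fin f) :
    evalY f E hs (MvPowerSeries.X i) = (Y i : Laurent p s f E) := evalHom_X _ _ i

end Eval

lemma hasSum_evalY (hs : 1 ≤ s) (F : MvPowerSeries (Fin f) (intRing E)) :
    HasSum (fun k : Fin f →₀ ℕ => MvPowerSeries.coeff k F •
      ∏ i, (Y i : Laurent p s f E) ^ k i) (evalY f E hs F) := by
  have h0 : Tendsto (fun k : Fin f →₀ ℕ => ∏ i, (Y i : Laurent p s f E) ^ k i) cofinite (𝓝 0) :=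
    tendsto_prod_Y hs
  exact (summable_of_tendsto
    (tendsto_zero_of_norm_le (fun _ => norm_integer_smul_le _ _) h0)).hasSum

lemma evalY_mem_ovRing (hs : 1 ≤ s) (F : MvPowerSeries (Fin f) (intRing E)) :
    (evalY f E hs F : Laurent p s f E) ∈ ovRing p s f E :=
  mem_of_hasSum (M := (ovRing p s f E).toSubring.toAddSubgroup) isClosed_ovRing (hasSum_evalY hs F)
    fun k => (ovRing p s f E).smul_mem (prod_Y_mem_ovRing hs k) _

end Integral

/-! ### The embedding of the Iwasawa algebra into Laurent series -/

section PowerEstimate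

variable {S : Type*} [NormedCommRing S] [NormOneClass S] [IsUltrametricDist S] {p : ℕ}
  [Fact p.Prime] {r : ℝ}

/-- The middle binomial terms carry a factor `p`, which gains `r`; the last term has norm at most `r
^ (j * p)`, and `j * p ≥ j + 1` since `j ≥ 1` and `p ≥ 2`. -/
lemma norm_one_add_pow_prime_sub_one_le (hp : ‖(p : S)‖ ≤ r) (hr : r ≤ 1) {z : S} {j : ℕ}
    (hj : 1 ≤ j) (hz : ‖z‖ ≤ r ^ j) : ‖(1 + z) ^ p - 1‖ ≤ r ^ (j + 1) := by
  have hr0 : 0 ≤ r := (norm_nonneg _).trans hp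
  have hp' := (Fact.out : p.Prime)
  have hz1 : ‖z‖ ≤ 1 := hz.trans (pow_le_one₀ hr0 hr)
  rw [add_comm, add_pow_prime_eq' hp', one_pow, add_sub_right_comm, add_sub_cancel_right]
  refine (IsUltrametricDist.norm_add_le_max _ _).trans (max_le ?_ ?_)
  · calc ‖z ^ p‖ ≤ ‖z‖ ^ p := norm_pow_le _ _
      _ ≤ (r ^ j) ^ p := pow_le_pow_left₀ (norm_nonneg _) hz p
      _ = r ^ (j * p) := (pow_mul _ _ _).symm
      _ ≤ r ^ (j + 1) := pow_le_pow_of_le_one hr0 hr (by nlinarith [hp'.two_le])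
  · rw [pow_succ', Finset.mul_sum]
    refine IsUltrametricDist.norm_sum_le_of_forall_le_of_nonneg (by positivity) fun k hk => ?_
    rw [Finset.mem_Ioo] at hk
    refine (norm_mul_le _ _).trans (mul_le_mul hp ?_ (norm_nonneg _) hr0)
    rw [one_pow, mul_one]
    refine (norm_mul_le _ _).trans ((mul_le_of_le_one_right (norm_nonneg _)
      (IsUltrametricDist.norm_natCast_le_one S _)).trans ?_)
    refine (norm_pow_le _ _).trans (le_trans ?_ hz)
    exact pow_le_of_le_one (norm_nonneg _) hz1 (by omega)

lemma norm_pow_prime_pow_sub_one_le (hp : ‖(p : S)‖ ≤ r) (hr : r ≤ 1) {x : S}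
    (hx : ‖x - 1‖ ≤ r) (n : ℕ) : ‖x ^ p ^ n - 1‖ ≤ r ^ (n + 1) := by
  induction n with
  | zero => simpa using hx
  | succ n ih =>
    have h := norm_one_add_pow_prime_sub_one_le hp hr (Nat.le_add_left 1 n) ih
    rwa [add_sub_cancel, ← pow_mul, ← pow_succ] at h

end PowerEstimate

section Embed

variable {p : ℕ} [Fact p.Prime] {s f : ℕ} {E : Type*} [NormedField E] [IsUltrametricDist E]
  [CompleteSpace E] [Algebra ℚ_[p] E]
  {K : Type*} [NormedField K] [NormedAlgebra ℚ_[p] K] [IsUltrametricDist K]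
  [FiniteDimensional ℚ_[p] K]

open Laurent

lemma algHom_eq_constantCoeff {R : Type*} [CommRing R] {f : ℕ}
    (g : MvPowerSeries (Fin f) R →ₐ[R] R) (hg : ∀ i, g (MvPowerSeries.X i) = 0)
    (F : MvPowerSeries (Fin f) R) : g F = MvPowerSeries.constantCoeff F := by
  obtain ⟨G, hG⟩ := exists_eq_C_add_sum F
  conv_lhs => rw [hG]
  rw [map_add, map_sum, Finset.sum_eq_zero fun i _ => by rw [map_mul, hg, zero_mul], add_zero]
  exact g.commutes _

section

attribute [local instance] Laurent.normedCommRing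

lemma norm_pow_prime_pow_sub_one_le_rad (hE : IsNormalizedPadicNorm p E) (hs : 1 ≤ s)
    {x : Laurent p s f E} (hx : ‖x - 1‖ ≤ rad p s) (n : ℕ) :
    ‖x ^ p ^ n - 1‖ ≤ rad p s ^ (n + 1) := by
  have := normOneClass (p := p) (s := s) (f := f) (E := E)
  refine norm_pow_prime_pow_sub_one_le (p := p) ?_ (rad_lt_one hs).le hx n
  have h1 : (p : Laurent p s f E) = (p : E) • 1 := by
    rw [← map_natCast (algebraMap E (Laurent p s f E)), Algebra.algebraMap_eq_smul_one]
  have h2 : ‖(p : E) • (1 : Laurent p s f E)‖ ≤ rad p s := by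
    rw [norm_smul_eq, norm_one, mul_one]
    refine hE.norm_natCast_le.trans ?_
    rw [← rad_pow (p := p) hs]
    exact pow_le_of_le_one rad_pos.le (rad_lt_one hs).le (by omega)
  rw [h1]
  exact h2

end

/-- What remains is a combination of the `Y_i`, of norm `rad p s`, with coefficients of norm at most
one. -/
lemma norm_evalY_sub_constantCoeff_le (hs : 1 ≤ s) (F : MvPowerSeries (Fin f) (intRing E)) :
    ‖(evalY f E hs F : Laurent p s f E) -
      algebraMap (intRing E) (Laurent p s f E) (MvPowerSeries.constantCoeff F)‖ ≤ rad p s := by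
  obtain ⟨G, hG⟩ := exists_eq_C_add_sum F
  have h1 : (evalY f E hs F : Laurent p s f E) -
      algebraMap (intRing E) (Laurent p s f E) (MvPowerSeries.constantCoeff F) =
      ∑ i, Y i * evalY f E hs (G i) := by
    have h2 : (evalY f E hs (MvPowerSeries.C (MvPowerSeries.constantCoeff F)) : Laurent p s f E) =
        algebraMap (intRing E) (Laurent p s f E) (MvPowerSeries.constantCoeff F) :=
      (evalY f E hs).commutes _
    rw [sub_eq_iff_eq_add', ← h2]
    conv_lhs => rw [hG]
    rw [map_add, map_sum]
    simp only [map_mul, evalY_X]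
  rw [h1]
  refine IsUltrametricDist.norm_sum_le_of_forall_le_of_nonneg rad_pos.le fun i _ => ?_
  exact (norm_mul_le_of_le_one_right (norm_le_one_of_mem_ovRing (evalY_mem_ovRing hs _))).trans_eq
    (norm_Y i)

variable (Θ : MvPowerSeries (Fin f) (intRing E) ≃ₐ[intRing E] Iwasawa p E K)

/-- The embedding `O_E[[O_K]] → A^{†,s⁻}` given by an identification of `O_E[[O_K]]` with a power
series ring. -/
def embed (hs : 1 ≤ s) : Iwasawa p E K →ₐ[intRing E] Laurent p s f E :=
  (evalY f E hs).comp (Θ.symm : Iwasawa p E K →ₐ[intRing E] MvPowerSeries (Fin f) (intRing E))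

lemma embed_apply (hs : 1 ≤ s) (x : Iwasawa p E K) :
    (embed Θ hs x : Laurent p s f E) = evalY f E hs (Θ.symm x) := rfl

lemma embed_theta (hs : 1 ≤ s) (F : MvPowerSeries (Fin f) (intRing E)) :
    (embed Θ hs (Θ F) : Laurent p s f E) = evalY f E hs F := by
  rw [embed_apply, AlgEquiv.symm_apply_apply]

lemma embed_mem_ovRing (hs : 1 ≤ s) (x : Iwasawa p E K) :
    (embed Θ hs x : Laurent p s f E) ∈ ovRing p s f E := evalY_mem_ovRing hs _

lemma norm_embed_le_one (hs : 1 ≤ s) (x : Iwasawa p E K) :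
    ‖(embed Θ hs x : Laurent p s f E)‖ ≤ 1 := norm_le_one_of_mem_ovRing (embed_mem_ovRing Θ hs x)

variable {Θ} {σ₀ : K →ₐ[ℚ_[p]] E} (hΘ : ∀ i, Θ (MvPowerSeries.X i) = Ysig p f σ₀ i)

include hΘ in
lemma embed_Ysig (hs : 1 ≤ s) (i : Fin f) :
    (embed Θ hs (Ysig p f σ₀ i) : Laurent p s f E) = Y i := by
  rw [← hΘ, embed_theta, evalY_X]

variable (hK : IsUnramified p K) (hf : Module.finrank ℚ_[p] K = f)

-- Through `Θ` the augmentation becomes the constant coefficient, since it kills every `Y_{σ_i}`; on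
-- group-like elements it equals one.
include hΘ hK hf in
lemma norm_embed_groupLike_sub_one_le (hs : 1 ≤ s) (x : intRing K) :
    ‖(embed Θ hs (groupLike p E x) : Laurent p s f E) - 1‖ ≤ rad p s := by
  have h1 := algHom_eq_constantCoeff
    (augmentation.comp (Θ : MvPowerSeries (Fin f) (intRing E) →ₐ[intRing E] Iwasawa p E K))
    (fun i => by
      change augmentation (Θ (MvPowerSeries.X i)) = 0
      rw [hΘ, augmentation_Ysig hK hf]) (Θ.symm (groupLike p E x))
  have h2 : (1 : intRing E) = MvPowerSeries.constantCoeff (Θ.symm (groupLike p E x)) := by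
    rw [← h1]
    change 1 = augmentation (Θ (Θ.symm (groupLike p E x)))
    rw [AlgEquiv.apply_symm_apply, augmentation_groupLike]
  have h3 := norm_evalY_sub_constantCoeff_le (p := p) hs (Θ.symm (groupLike p E x))
  rwa [← h2, map_one] at h3

include hΘ hK hf in
lemma norm_embed_groupLike_pow_mul_sub_one_le (hE : IsNormalizedPadicNorm p E) (hs : 1 ≤ s) (n : ℕ)
    (x : intRing K) :
    ‖(embed Θ hs (groupLike p E ((p : intRing K) ^ n * x)) : Laurent p s f E) - 1‖ ≤
      rad p s ^ (n + 1) := by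
  have h1 := norm_pow_prime_pow_sub_one_le_rad hE hs
    (norm_embed_groupLike_sub_one_le hΘ hK hf hs x) n
  rwa [← map_pow, ← groupLike_natCast_mul, Nat.cast_pow] at h1

lemma embed_groupLike_add (hs : 1 ≤ s) (x y : intRing K) :
    (embed Θ hs (groupLike p E (x + y)) : Laurent p s f E) =
      embed Θ hs (groupLike p E x) * embed Θ hs (groupLike p E y) := by
  rw [groupLike_add, map_mul]

-- Group-like elements have norm at most one, and `[x] - [y] = [y] ([x - y] - 1)`.
include hΘ hK hf in
lemma norm_embed_groupLike_sub_le (hE : IsNormalizedPadicNorm p E) (hs : 1 ≤ s) {n : ℕ}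
    {x y : intRing K} (h : (p : intRing K) ^ n ∣ x - y) :
    ‖(embed Θ hs (groupLike p E x) : Laurent p s f E) - embed Θ hs (groupLike p E y)‖ ≤
      rad p s ^ (n + 1) := by
  obtain ⟨z, hz⟩ := h
  have h1 : x = y + (p : intRing K) ^ n * z := by rw [← hz]; ring
  have h2 : (embed Θ hs (groupLike p E x) : Laurent p s f E) - embed Θ hs (groupLike p E y) =
      embed Θ hs (groupLike p E y) * (embed Θ hs (groupLike p E ((p : intRing K) ^ n * z)) - 1) := by
    rw [h1, embed_groupLike_add, mul_sub, mul_one]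
  rw [h2]
  exact (norm_mul_le_of_le_one_left (norm_embed_le_one Θ hs _)).trans
    (norm_embed_groupLike_pow_mul_sub_one_le hΘ hK hf hE hs n z)

variable (Θ σ₀) in
/-- The image of `a · Y_{σ_i}` in Laurent series. -/
def actY (hs : 1 ≤ s) (a : intRing K) (i : Fin f) : Laurent p s f E :=
  embed Θ hs (iwasawaHom p E a (Ysig p f σ₀ i))

lemma actY_mem_ovRing (hs : 1 ≤ s) (a : intRing K) (i : Fin f) :
    (actY Θ σ₀ hs a i : Laurent p s f E) ∈ ovRing p s f E := embed_mem_ovRing _ _ _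

include hΘ in
lemma actY_one (hs : 1 ≤ s) (i : Fin f) : (actY Θ σ₀ hs 1 i : Laurent p s f E) = Y i := by
  rw [actY, iwasawaHom_one, embed_Ysig hΘ]

include hK hf in
lemma actY_eq_sum (hs : 1 ≤ s) (a : intRing K) (i : Fin f) :
    (actY Θ σ₀ hs a i : Laurent p s f E) = ∑ ζ : Teich p f K, ζ.charInv σ₀ i •
      (embed Θ hs (groupLike p E (a * ζ.toInt p f)) - 1) := by
  change ((embed Θ hs).comp (iwasawaHom p E a)) (Ysig p f σ₀ i) = _
  rw [Ysig_eq hK hf, map_sum]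
  refine Finset.sum_congr rfl fun ζ _ => ?_
  rw [map_smul, Iwasawa.map_sub, AlgHom.comp_apply, iwasawaHom_groupLike, map_one]

include hΘ hK hf in
lemma norm_actY_sub_le (hE : IsNormalizedPadicNorm p E) (hs : 1 ≤ s) {n : ℕ}
    {a b : intRing K} (h : (p : intRing K) ^ n ∣ a - b) (i : Fin f) :
    ‖(actY Θ σ₀ hs a i : Laurent p s f E) - actY Θ σ₀ hs b i‖ ≤ rad p s ^ (n + 1) := by
  rw [actY_eq_sum hK hf, actY_eq_sum hK hf, ← Finset.sum_sub_distrib]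
  refine IsUltrametricDist.norm_sum_le_of_forall_le_of_nonneg (pow_nonneg rad_pos.le _)
    fun ζ _ => ?_
  rw [← smul_sub, sub_sub_sub_cancel_right]
  refine (norm_integer_smul_le _ _).trans (norm_embed_groupLike_sub_le hΘ hK hf hE hs ?_)
  rw [← sub_mul]
  exact h.mul_right _

-- Reindexing the defining sum by `η ↦ ζ η` shows that `Y_{σ_i}` is an eigenvector of the
-- Teichmüller elements, with character `σ_i`.
include hΘ hK hf in
lemma charInv_smul_actY_teich (hs : 1 ≤ s) (ζ : Teich p f K) (i : Fin f) :
    ζ.charInv σ₀ i • (actY Θ σ₀ hs (ζ.toInt p f) i : Laurent p s f E) = Y i := by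
  have h := Function.Bijective.sum_comp ζ.mul_bijective fun η : Teich p f K =>
    η.charInv σ₀ i • ((embed Θ hs (groupLike p E (1 * η.toInt p f)) : Laurent p s f E) - 1)
  rw [actY_eq_sum hK hf, Finset.smul_sum, ← actY_one hΘ hs, actY_eq_sum hK hf, ← h]
  refine Finset.sum_congr rfl fun η _ => ?_
  rw [smul_smul, charInv_mul, one_mul, Teich.toInt_mul]

end Embed

/-! ### Units of the integral ring and substitution -/

section Units

variable {p : ℕ} [Fact p.Prime] {s f : ℕ} {E : Type*} [NormedField E] [IsUltrametricDist E]
  [CompleteSpace E]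

open Laurent

section

attribute [local instance] Laurent.normedCommRing

lemma exists_hasSum_pow {t : Laurent p s f E} (ht : ‖t‖ < 1) :
    ∃ w, HasSum (fun n : ℕ => t ^ n) w ∧ w * (1 - t) = 1 :=
  ⟨_, (summable_geometric_of_norm_lt_one ht).hasSum, geom_series_mul_neg t ht⟩

end

lemma isUnit_of_norm_sub_one_lt {z : ovRing p s f E} (hz : ‖(z : Laurent p s f E) - 1‖ < 1) :
    IsUnit z := by
  have h1 : ‖1 - (z : Laurent p s f E)‖ < 1 := by rwa [norm_sub_rev]
  obtain ⟨w, hw, hw1⟩ := exists_hasSum_pow h1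
  rw [sub_sub_cancel] at hw1
  have hmem : w ∈ ovRing p s f E :=
    mem_of_hasSum (M := (ovRing p s f E).toSubring.toAddSubgroup) isClosed_ovRing hw
      fun n => (ovRing p s f E).pow_mem ((ovRing p s f E).sub_mem (one_mem _) z.2) n
  refine IsUnit.of_mul_eq_one ⟨w, hmem⟩ (Subtype.ext ?_)
  rw [mul_comm]
  exact hw1

lemma norm_unit_le_one (u : (ovRing p s f E)ˣ) :
    ‖((u : ovRing p s f E) : Laurent p s f E)‖ ≤ 1 :=
  norm_le_one_of_mem_ovRing (u : ovRing p s f E).2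

variable (p s f E) in
/-- The units of `A^{†,s⁻}` at distance at most `δ` from `1`. -/
def unitsNear {δ : ℝ} (hδ : 0 ≤ δ) : Subgroup (ovRing p s f E)ˣ where
  carrier := {u | ‖((u : ovRing p s f E) : Laurent p s f E) - 1‖ ≤ δ}
  one_mem' := by
    change ‖(1 : Laurent p s f E) - 1‖ ≤ δ
    rwa [sub_self, norm_zero]
  mul_mem' {u v} hu hv := by
    change ‖((u : ovRing p s f E) : Laurent p s f E) * ((v : ovRing p s f E) : Laurent p s f E) - 1‖
      ≤ δ
    have h : ((u : ovRing p s f E) : Laurent p s f E) * ((v : ovRing p s f E) : Laurent p s f E) - 1 =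
        ((u : ovRing p s f E) : Laurent p s f E) *
          (((v : ovRing p s f E) : Laurent p s f E) - 1) +
          (((u : ovRing p s f E) : Laurent p s f E) - 1) := by ring
    rw [h]
    exact (IsUltrametricDist.norm_add_le_max _ _).trans
      (max_le ((norm_mul_le_of_le_one_left (norm_unit_le_one u)).trans hv) hu)
  inv_mem' {u} hu := by
    change ‖((u⁻¹ : (ovRing p s f E)ˣ) : Laurent p s f E) - 1‖ ≤ δ
    have h1 : ((u⁻¹ : (ovRing p s f E)ˣ) : Laurent p s f E) *
        ((u : ovRing p s f E) : Laurent p s f E) = 1 :=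
      congrArg Subtype.val u.inv_mul
    have h : ((u⁻¹ : (ovRing p s f E)ˣ) : Laurent p s f E) - 1 =
        ((u⁻¹ : (ovRing p s f E)ˣ) : Laurent p s f E) *
          -(((u : ovRing p s f E) : Laurent p s f E) - 1) := by
      rw [mul_neg, mul_sub, h1, mul_one, neg_sub]
    rw [h]
    refine (norm_mul_le_of_le_one_left (norm_unit_le_one _)).trans ?_
    rw [norm_neg]
    exact hu

/-! ### Substitution `Y_i ↦ Y_i v_i` -/

variable (hf : 0 < f)

/-- The factor by which the monomial of exponent `k` is multiplied when each `Y_i` is multiplied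
by `v_i`. -/
def twist {M : Type*} [CommGroup M] (v : Fin f → M) (k : Expo f) : M :=
  v ⟨0, hf⟩ ^ k.1 * ∏ j : Fin (f - 1), (v ⟨j + 1, by omega⟩ / v ⟨0, hf⟩) ^ k.2 j

lemma twist_add {M : Type*} [CommGroup M] (v : Fin f → M) (k l : Expo f) :
    twist hf v (k + l) = twist hf v k * twist hf v l := by
  simp only [twist, Prod.fst_add, Prod.snd_add, Pi.add_apply, zpow_add, Finset.prod_mul_distrib]
  exact mul_mul_mul_comm _ _ _ _

lemma twist_zero {M : Type*} [CommGroup M] (v : Fin f → M) : twist hf v 0 = 1 := by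
  simp [twist]

lemma twist_Yexp {M : Type*} [CommGroup M] (v : Fin f → M) (i : Fin f) :
    twist hf v (Yexp i) = v i := by
  simp only [twist, Yexp]
  by_cases hi : (i : ℕ) = 0
  · have h1 : i = ⟨0, hf⟩ := Fin.ext hi
    rw [Finset.prod_eq_one, mul_one, zpow_one, h1]
    intro j _
    rw [if_neg (by omega), zpow_zero]
  · obtain ⟨j, hj⟩ : ∃ j : Fin (f - 1), (j : ℕ) + 1 = i := ⟨⟨i - 1, by omega⟩, by
      change (i : ℕ) - 1 + 1 = i
      omega⟩
    have h1 : i = ⟨j + 1, by omega⟩ := Fin.ext hj.symm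
    rw [Finset.prod_eq_single j]
    · rw [if_pos hj, zpow_one, zpow_one, mul_div_cancel, h1]
    · intro l _ hl
      rw [if_neg, zpow_zero]
      intro h
      exact hl (Fin.ext (by omega))
    · simp

lemma twist_mem {M : Type*} [CommGroup M] {H : Subgroup M} {v : Fin f → M} (h : ∀ i, v i ∈ H)
    (k : Expo f) : twist hf v k ∈ H :=
  H.mul_mem (H.zpow_mem (h _) _) (H.prod_mem fun _ _ => H.zpow_mem (H.div_mem (h _) (h _)) _)

/-- The image of the monomial of exponent `k`. -/
def twistedSingle (v : Fin f → (ovRing p s f E)ˣ) (k : Expo f) : Laurent p s f E :=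
  single k 1 * (((twist hf v k : (ovRing p s f E)ˣ) : ovRing p s f E) : Laurent p s f E)

lemma norm_twistedSingle_le (v : Fin f → (ovRing p s f E)ˣ) (k : Expo f) :
    ‖(twistedSingle hf v k : Laurent p s f E)‖ ≤ weight p s k := by
  rw [twistedSingle, norm_single_mul]
  exact mul_le_of_le_one_right (weight_pos k).le (norm_unit_le_one _)

lemma twistedSingle_add (v : Fin f → (ovRing p s f E)ˣ) (k l : Expo f) :
    (twistedSingle hf v (k + l) : Laurent p s f E) =
      twistedSingle hf v k * twistedSingle hf v l := by
  have h : (single (k + l) 1 : Laurent p s f E) = single k 1 * single l 1 := by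
    rw [single_mul_single, one_mul]
  rw [twistedSingle, h, twist_add]
  change single k 1 * single l 1 * (((twist hf v k : (ovRing p s f E)ˣ) : Laurent p s f E) *
    ((twist hf v l : (ovRing p s f E)ˣ) : Laurent p s f E)) = _
  exact mul_mul_mul_comm _ _ _ _

lemma norm_coeff_smul_le {k : Expo f} {y : Laurent p s f E} (hy : ‖y‖ ≤ weight p s k)
    (a : Laurent p s f E) : ‖a.coeff k • y‖ ≤ ‖a.coeff k‖ * weight p s k :=
  (norm_smul_eq _ _).trans_le (mul_le_mul_of_nonneg_left hy (norm_nonneg _))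

lemma summable_twist (v : Fin f → (ovRing p s f E)ˣ) (a : Laurent p s f E) :
    Summable fun k => a.coeff k • (twistedSingle hf v k : Laurent p s f E) :=
  summable_of_tendsto (squeeze_zero_norm
    (fun k => norm_coeff_smul_le (norm_twistedSingle_le hf v k) a) a.tendsto_coeff)

/-- The linear map underlying substitution. -/
def substLin (v : Fin f → (ovRing p s f E)ˣ) : Laurent p s f E →ₗ[E] Laurent p s f E where
  toFun a := ∑' k, a.coeff k • twistedSingle hf v k
  map_add' a b := by
    simp only [coeff_add, Pi.add_apply, add_smul]
    exact (summable_twist hf v a).tsum_add (summable_twist hf v b)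
  map_smul' c a := by
    simp only [coeff_smul, Pi.smul_apply, smul_assoc, RingHom.id_apply]
    exact (summable_twist hf v a).tsum_const_smul c

lemma hasSum_substLin (v : Fin f → (ovRing p s f E)ˣ) (a : Laurent p s f E) :
    HasSum (fun k => a.coeff k • (twistedSingle hf v k : Laurent p s f E)) (substLin hf v a) :=
  (summable_twist hf v a).hasSum

lemma norm_substLin_le (v : Fin f → (ovRing p s f E)ˣ) (a : Laurent p s f E) :
    ‖substLin hf v a‖ ≤ ‖a‖ :=
  IsUltrametricDist.norm_tsum_le_of_forall_le_of_nonneg (norm_nonneg _) fun k =>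
    (norm_coeff_smul_le (norm_twistedSingle_le hf v k) a).trans (a.le_norm k)

lemma continuous_substLin (v : Fin f → (ovRing p s f E)ˣ) :
    Continuous (substLin hf v : Laurent p s f E →ₗ[E] Laurent p s f E) :=
  AddMonoidHomClass.continuous_of_bound _ 1 fun a =>
    (norm_substLin_le hf v a).trans_eq (one_mul _).symm

lemma substLin_single (v : Fin f → (ovRing p s f E)ˣ) (k : Expo f) (c : E) :
    substLin hf v (single k c) = c • (twistedSingle hf v k : Laurent p s f E) := by
  refine (hasSum_substLin hf v _).unique ?_
  have h : c • (twistedSingle hf v k : Laurent p s f E) =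
      (single k c : Laurent p s f E).coeff k • twistedSingle hf v k := by
    rw [coeff_single_self]
  rw [h]
  refine _root_.hasSum_single k fun l hl => ?_
  rw [coeff_single_of_ne hl, zero_smul]

lemma Laurent.addHom_ext {g h : Laurent p s f E →+ Laurent p s f E} (hg : Continuous g)
    (hh : Continuous h) (H : ∀ k c, g (single k c) = h (single k c)) : g = h := by
  ext1 a
  have h1 := (hasSum_coeff_smul_single a).map g hg
  have h2 := (hasSum_coeff_smul_single a).map h hh
  refine h1.unique (hasSum_of_eq h2 fun k => ?_)
  simp only [Function.comp_apply, smul_single, H]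

lemma Laurent.continuous_mulRight (b : Laurent p s f E) :
    Continuous (AddMonoidHom.mulRight b) :=
  AddMonoidHomClass.continuous_of_bound _ ‖b‖ fun a =>
    (Laurent.norm_mul_le a b).trans_eq (mul_comm _ _)

lemma substLin_mul (v : Fin f → (ovRing p s f E)ˣ) (a b : Laurent p s f E) :
    substLin hf v (a * b) = substLin hf v a * substLin hf v b := by
  have hc := continuous_substLin hf v
  -- Both sides are additive and continuous in each argument, so monomials suffice in one argument
  -- and, by commutativity, in the other; there `twistedSingle_add` applies.
  have step : ∀ b : Laurent p s f E,
      (∀ k c, substLin hf v (single k c * b) = substLin hf v (single k c) * substLin hf v b) →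
      ∀ a, substLin hf v (a * b) = substLin hf v a * substLin hf v b := by
    intro b hb a
    exact DFunLike.congr_fun (Laurent.addHom_ext
      (g := (substLin hf v).toAddMonoidHom.comp (AddMonoidHom.mulRight b))
      (h := (AddMonoidHom.mulRight (substLin hf v b)).comp (substLin hf v).toAddMonoidHom)
      (hc.comp (Laurent.continuous_mulRight b)) ((Laurent.continuous_mulRight _).comp hc) hb) a
  refine step b (fun k c => ?_) a
  rw [mul_comm, mul_comm (substLin hf v _)]
  refine step (single k c) (fun l d => ?_) b
  rw [single_mul_single, substLin_single, substLin_single, substLin_single, twistedSingle_add,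
    smul_mul_smul_comm]

/-- The endomorphism of the algebra of Laurent series sending `Y_i` to `Y_i v_i`. -/
def subst (v : Fin f → (ovRing p s f E)ˣ) : Laurent p s f E →ₐ[E] Laurent p s f E :=
  AlgHom.ofLinearMap (substLin hf v) (by
    rw [one_def, substLin_single, one_smul, twistedSingle, twist_zero]
    change single 0 1 * (1 : Laurent p s f E) = single 0 1
    rw [mul_one]) (substLin_mul hf v)

lemma hasSum_subst (v : Fin f → (ovRing p s f E)ˣ) (a : Laurent p s f E) :
    HasSum (fun k => a.coeff k • (twistedSingle hf v k : Laurent p s f E)) (subst hf v a) :=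
  hasSum_substLin hf v a

lemma norm_subst_le (v : Fin f → (ovRing p s f E)ˣ) (a : Laurent p s f E) :
    ‖subst hf v a‖ ≤ ‖a‖ := norm_substLin_le hf v a

lemma continuous_subst (v : Fin f → (ovRing p s f E)ˣ) :
    Continuous (subst hf v : Laurent p s f E →ₐ[E] Laurent p s f E) := continuous_substLin hf v

lemma subst_Y (v : Fin f → (ovRing p s f E)ˣ) (i : Fin f) :
    subst hf v (Y i) = Y i * ((v i : ovRing p s f E) : Laurent p s f E) := by
  change substLin hf v (single (Yexp i) 1) = _
  rw [substLin_single, one_smul, twistedSingle, twist_Yexp]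
  rfl

lemma subst_mem_ovRingInv (hs : 1 ≤ s) (v : Fin f → (ovRing p s f E)ˣ) {a : Laurent p s f E}
    (ha : a ∈ ovRingInv p s f E) : subst hf v a ∈ ovRingInv p s f E := by
  refine mem_of_hasSum (M := (ovRingInv p s f E).toSubring.toAddSubgroup) (isClosed_ovRingInv hs)
    (hasSum_subst hf v a) fun k => ?_
  exact (ovRingInv p s f E).smul_mem ((ovRingInv p s f E).mul_mem (single_mem_ovRingInv hs k)
    (ovRing_le_ovRingInv (Subtype.prop _))) (⟨a.coeff k, (mem_ovRingInv_iff hs).mp ha k⟩ : intRing E)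

/-- Units within `δ` of one form a group, so the factor of every monomial stays within `δ` of one,
uniformly in the exponent. -/
lemma norm_subst_sub_le {v : Fin f → (ovRing p s f E)ˣ} {δ : ℝ} (hδ : 0 ≤ δ)
    (hv : ∀ i, ‖((v i : ovRing p s f E) : Laurent p s f E) - 1‖ ≤ δ) (a : Laurent p s f E) :
    ‖subst hf v a - a‖ ≤ δ * ‖a‖ := by
  have h1 := (hasSum_subst hf v a).sub (hasSum_coeff_smul_single a)
  rw [← h1.tsum_eq]
  refine IsUltrametricDist.norm_tsum_le_of_forall_le_of_nonneg (by positivity) fun k => ?_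
  have h2 : a.coeff k • (twistedSingle hf v k : Laurent p s f E) - a.coeff k • single k 1 =
      a.coeff k • (single k 1 *
        ((((twist hf v k : (ovRing p s f E)ˣ) : ovRing p s f E) : Laurent p s f E) - 1)) := by
    rw [mul_sub, mul_one, smul_sub]
    rfl
  have h3 : ‖((((twist hf v k : (ovRing p s f E)ˣ) : ovRing p s f E) : Laurent p s f E) - 1)‖ ≤ δ :=
    twist_mem hf (H := unitsNear p s f E hδ) hv k
  rw [h2, norm_smul_eq, norm_single_mul, ← mul_assoc, mul_comm]
  exact mul_le_mul h3 (a.le_norm k) (mul_nonneg (norm_nonneg _) (weight_pos k).le) hδ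

end Units

/-! ### The action of `O_K^×` on Laurent series -/

section ActionConstruction

variable {p : ℕ} [Fact p.Prime] {s f : ℕ} {E : Type*} [NormedField E] [IsUltrametricDist E]
  [CompleteSpace E]

open Laurent

lemma norm_sub_le_max_ultra {S : Type*} [SeminormedAddCommGroup S] [IsUltrametricDist S] (x y : S) :
    ‖x - y‖ ≤ max ‖x‖ ‖y‖ := by
  rw [sub_eq_add_neg, ← norm_neg y]
  exact IsUltrametricDist.norm_add_le_max _ _

/-- Automatic continuity: a bounded homomorphism sending the variables into the ball of radius `rad
p s < 1` is small on high powers of `varIdeal`, and polynomials represent every class modulo such a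
power. -/
lemma powerSeries_algHom_ext (hs : 1 ≤ s)
    {g h : MvPowerSeries (Fin f) (intRing E) →ₐ[intRing E] Laurent p s f E}
    (hg : ∀ F, ‖g F‖ ≤ 1) (hh : ∀ F, ‖h F‖ ≤ 1)
    (hgX : ∀ i, ‖g (MvPowerSeries.X i)‖ ≤ rad p s)
    (H : ∀ i, g (MvPowerSeries.X i) = h (MvPowerSeries.X i)) : g = h := by
  have hpoly : ∀ P : MvPolynomial (Fin f) (intRing E),
      g (P : MvPowerSeries (Fin f) (intRing E)) = h (P : MvPowerSeries (Fin f) (intRing E)) := by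
    intro P
    have h1 : g.comp (MvPolynomial.coeToMvPowerSeries.algHom (intRing E))
        = h.comp (MvPolynomial.coeToMvPowerSeries.algHom (intRing E)) := by
      ext1 i
      simpa using H i
    have h2 := DFunLike.congr_fun h1 P
    simpa using h2
  have hbound : ∀ (g : MvPowerSeries (Fin f) (intRing E) →ₐ[intRing E] Laurent p s f E),
      (∀ F, ‖g F‖ ≤ 1) → (∀ i, ‖g (MvPowerSeries.X i)‖ ≤ rad p s) →
      ∀ (n : ℕ) (F), F ∈ varIdeal (intRing E) f ^ n → ‖g F‖ ≤ rad p s ^ n := by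
    intro g hg hgX n
    have hI : ∀ F ∈ varIdeal (intRing E) f, ‖g F‖ ≤ rad p s := by
      intro F hF
      refine Submodule.span_induction (p := fun x _ => ‖g x‖ ≤ rad p s) ?_ ?_ ?_ ?_ hF
      · rintro _ ⟨i, rfl⟩
        exact hgX i
      · rw [map_zero, norm_zero]
        exact rad_pos.le
      · intro x y _ _ hx hy
        rw [map_add]
        exact (IsUltrametricDist.norm_add_le_max _ _).trans (max_le hx hy)
      · intro a x _ hx
        rw [smul_eq_mul, map_mul]
        exact (norm_mul_le_of_le_one_left (hg a)).trans hx
    induction n with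
    | zero => intro F _; simpa using hg F
    | succ n ih =>
      intro F hF
      rw [pow_succ'] at hF
      refine Submodule.mul_induction_on hF (fun x hx y hy => ?_) fun x y hx hy => ?_
      · rw [map_mul, pow_succ']
        exact (Laurent.norm_mul_le _ _).trans
          (mul_le_mul (hI x hx) (ih y hy) (norm_nonneg _) rad_pos.le)
      · rw [map_add]
        exact (IsUltrametricDist.norm_add_le_max _ _).trans (max_le hx hy)
  ext1 F
  have key : ∀ n : ℕ, ‖g F - h F‖ ≤ rad p s ^ n := by
    intro n
    obtain ⟨P, hP⟩ := exists_sub_mem_varIdeal_pow F n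
    have h1 : g F - h F = g (F - P) - h (F - P) := by
      rw [map_sub, map_sub, hpoly, sub_sub_sub_cancel_right]
    rw [h1]
    exact (norm_sub_le_max_ultra _ _).trans (max_le (hbound g hg hgX n _ hP)
      (hbound h hh (fun i => H i ▸ hgX i) n _ hP))
  have h2 : ‖g F - h F‖ ≤ 0 := ge_of_tendsto'
    (tendsto_pow_atTop_nhds_zero_of_lt_one rad_pos.le (rad_lt_one hs)) key
  rwa [norm_le_zero_iff, sub_eq_zero] at h2

/-- Monomials as elements of `A^{†,s⁻}[1 / Y_0]`. -/
def intSingle (hs : 1 ≤ s) (k : Expo f) : ovRingInv p s f E :=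
  ⟨single k 1, single_mem_ovRingInv hs k⟩

lemma intSingle_add (hs : 1 ≤ s) (k l : Expo f) :
    (intSingle hs (k + l) : ovRingInv p s f E) = intSingle hs k * intSingle hs l :=
  Subtype.ext (by
    change (single (k + l) 1 : Laurent p s f E) = single k 1 * single l 1
    rw [single_mul_single, one_mul])

lemma intSingle_zero (hs : 1 ≤ s) : (intSingle hs 0 : ovRingInv p s f E) = 1 := rfl

lemma intSingle_mul_neg (hs : 1 ≤ s) (k : Expo f) :
    (intSingle hs k * intSingle hs (-k) : ovRingInv p s f E) = 1 := by
  rw [← intSingle_add, add_neg_cancel, intSingle_zero]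

lemma hasSum_intSingle (hs : 1 ≤ s) (x : ovRingInv p s f E) :
    HasSum (fun k => (⟨(x : Laurent p s f E).coeff k, (mem_ovRingInv_iff hs).mp x.2 k⟩ :
      intRing E) • (intSingle hs k : ovRingInv p s f E)) x :=
  (Topology.IsInducing.hasSum_iff (g := (ovRingInv p s f E).val) Topology.IsInducing.subtypeVal
    _ _).mp (hasSum_coeff_smul_single (x : Laurent p s f E))

/-- Continuous endomorphisms of `A^{†,s⁻}[1 / Y_0]` are determined by the images of the `Y_i`. -/
lemma ovRingInv_algHom_ext (hf : 0 < f) (hs : 1 ≤ s)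
    {g h : ovRingInv p s f E →ₐ[intRing E] ovRingInv p s f E} (hg : Continuous g)
    (hh : Continuous h) (H : ∀ i, g (intSingle hs (Yexp i)) = h (intSingle hs (Yexp i))) :
    g = h := by
  -- Exponents where `g` and `h` agree form a subgroup, inverses being unique, and it contains every
  -- `Yexp i`. Convergent expansion in monomials and continuity do the rest.
  let M : AddSubgroup (Expo f) :=
    { carrier := {k | g (intSingle hs k) = h (intSingle hs k)}
      add_mem' := fun {k l} hk hl => by
        change g (intSingle hs (k + l)) = h (intSingle hs (k + l))
        have hk' : g (intSingle hs k) = h (intSingle hs k) := hk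
        have hl' : g (intSingle hs l) = h (intSingle hs l) := hl
        rw [intSingle_add, map_mul, map_mul, hk', hl']
      zero_mem' := by
        change g (intSingle hs 0) = h (intSingle hs 0)
        rw [intSingle_zero, map_one, map_one]
      neg_mem' := fun {k} hk => by
        have hk' : g (intSingle hs k) = h (intSingle hs k) := hk
        change g (intSingle hs (-k)) = h (intSingle hs (-k))
        have h1 : g (intSingle hs (-k)) * g (intSingle hs k) = 1 := by
          rw [mul_comm, ← map_mul, intSingle_mul_neg, map_one]
        have h2 : g (intSingle hs k) * h (intSingle hs (-k)) = 1 := by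
          rw [hk', ← map_mul, intSingle_mul_neg, map_one]
        exact left_inv_eq_right_inv h1 h2 }
  have hM : ∀ k, g (intSingle hs k) = h (intSingle hs k) := expo_mem_of_Yexp_mem hf M H
  ext1 x
  refine ((hasSum_intSingle hs x).map g hg).unique
    (hasSum_of_eq ((hasSum_intSingle hs x).map h hh) fun k => ?_)
  rw [Function.comp_apply, Function.comp_apply, map_smul, map_smul, hM]

variable [Algebra ℚ_[p] E]
  {K : Type*} [NormedField K] [NormedAlgebra ℚ_[p] K] [IsUltrametricDist K]
  [FiniteDimensional ℚ_[p] K]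

/-- The standing assumptions: `K` is unramified of degree `f`, the norm of `E` is normalized, and
`Θ` identifies the power series ring with `O_E[[O_K]]`, sending `X_i` to `Y_{σ_i}`. -/
structure IsTheta (s : ℕ) (σ₀ : K →ₐ[ℚ_[p]] E)
    (Θ : MvPowerSeries (Fin f) (intRing E) ≃ₐ[intRing E] Iwasawa p E K) : Prop where
  map_X : ∀ i, Θ (MvPowerSeries.X i) = Ysig p f σ₀ i
  unramified : IsUnramified p K
  finrank_eq : Module.finrank ℚ_[p] K = f
  normalized : IsNormalizedPadicNorm p E
  one_le : 1 ≤ s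

namespace IsTheta

variable {σ₀ : K →ₐ[ℚ_[p]] E}
  {Θ : MvPowerSeries (Fin f) (intRing E) ≃ₐ[intRing E] Iwasawa p E K} (h : IsTheta s σ₀ Θ)

include h in
lemma pos : 0 < f := h.finrank_eq ▸ Module.finrank_pos

-- The Teichmüller representative `ζ` of `a` multiplies `Y_i` by the constant `c⁻¹` of norm one. The
-- actions of `a` and `ζ` on `Y_i` differ by at most `rad p s ^ 2`, so the quotient `w` of `a Y_i`
-- by `Y_i` satisfies `‖c w - 1‖ ≤ rad p s < 1` and is a unit.
include h in
lemma exists_unit_mul_eq_actY (a : (intRing K)ˣ) (i : Fin f) :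
    ∃ v : (ovRing p s f E)ˣ, Y i * ((v : ovRing p s f E) : Laurent p s f E) =
      actY Θ σ₀ h.one_le a i := by
  have hp1 : (1 : ℝ) < p := by exact_mod_cast (Fact.out : p.Prime).one_lt
  have hs := h.one_le
  have hna : ¬ (p : intRing K) ∣ a := by
    intro hd
    have h1 := (p_pow_dvd_iff (n := 1) (x := (a : intRing K))).mp (by rwa [pow_one])
    rw [norm_unit_eq_one, pow_one] at h1
    exact absurd (inv_lt_one_of_one_lt₀ hp1) (not_lt.mpr h1)
  obtain ⟨ζ, hζ⟩ := exists_teich h.unramified h.finrank_eq hna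
  set c := ζ.charInv σ₀ i with hc
  obtain ⟨c', hc'⟩ := (isUnit_of_norm_eq_one (norm_charInv σ₀ i ζ)).exists_left_inv
  set w : Laurent p s f E := single (-Yexp i) 1 * actY Θ σ₀ hs a i with hw
  have hYw : Y i * w = actY Θ σ₀ hs a i := by
    rw [hw, ← mul_assoc, Y_eq, single_mul_single_neg, one_mul]
  have h2 : ‖c • w - 1‖ ≤ rad p s := by
    have h3 : Y i * (c • w - 1) =
        c • (actY Θ σ₀ hs a i - actY Θ σ₀ hs (ζ.toInt p f) i : Laurent p s f E) := by
      rw [smul_sub, hc, charInv_smul_actY_teich h.map_X h.unramified h.finrank_eq, mul_sub, mul_one,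
        ← hYw, mul_smul_comm]
    have h4 : ‖Y i * (c • w - 1)‖ ≤ rad p s ^ (1 + 1) := by
      rw [h3]
      exact (norm_integer_smul_le _ _).trans (norm_actY_sub_le h.map_X h.unramified h.finrank_eq
        h.normalized hs (by rwa [pow_one]) i)
    rw [norm_Y_mul, pow_succ, pow_one] at h4
    exact le_of_mul_le_mul_left h4 rad_pos
  have hwW : w ∈ ovRingInv p s f E :=
    (ovRingInv p s f E).mul_mem (single_mem_ovRingInv hs _)
      (ovRing_le_ovRingInv (actY_mem_ovRing hs _ _))
  have hcw : c • w ∈ ovRing p s f E := by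
    refine mem_ovRing_of_mem_ovRingInv hs ((ovRingInv p s f E).smul_mem hwW c) ?_
    have h5 : c • w = (c • w - 1) + 1 := by ring
    rw [h5]
    refine (IsUltrametricDist.norm_add_le_max _ _).trans (max_le (h2.trans (rad_lt_one hs).le) ?_)
    exact norm_le_one_of_mem_ovRing (ovRing p s f E).one_mem
  have hc'w : c' • c • w = w := by rw [smul_smul, hc', one_smul]
  have hwR : w ∈ ovRing p s f E := hc'w ▸ (ovRing p s f E).smul_mem hcw c'
  have hunit : IsUnit (algebraMap (intRing E) (ovRing p s f E) c * ⟨w, hwR⟩) := by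
    apply isUnit_of_norm_sub_one_lt
    rw [← Algebra.smul_def]
    exact h2.trans_lt (rad_lt_one hs)
  obtain ⟨v, hv⟩ := isUnit_of_mul_isUnit_right hunit
  exact ⟨v, by rw [hv]; exact hYw⟩

/-- The unit `v` of `A^{†,s⁻}` such that `a` acts by `Y_i ↦ Y_i v`. -/
def actUnit (a : (intRing K)ˣ) (i : Fin f) : (ovRing p s f E)ˣ :=
  (h.exists_unit_mul_eq_actY a i).choose

lemma Y_mul_actUnit (a : (intRing K)ˣ) (i : Fin f) :
    Y i * ((h.actUnit a i : ovRing p s f E) : Laurent p s f E) = actY Θ σ₀ h.one_le a i :=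
  (h.exists_unit_mul_eq_actY a i).choose_spec

lemma Y_mul_actUnit_sub_one (a : (intRing K)ˣ) (i : Fin f) :
    Y i * (((h.actUnit a i : ovRing p s f E) : Laurent p s f E) - 1) =
      actY Θ σ₀ h.one_le a i - actY Θ σ₀ h.one_le 1 i := by
  rw [mul_sub, mul_one, h.Y_mul_actUnit, actY_one h.map_X]

/-- One of the `n + 1` factors in `norm_actY_sub_le` is spent on cancelling `Y_i`. -/
lemma norm_actUnit_sub_one_le {a : (intRing K)ˣ} {n : ℕ} (ha : (p : intRing K) ^ n ∣ a - 1)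
    (i : Fin f) :
    ‖((h.actUnit a i : ovRing p s f E) : Laurent p s f E) - 1‖ ≤ rad p s ^ n := by
  have h1 := norm_actY_sub_le h.map_X h.unramified h.finrank_eq h.normalized h.one_le ha i
  rw [← h.Y_mul_actUnit_sub_one, norm_Y_mul, pow_succ'] at h1
  exact le_of_mul_le_mul_left h1 rad_pos

/-- The action of `a ∈ O_K^×` on Laurent series. -/
def act (a : (intRing K)ˣ) : Laurent p s f E →ₐ[E] Laurent p s f E := subst h.pos (h.actUnit a)

lemma act_Y (a : (intRing K)ˣ) (i : Fin f) : h.act a (Y i) = actY Θ σ₀ h.one_le a i := by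
  rw [act, subst_Y, h.Y_mul_actUnit]

lemma norm_act_le (a : (intRing K)ˣ) (x : Laurent p s f E) : ‖h.act a x‖ ≤ ‖x‖ :=
  norm_subst_le _ _ _

/-- The substitution was built from the images of the `Y_i` alone. Both sides are bounded
homomorphisms on the power series ring agreeing on the variables, so `powerSeries_algHom_ext`
applies. -/
lemma act_embed (a : (intRing K)ˣ) (x : Iwasawa p E K) :
    h.act a (embed Θ h.one_le x) = embed Θ h.one_le (iwasawaHom p E (a : intRing K) x) := by
  have hs := h.one_le
  have h1 : ((h.act a).restrictScalars (intRing E)).comp (evalY f E hs) =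
      (embed Θ hs).comp ((iwasawaHom p E (a : intRing K)).comp
        (Θ : MvPowerSeries (Fin f) (intRing E) →ₐ[intRing E] Iwasawa p E K)) := by
    have hX : ∀ i, h.act a (evalY f E hs (MvPowerSeries.X i)) = actY Θ σ₀ hs a i := fun i => by
      rw [evalY_X, h.act_Y]
    refine powerSeries_algHom_ext hs (fun F => ?_) (fun F => norm_embed_le_one Θ hs _) (fun i => ?_)
      fun i => ?_
    · exact (h.norm_act_le _ _).trans (norm_le_one_of_mem_ovRing (evalY_mem_ovRing hs F))
    · change ‖h.act a (evalY f E hs (MvPowerSeries.X i))‖ ≤ rad p s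
      rw [evalY_X]
      exact (h.norm_act_le _ _).trans_eq (norm_Y i)
    · refine (hX i).trans ?_
      change _ = embed Θ hs (iwasawaHom p E (a : intRing K) (Θ (MvPowerSeries.X i)))
      rw [h.map_X]
      rfl
  have h2 := DFunLike.congr_fun h1 (Θ.symm x)
  refine h2.trans ?_
  change embed Θ hs (iwasawaHom p E (a : intRing K) (Θ (Θ.symm x))) = _
  rw [AlgEquiv.apply_symm_apply]

/-- The action of `a ∈ O_K^×` on `A^{†,s⁻}[1 / Y_0]`. -/
def actInt (a : (intRing K)ˣ) : ovRingInv p s f E →ₐ[intRing E] ovRingInv p s f E :=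
  (((h.act a).restrictScalars (intRing E)).comp (ovRingInv p s f E).val).codRestrict _
    fun x => subst_mem_ovRingInv h.pos h.one_le (h.actUnit a) x.2

lemma continuous_actInt (a : (intRing K)ˣ) : Continuous (h.actInt a) :=
  ((continuous_subst h.pos (h.actUnit a)).comp continuous_subtype_val).subtype_mk _

/-- By continuity it is enough to look at the `Y_i`, where `act_embed` reduces the law to the
Iwasawa algebra. -/
lemma actInt_mul (a b : (intRing K)ˣ) : h.actInt (a * b) = (h.actInt a).comp (h.actInt b) := by
  refine ovRingInv_algHom_ext h.pos h.one_le (h.continuous_actInt _)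
    ((h.continuous_actInt a).comp (h.continuous_actInt b)) fun i => Subtype.ext ?_
  change h.act (a * b) (Y i) = h.act a (h.act b (Y i))
  rw [h.act_Y, h.act_Y, actY, actY, h.act_embed, iwasawaHom_comp, Units.val_mul]

lemma actInt_one : h.actInt 1 = AlgHom.id _ _ := by
  refine ovRingInv_algHom_ext h.pos h.one_le (h.continuous_actInt _) continuous_id
    fun i => Subtype.ext ?_
  change h.act 1 (Y i) = Y i
  rw [h.act_Y, Units.val_one, actY_one h.map_X]

/-- The action of `O_K^×` on `A^{†,s⁻}[1 / Y_0]`. -/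
def action : (intRing K)ˣ →* (ovRingInv p s f E ≃ₐ[intRing E] ovRingInv p s f E) where
  toFun a := AlgEquiv.ofAlgHom (h.actInt a) (h.actInt a⁻¹)
    (by rw [← h.actInt_mul, mul_inv_cancel, h.actInt_one])
    (by rw [← h.actInt_mul, inv_mul_cancel, h.actInt_one])
  map_one' := by
    ext1 x
    exact DFunLike.congr_fun h.actInt_one x
  map_mul' a b := by
    ext1 x
    exact DFunLike.congr_fun (h.actInt_mul a b) x

lemma action_apply (a : (intRing K)ˣ) (x : ovRingInv p s f E) :
    (h.action a x : Laurent p s f E) = h.act a x := rfl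

lemma isCanonicalAction : IsCanonicalAction p s f σ₀ h.action := by
  refine ⟨h.continuous_actInt, Θ, h.map_X, fun a F x hx => ?_⟩
  rw [h.action_apply, hx, ← evalY_apply h.one_le, ← embed_theta Θ, h.act_embed]
  rfl

/-- The isomorphism inside `IsCanonicalAction` is only asserted to exist, but `theta_unique`
identifies it with `Θ`. The values on the `Y_i` are then prescribed, and continuity determines the
rest. -/
lemma eq_action {ρ : (intRing K)ˣ →* (ovRingInv p s f E ≃ₐ[intRing E] ovRingInv p s f E)}
    (hρ : IsCanonicalAction p s f σ₀ ρ) : ρ = h.action := by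
  obtain ⟨hc, Θ', hΘ', hρ⟩ := hρ
  obtain rfl := theta_unique h.map_X hΘ'
  ext1 a
  have h1 : ((ρ a : ovRingInv p s f E ≃ₐ[intRing E] ovRingInv p s f E) :
      ovRingInv p s f E →ₐ[intRing E] ovRingInv p s f E) = h.actInt a := by
    refine ovRingInv_algHom_ext h.pos h.one_le (hc a) (h.continuous_actInt a)
      fun i => Subtype.ext ?_
    refine (hρ a (MvPowerSeries.X i) (intSingle h.one_le (Yexp i))
      (evalY_X h.one_le i).symm).trans ?_
    change _ = h.act a (Y i)
    rw [h.act_Y, h.map_X]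
    rfl
  ext1 x
  exact DFunLike.congr_fun h1 x

/-- The congruence exponent `s` enters through `rad p s ^ s = p⁻¹`, which bounds the distance of
every `actUnit` from one. -/
lemma norm_act_sub_le {a : (intRing K)ˣ} (ha : (p : intRing K) ^ s ∣ a - 1)
    {x : Laurent p s f E} (hx : ‖x‖ ≤ 1) : ‖h.act a x - x‖ ≤ (p : ℝ)⁻¹ := by
  have hp0 : (0 : ℝ) ≤ (p : ℝ)⁻¹ := inv_nonneg.mpr (Nat.cast_nonneg _)
  have h1 := norm_subst_sub_le h.pos hp0 (v := h.actUnit a)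
    (fun i => (h.norm_actUnit_sub_one_le ha i).trans_eq (rad_pow h.one_le)) x
  exact h1.trans (mul_le_of_le_one_right hp0 hx)

end IsTheta

lemma inv_le_rpow_neg_inv_sub_one : (p : ℝ)⁻¹ ≤ (p : ℝ) ^ (-(1 : ℝ) / ((p : ℝ) - 1)) := by
  have hp2 : (2 : ℝ) ≤ p := by exact_mod_cast (Fact.out : p.Prime).two_le
  rw [← Real.rpow_neg_one]
  refine Real.rpow_le_rpow_of_exponent_le (by linarith) ?_
  rw [le_div_iff₀ (by linarith)]
  linarith

end ActionConstruction

/-! ### Local analyticity of the action -/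

section AnalyticProducts

variable {p : ℕ} [Fact p.Prime] {f : ℕ} {E : Type*} [NormedField E] [IsUltrametricDist E]
  [Algebra ℚ_[p] E] {S : Type*} [NormedCommRing S] [NormedAlgebra E S] {P : Type*}
  [IsUltrametricDist S] [CompleteSpace S] [NormOneClass S] {τ : P → Fin f → ℤ_[p]} {C : ℝ}

namespace IsAnalyticIn

lemma of_sub_one (hE : IsNormalizedPadicNorm p E) (hC : C ≤ 1) {o : P → S}
    (h : IsAnalyticIn E τ C fun x => o x - 1) : IsAnalyticIn E τ 1 o := by
  have h1 := (h.mono hC).add hE ((const τ (1 : S)).mono norm_one.le)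
  simpa using h1

lemma mul_sub_one (hE : IsNormalizedPadicNorm p E) (hC : C ≤ 1) {o o' : P → S}
    (h : IsAnalyticIn E τ C fun x => o x - 1) (h' : IsAnalyticIn E τ C fun x => o' x - 1) :
    IsAnalyticIn E τ C fun x => o x * o' x - 1 := by
  have h1 := ((h.mul hE (h'.of_sub_one hE hC)).mono (mul_one C).le).add hE h'
  refine (congrArg (IsAnalyticIn E τ C) (funext fun x => ?_)).mp h1
  ring

lemma prod_sub_one (hE : IsNormalizedPadicNorm p E) (hC0 : 0 ≤ C) (hC : C ≤ 1) {ι : Type*}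
    (t : Finset ι) {o : ι → P → S} (h : ∀ i, IsAnalyticIn E τ C fun x => o i x - 1) :
    IsAnalyticIn E τ C fun x => ∏ i ∈ t, o i x - 1 := by
  classical
  induction t using Finset.induction_on with
  | empty =>
    have := (const (E := E) τ (0 : S)).mono (norm_zero.trans_le hC0)
    simpa using this
  | insert a t ha ih =>
    simp only [Finset.prod_insert ha]
    exact (h a).mul_sub_one hE hC ih

lemma smul (hE : IsNormalizedPadicNorm p E) (c : E) {o : P → S} (h : IsAnalyticIn E τ C o) :
    IsAnalyticIn E τ (‖c‖ * C) fun x => c • o x := by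
  have h1 := h.const_mul hE (c • (1 : S))
  rw [norm_smul, norm_one, mul_one] at h1
  simpa using h1

end IsAnalyticIn

/-- By Legendre's formula the valuation of `n!` is at most `n`. This crude bound suffices since the
neighbourhood of `1` may be shrunk freely. -/
lemma pow_norm_le_norm_factorial (hE : IsNormalizedPadicNorm p E) (n : ℕ) :
    ‖(p : E)‖ ^ n ≤ ‖(n.factorial : E)‖ := by
  have hp := (Fact.out : p.Prime)
  have hp1 : (1 : ℝ) < p := by exact_mod_cast hp.one_lt
  obtain ⟨v, u, hu, hn⟩ := Nat.exists_eq_pow_mul_and_not_dvd n.factorial_ne_zero p hp.ne_one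
  have hv : v ≤ n := by
    have h1 := (padicValNat_dvd_iff_le n.factorial_ne_zero).mp (Dvd.intro u hn.symm)
    have h2 := sub_one_mul_padicValNat_factorial (p := p) n
    have h3 := Nat.le_mul_of_pos_left (padicValNat p n.factorial) (Nat.sub_pos_of_lt hp.one_lt)
    omega
  have hu1 : ‖(u : E)‖ = 1 := by
    have h1 : ‖(u : ℚ_[p])‖ = 1 := by
      refine le_antisymm (IsUltrametricDist.norm_natCast_le_one _ _) (not_lt.mp fun h => hu ?_)
      exact Padic.norm_natCast_lt_one_iff.mp h
    obtain ⟨e, -, he⟩ := hE.restrict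
    rw [← map_natCast (algebraMap ℚ_[p] E), he, h1, one_pow]
  rw [hn, Nat.cast_mul, Nat.cast_pow, norm_mul, norm_pow, hu1, mul_one]
  exact pow_le_pow_of_le_one (norm_nonneg _)
    (hE.norm_natCast_le.trans (inv_lt_one_of_one_lt₀ hp1).le) hv

/-- The factor `‖p‖` pays for the denominator `n!`; the factor `c` is left for convergence. -/
lemma norm_inv_factorial_smul_pow_le (hE : IsNormalizedPadicNorm p E) {z : S} {c : ℝ}
    (hz : ‖z‖ ≤ c * ‖(p : E)‖) (n : ℕ) : ‖(n.factorial : E)⁻¹ • z ^ n‖ ≤ c ^ n := by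
  have hp0 : 0 < ‖(p : E)‖ := by
    rw [norm_pos_iff, ← map_natCast (algebraMap ℚ_[p] E), Ne, map_eq_zero]
    exact_mod_cast (Fact.out : p.Prime).ne_zero
  have h1 := pow_norm_le_norm_factorial hE n
  have h2 : 0 < ‖(n.factorial : E)‖ := (pow_pos hp0 n).trans_le h1
  rw [norm_smul, norm_inv, inv_mul_le_iff₀ h2]
  calc ‖z ^ n‖ ≤ ‖z‖ ^ n := norm_pow_le _ _
    _ ≤ (c * ‖(p : E)‖) ^ n := pow_le_pow_left₀ (norm_nonneg _) hz n
    _ = ‖(p : E)‖ ^ n * c ^ n := by rw [mul_pow, mul_comm]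
    _ ≤ _ := by
      refine mul_le_mul_of_nonneg_right h1 (pow_nonneg ?_ n)
      exact nonneg_of_mul_nonneg_left ((norm_nonneg _).trans hz) hp0

end AnalyticProducts

section LaurentAnalytic

variable {p : ℕ} [Fact p.Prime] {s f : ℕ} {E : Type*} [NormedField E] [IsUltrametricDist E]
  [CompleteSpace E] [Algebra ℚ_[p] E] {P : Type*} {τ : P → Fin f → ℤ_[p]} {C : ℝ}

open Laurent

attribute [local instance] Laurent.normedCommRing Laurent.normedAlgebra Laurent.normOneClass

variable (p s f E) in
/-- The units of `A^{†,s⁻}` depending analytically on parameters, together with their inverses. -/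
def analyticUnits (hE : IsNormalizedPadicNorm p E) (τ : P → Fin f → ℤ_[p]) :
    Subgroup (P → (ovRing p s f E)ˣ) where
  carrier := {u | IsAnalyticIn E τ 1 (fun x => (((u x : (ovRing p s f E)ˣ) : ovRing p s f E) :
    Laurent p s f E)) ∧ IsAnalyticIn E τ 1 (fun x => ((((u x)⁻¹ : (ovRing p s f E)ˣ) :
      ovRing p s f E) : Laurent p s f E))}
  one_mem' := by
    have h1 : IsAnalyticIn E τ 1 fun _ => (1 : Laurent p s f E) :=
      (IsAnalyticIn.const τ _).mono norm_one.le
    refine ⟨h1, ?_⟩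
    have h2 : (fun x => (((((1 : P → (ovRing p s f E)ˣ) x)⁻¹ : (ovRing p s f E)ˣ) :
      ovRing p s f E) : Laurent p s f E)) = fun _ => 1 := by
      funext x
      rw [Pi.one_apply, inv_one]
      rfl
    rwa [h2]
  mul_mem' {u v} hu hv := by
    refine ⟨(hu.1.mul hE hv.1).mono (mul_one 1).le, ?_⟩
    have h1 := (hu.2.mul hE hv.2).mono (mul_one 1).le
    refine (congrArg (IsAnalyticIn E τ 1) (funext fun x => ?_)).mp h1
    rw [Pi.mul_apply, mul_inv]
    rfl
  inv_mem' {u} hu := by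
    refine ⟨hu.2, ?_⟩
    have h1 := hu.1
    refine (congrArg (IsAnalyticIn E τ 1) (funext fun x => ?_)).mp h1
    rw [Pi.inv_apply, inv_inv]

lemma mem_analyticUnits (hE : IsNormalizedPadicNorm p E) (hC : C < 1)
    {u : P → (ovRing p s f E)ˣ}
    (hu : IsAnalyticIn E τ C fun x => ((u x : ovRing p s f E) : Laurent p s f E) - 1)
    (hu1 : ∀ x, ‖((u x : ovRing p s f E) : Laurent p s f E) - 1‖ < 1) :
    u ∈ analyticUnits p s f E hE τ :=
  ⟨hu.of_sub_one hE hC.le, hu.inverse hE hC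
    (fun x => congrArg Subtype.val (u x).inv_mul) hu1⟩

/-- Since `analyticUnits` is a group, negative exponents cause no trouble and every `twist` is
analytic with bound one. The term of exponent `k` has bound `‖a.coeff k‖ * weight p s k`, which
tends to zero, so the terms can be summed. -/
lemma isAnalyticIn_subst (hE : IsNormalizedPadicNorm p E) (hf : 0 < f)
    {v : Fin f → P → (ovRing p s f E)ˣ} (hv : ∀ i, v i ∈ analyticUnits p s f E hE τ)
    (a : Laurent p s f E) : IsAnalyticIn E τ ‖a‖ fun x => subst hf (fun i => v i x) a := by
  have h1 : ∀ k : Expo f, IsAnalyticIn E τ (‖a.coeff k‖ * weight p s k)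
      fun x => a.coeff k • (twistedSingle hf (fun i => v i x) k : Laurent p s f E) := by
    intro k
    have h2 := (twist_mem hf hv k).1
    have h3 := ((h2.const_mul hE (single k 1)).smul hE (a.coeff k)).mono
      (D := ‖a.coeff k‖ * weight p s k) (by rw [norm_single, norm_one, one_mul, mul_one])
    refine (congrArg (IsAnalyticIn E τ _) (funext fun x => ?_)).mp h3
    have h4 : twist hf v k x = twist hf (fun i => v i x) k := by
      simp [twist]
    rw [h4]
    rfl
  exact IsAnalyticIn.tsum hE h1 a.tendsto_coeff (norm_nonneg _) a.le_norm
    fun x => hasSum_subst hf _ a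

end LaurentAnalytic

section LocalAnalyticity

variable {p : ℕ} [Fact p.Prime] {s f : ℕ} {E : Type*} [NormedField E] [IsUltrametricDist E]
  [CompleteSpace E] [Algebra ℚ_[p] E]
  {K : Type*} [NormedField K] [NormedAlgebra ℚ_[p] K] [IsUltrametricDist K]
  [FiniteDimensional ℚ_[p] K] {σ₀ : K →ₐ[ℚ_[p]] E}
  {Θ : MvPowerSeries (Fin f) (intRing E) ≃ₐ[intRing E] Iwasawa p E K}

open Laurent

attribute [local instance] Laurent.normedCommRing Laurent.normedAlgebra Laurent.normOneClass

lemma padicIntToInt_pow_dvd {t u : ℤ_[p]} {N : ℕ} (h : (p : ℤ_[p]) ^ N ∣ t - u) (y : intRing K) :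
    (p : intRing K) ^ N ∣ padicIntToInt p K t * y - padicIntToInt p K u * y := by
  rw [← sub_mul, ← map_sub]
  have h1 := map_dvd (padicIntToInt p K) h
  rw [map_pow, map_natCast] at h1
  exact h1.mul_right _

lemma embed_groupLike_sum (hs : 1 ≤ s) {ι : Type*} (t : Finset ι) (y : ι → intRing K) :
    (embed Θ hs (groupLike p E (∑ j ∈ t, y j)) : Laurent p s f E) =
      ∏ j ∈ t, embed Θ hs (groupLike p E (y j)) := by
  classical
  induction t using Finset.induction_on with
  | empty => rw [Finset.sum_empty, Finset.prod_empty, groupLike_zero, map_one]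
  | insert a t ha ih => rw [Finset.sum_insert ha, Finset.prod_insert ha, embed_groupLike_add, ih]

namespace IsTheta

variable (h : IsTheta s σ₀ Θ)

-- The map `t ↦ [t y]` is `p`-adically continuous and equals `[y] ^ N` at natural numbers, so the
-- binomial series in `[y] - 1` interpolates it.
include h in
lemma hasSum_binomTerm_embed {c : ℝ} (hc : c < 1) {y : intRing K}
    (hy : ‖(embed Θ h.one_le (groupLike p E y) : Laurent p s f E) - 1‖ ≤ c * ‖(p : E)‖) (t : ℤ_[p]) :
    HasSum (binomTerm E t ((embed Θ h.one_le (groupLike p E y) : Laurent p s f E) - 1))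
      (embed Θ h.one_le (groupLike p E (padicIntToInt p K t * y))) := by
  have hz := norm_inv_factorial_smul_pow_le h.normalized hy
  have hc0 : 0 ≤ c := by simpa using (norm_nonneg _).trans (hz 1)
  refine hasSum_binomTerm (g := fun t => embed Θ h.one_le (groupLike p E (padicIntToInt p K t * y)))
    (δ := fun N => rad p s ^ (N + 1)) h.normalized
    (squeeze_zero_norm hz (tendsto_pow_atTop_nhds_zero_of_lt_one hc0 hc))
    (fun n => (hz n).trans (pow_le_one₀ hc0 hc.le)) (fun N => ?_) ?_ (fun t u N htu => ?_) t
  · rw [map_natCast, groupLike_natCast_mul, map_pow, add_sub_cancel]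
  · exact (tendsto_add_atTop_iff_nat 1).mpr
      (tendsto_pow_atTop_nhds_zero_of_lt_one rad_pos.le (rad_lt_one h.one_le))
  · exact norm_embed_groupLike_sub_le h.map_X h.unramified h.finrank_eq h.normalized h.one_le
      (padicIntToInt_pow_dvd htu y)

variable {P : Type*} {τ : P → Fin f → ℤ_[p]}

include h in
lemma isAnalyticIn_embed {c : ℝ} (hc : c < 1) {y : Fin f → intRing K}
    (hy : ∀ j, ‖(embed Θ h.one_le (groupLike p E (y j)) : Laurent p s f E) - 1‖ ≤ c * ‖(p : E)‖)
    (hc0 : 0 ≤ c) : IsAnalyticIn E τ c fun x =>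
      (embed Θ h.one_le (groupLike p E (∑ j, padicIntToInt p K (τ x j) * y j)) :
        Laurent p s f E) - 1 := by
  simp only [embed_groupLike_sum]
  refine IsAnalyticIn.prod_sub_one h.normalized hc0 hc.le _ fun j => ?_
  exact isAnalyticIn_binomial h.normalized τ j hc
    (norm_inv_factorial_smul_pow_le h.normalized (hy j))
    fun x => h.hasSum_binomTerm_embed hc (hy j) (τ x j)

-- From `[γ ζ] - [ζ] = [ζ] ([(γ - 1) ζ] - 1)` one reduces to `isAnalyticIn_embed`, with `he` making
-- each `[p ^ e b_j ζ] - 1` small against `p`. The bound `rad p s ^ 2` still leaves `rad p s < 1`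
-- after division by `Y_i`.
include h in
lemma isAnalyticIn_actY {e : ℕ} (he : rad p s ^ (e + 1) ≤ rad p s ^ 2 * ‖(p : E)‖)
    {b : Fin f → intRing K} {γ : P → (intRing K)ˣ}
    (hγ : ∀ x, (γ x : intRing K) = 1 + (p : intRing K) ^ e * ∑ j, padicIntToInt p K (τ x j) * b j)
    (i : Fin f) : IsAnalyticIn E τ (rad p s ^ 2) fun x =>
      actY Θ σ₀ h.one_le (γ x : intRing K) i - (actY Θ σ₀ h.one_le 1 i : Laurent p s f E) := by
  have hr1 : rad p s ^ 2 < 1 := pow_lt_one₀ rad_pos.le (rad_lt_one h.one_le) two_ne_zero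
  have hr0 : 0 ≤ rad p s ^ 2 := pow_nonneg rad_pos.le 2
  have h1 : ∀ ζ : Teich p f K, IsAnalyticIn E τ (rad p s ^ 2) fun x => ζ.charInv σ₀ i •
      ((embed Θ h.one_le (groupLike p E (1 * ζ.toInt p f)) : Laurent p s f E) *
        (embed Θ h.one_le (groupLike p E (∑ j, padicIntToInt p K (τ x j) *
          ((p : intRing K) ^ e * (b j * ζ.toInt p f)))) - 1)) := by
    intro ζ
    have h2 := h.isAnalyticIn_embed (τ := τ) hr1
      (y := fun j => (p : intRing K) ^ e * (b j * ζ.toInt p f))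
      (fun j => (norm_embed_groupLike_pow_mul_sub_one_le h.map_X h.unramified h.finrank_eq
        h.normalized h.one_le e _).trans he) hr0
    have h3 := (h2.const_mul h.normalized
      (embed Θ h.one_le (groupLike p E (1 * ζ.toInt p f)))).mono
      (mul_le_of_le_one_left hr0 (norm_embed_le_one Θ h.one_le _))
    exact (h3.smul h.normalized (ζ.charInv σ₀ i : E)).mono
      (mul_le_of_le_one_left hr0 (ζ.charInv σ₀ i).2)
  have h4 := IsAnalyticIn.sum h.normalized hr0 h1
  refine (congrArg (IsAnalyticIn E τ _) (funext fun x => ?_)).mp h4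
  rw [actY_eq_sum h.unramified h.finrank_eq, actY_eq_sum h.unramified h.finrank_eq,
    ← Finset.sum_sub_distrib]
  refine Finset.sum_congr rfl fun ζ _ => ?_
  have h5 : (γ x : intRing K) * ζ.toInt p f = 1 * ζ.toInt p f +
      ∑ j, padicIntToInt p K (τ x j) * ((p : intRing K) ^ e * (b j * ζ.toInt p f)) := by
    rw [hγ, add_mul, Finset.mul_sum, Finset.sum_mul]
    congr 1
    refine Finset.sum_congr rfl fun j _ => ?_
    ring
  rw [h5, embed_groupLike_add, ← smul_sub, sub_sub_sub_cancel_right, mul_sub, mul_one]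

include h in
lemma isAnalyticIn_act {e : ℕ} (he : rad p s ^ (e + 1) ≤ rad p s ^ 2 * ‖(p : E)‖) (he1 : 1 ≤ e)
    {b : Fin f → intRing K} {γ : P → (intRing K)ˣ}
    (hγ : ∀ x, (γ x : intRing K) = 1 + (p : intRing K) ^ e * ∑ j, padicIntToInt p K (τ x j) * b j)
    (a : Laurent p s f E) : IsAnalyticIn E τ ‖a‖ fun x => h.act (γ x) a := by
  have hr := rad_lt_one (p := p) h.one_le
  refine isAnalyticIn_subst h.normalized h.pos (v := fun i x => h.actUnit (γ x) i) (fun i => ?_) a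
  refine mem_analyticUnits h.normalized hr ?_ fun x => ?_
  · have h1 := (h.isAnalyticIn_actY he hγ i).const_mul h.normalized (single (-Yexp i) 1)
    have h2 : ‖(single (-Yexp i) 1 : Laurent p s f E)‖ * rad p s ^ 2 ≤ rad p s := by
      have h3 : weight p s (-Yexp i) * rad p s = 1 := by
        rw [← weight_Yexp i, ← weight_add, neg_add_cancel, weight_zero]
      rw [norm_single, norm_one, one_mul, pow_two, ← mul_assoc, h3, one_mul]
    refine (congrArg (IsAnalyticIn E τ _) (funext fun x => ?_)).mp (h1.mono h2)
    rw [← h.Y_mul_actUnit_sub_one, ← mul_assoc, mul_comm (single (-Yexp i) 1), Y_eq,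
      single_mul_single_neg, one_mul]
  · refine (h.norm_actUnit_sub_one_le (n := e) ?_ i).trans_lt
      (pow_lt_one₀ rad_pos.le hr (by omega))
    rw [hγ, add_sub_cancel_left]
    exact dvd_mul_right _ _

include h in
lemma isLocallyAnalyticAction : IsLocallyAnalyticAction p s f h.action := by
  intro a b
  have hp1 : (1 : ℝ) < p := by exact_mod_cast (Fact.out : p.Prime).one_lt
  have hpE : 0 < ‖(p : E)‖ := by
    rw [norm_pos_iff, ← map_natCast (algebraMap ℚ_[p] E), Ne, map_eq_zero]
    exact_mod_cast (Fact.out : p.Prime).ne_zero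
  have hr := rad_lt_one (p := p) h.one_le
  obtain ⟨m₀, hm₀⟩ : ∃ m₀ : ℕ, ∀ j, ‖(p : K) ^ m₀ * b j‖ ≤ 1 := by
    have h1 : ∀ j, ∀ᶠ m : ℕ in atTop, ‖(p : K) ^ m * b j‖ ≤ 1 := by
      intro j
      have h2 : Tendsto (fun m : ℕ => ((p : ℝ)⁻¹) ^ m * ‖b j‖) atTop (𝓝 (0 * ‖b j‖)) :=
        (tendsto_pow_atTop_nhds_zero_of_lt_one (by positivity)
          (inv_lt_one_of_one_lt₀ hp1)).mul_const _
      rw [zero_mul] at h2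
      refine (h2.eventually (eventually_le_nhds zero_lt_one)).mono fun m hm => ?_
      rwa [norm_mul, norm_pow, norm_natCast_p]
    exact (eventually_all.mpr h1).exists
  -- For `e = N + 1` the condition `he` amounts to `rad p s ^ N ≤ ‖p‖`. The chart uses `m = m₀ + (N
  -- + 1)`, where `p ^ m₀` makes the basis integral.
  obtain ⟨N, hN⟩ := exists_pow_lt_of_lt_one hpE hr
  have he : rad p s ^ (N + 1 + 1) ≤ rad p s ^ 2 * ‖(p : E)‖ := by
    rw [show N + 1 + 1 = 2 + N by omega, pow_add]
    exact mul_le_mul_of_nonneg_left hN.le (pow_nonneg rad_pos.le 2)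
  let b' : Fin f → intRing K := fun j => ⟨(p : K) ^ m₀ * b j, hm₀ j⟩
  -- Taking as parameters the pairs `(t, γ)` related by the chart avoids constructing a unit from
  -- `t`, while one family `w` serves all of them.
  obtain ⟨w, hw, -, hsum⟩ := h.isAnalyticIn_act
    (P := {x : (Fin f → ℤ_[p]) × (intRing K)ˣ // (x.2 : intRing K) =
      1 + (p : intRing K) ^ (N + 1) * ∑ j, padicIntToInt p K (x.1 j) * b' j})
    (τ := fun x => x.1.1) (γ := fun x => x.1.2) he (Nat.le_add_left 1 N) (fun x => x.2)
    (a : Laurent p s f E)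
  refine ⟨m₀ + (N + 1), w, hw, fun t γ hγ => ?_⟩
  refine hsum ⟨(t, γ), Subtype.ext (hγ.trans ?_)⟩
  change _ = 1 + (p : K) ^ (N + 1) * ((∑ j, padicIntToInt p K (t j) * b' j : intRing K) : K)
  rw [AddSubmonoidClass.coe_finsetSum, pow_add, mul_comm ((p : K) ^ m₀), mul_assoc]
  congr 2
  rw [Finset.mul_sum]
  refine Finset.sum_congr rfl fun j _ => ?_
  change _ = algebraMap ℚ_[p] K (t j : ℚ_[p]) * ((p : K) ^ m₀ * b j)
  rw [Algebra.smul_def]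
  ring

end IsTheta

end LocalAnalyticity

end MultivarOC

end

theorem mainTheorem11 (p : ℕ) [Fact p.Prime]
    (K : Type*) [NormedField K] [NormedAlgebra ℚ_[p] K] [IsUltrametricDist K]
    [FiniteDimensional ℚ_[p] K] (hK : IsUnramified p K)
    (f : ℕ) (hf : Module.finrank ℚ_[p] K = f)
    (E : Type*) [NormedField E] [IsUltrametricDist E] [CompleteSpace E]
    [Algebra ℚ_[p] E] [FiniteDimensional ℚ_[p] E] (hE : IsNormalizedPadicNorm p E)
    (σ₀ : K →ₐ[ℚ_[p]] E) (s : ℕ) (hs : 1 ≤ s) :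
    (∃! ρ : (intRing K)ˣ →* (ovRingInv p s f E ≃ₐ[intRing E] ovRingInv p s f E),
      IsCanonicalAction p s f σ₀ ρ) ∧
    ∀ ρ : (intRing K)ˣ →* (ovRingInv p s f E ≃ₐ[intRing E] ovRingInv p s f E),
      IsCanonicalAction p s f σ₀ ρ →
        IsLocallyAnalyticAction p s f ρ ∧
        ∀ (γ : (intRing K)ˣ) (x : ovRingInv p s f E),
          ((γ : intRing K) - 1) ∈ Ideal.span {(p : intRing K) ^ s} →
          (x : Laurent p s f E) ∈ ovRing p s f E →
          ‖((ρ γ x - x : ovRingInv p s f E) : Laurent p s f E)‖ ≤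
            (p : ℝ) ^ (-(1 : ℝ) / ((p : ℝ) - 1)) := by
  obtain ⟨Θ, hΘ⟩ := exists_theta hK hf hE σ₀
  have h : IsTheta s σ₀ Θ := ⟨hΘ, hK, hf, hE, hs⟩
  refine ⟨⟨h.action, h.isCanonicalAction, fun ρ hρ => h.eq_action hρ⟩, fun ρ hρ => ?_⟩
  obtain rfl := h.eq_action hρ
  refine ⟨h.isLocallyAnalyticAction, fun γ x hγ hx => ?_⟩
  exact (h.norm_act_sub_le (Ideal.mem_span_singleton.mp hγ)
    (norm_le_one_of_mem_ovRing hx)).trans inv_le_rpow_neg_inv_sub_one
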